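/- Let $(M^n,g_{ij}(t))$, $t\in(0,T]$, be a Ricci flow $\partial_t g_{ij}=-2R_{ij}$, smooth on $M\times(0,T]$, with each $g(t)$ complete and with uniformly bounded curvature $|\mathrm{Rm}|\le C_0$. For $N\in\mathbb N$ let $(\mathbb H^N,g_{\alpha\beta})$ be hyperbolic space of constant sectional curvature $-\frac1{2N}$. On $\tilde M=M\times\mathbb H^N\times(0,T]$ let $\tilde g$ be given by $$\tilde g_{ij}=g_{ij},\qquad \tilde g_{\alpha\beta}=t\,g_{\alpha\beta},\qquad \tilde g_{00}=R-\frac N{2t},\qquad \tilde g_{i\alpha}=\tilde g_{0i}=\tilde g_{0\alpha}=0,$$ where $i,j$ are coordinate indices on $M$, $\alpha,\beta$ on $\mathbb H^N$, $0$ is the index of the coordinate $t$, and $R$ is the scalar curvature of $g(t)$. Conventions: $R_{abcd}=\langle \mathrm{Rm}(\partial_a,\partial_b)\partial_c,\partial_d\rangle$ with $\mathrm{Rm}(X,Y)Z=\nabla_Y\nabla_XZ-\nabla_X\nabla_YZ+\nabla_{[X,Y]}Z$, $R_{ab}=g^{cd}R_{acbd}$, $R=g^{ab}R_{ab}$; a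 tilde denotes the same quantities for $\tilde g$. Put $$P_{ijk}=\nabla_iR_{jk}-\nabla_jR_{ik},\qquad M_{ij}=\Delta R_{ij}-\tfrac12\nabla_i\nabla_jR+2R_{ikjl}R^{kl}-R_{ik}R_j{}^k+\tfrac1{2t}R_{ij},$$ $$Z(U,X)=R_{ijkl}U^{ij}U^{kl}+2P_{ijk}U^{ij}X^k+M_{ij}X^iX^j .$$ Then: (0) There is $N_0$ such that $\tilde g_{00}<0$ on all of $\tilde M$ for $N\ge N_0$, so that $\tilde g$ is a Lorentzian metric. Moreover, for every chart of $M$ with domain $\mathcal U$ and every compact $K\subset \mathcal U\times(0,T]$ there are $C$ and $N_1$, depending on the flow, the chart and $K$ but not on $N$, such that for all $N\ge N_1$, at all points of $\tilde M$ with $(x,t)\in K$ and arbitrary $y\in\mathbb H^N$: (1) ($\tilde g$ is Ricci flat up to $O(1/N)$) $|\tilde R_{ab}V^aV^b|\le \frac CN|V|^2$ for all tangent vectors $V$; (2) $|\tilde R_{ijkl}-R_{ijkl}|\le\frac CN$, $\ |\tilde R_{ij0k}-P_{ijk}|\le\frac CN$, $\ |\tilde R_{i0j0}-M_{ij}|\le\frac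 CN$ for all $i,j,k,l$; in particular these components converge to $R_{ijkl}$, $P_{ijk}$, $M_{ij}$ as $N\to\infty$; (3) (Hamilton's Harnack expression is the full curvature operator up to $O(1/N)$) for every antisymmetric $W^{ab}$, with $U^{ij}=W^{ij}$ and $X^k=2W^{0k}$, $$\bigl|\tilde R_{abcd}W^{ab}W^{cd}-Z(U,X)\bigr|\le\frac CN|W|^2 .$$ Here $|V|$ and $|W|$ (with $|W|^2$ the sum over all ordered index pairs) are taken with respect to the inner product $\sum_i(dx^i)^2+g_{\alpha\beta}dy^\alpha dy^\beta+dt^2$. At $t=T$, time derivatives are one-sided. -/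

import Mathlib

open scoped Manifold ContDiff Topology Bundle
open Set Filter Manifold Bundle

noncomputable section

/-! ## Tensor calculus in coordinates -/

/-- The components `coeff z a b = g_ab(z)` of a (pseudo-)Riemannian metric in a coordinate system:
`domain` is the set of coordinate values in the vector space `Z`, and `frame a` is the
coordinate direction `∂_a`. -/
structure MetricPatch (ι Z : Type*) where
  /-- the coordinate directions -/
  frame : ι → Z
  /-- the range of the coordinates -/
  domain : Set Z
  /-- the matrix of components of the metric -/
  coeff : Z → Matrix ι ι ℝ

namespace MetricPatch

variable {ι Z : Type*} [Fintype ι] [DecidableEq ι] [AddCommGroup Z] [Module ℝ Z]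

/-- The partial derivative `∂_a f`, taken within the coordinate domain (so that it is one-sided
at a boundary point of the domain). -/
def pd (L : MetricPatch ι Z) (a : ι) (f : Z → ℝ) (z : Z) : ℝ :=
  lineDerivWithin ℝ f L.domain z (L.frame a)

/-- The inverse metric `g^{ab}`. -/
def inv (L : MetricPatch ι Z) (a b : ι) (z : Z) : ℝ := (L.coeff z)⁻¹ a b

/-- Christoffel symbols
`Γ^a_{bc} = ½ g^{ad} (∂_b g_{cd} + ∂_c g_{bd} - ∂_d g_{bc})`. -/
def christoffel (L : MetricPatch ι Z) (a b c : ι) (z : Z) : ℝ :=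
  (1 / 2) * ∑ d, L.inv a d z *
    (L.pd b (fun w => L.coeff w c d) z + L.pd c (fun w => L.coeff w b d) z
      - L.pd d (fun w => L.coeff w b c) z)

/-- The curvature tensor with one index raised: `Rm(∂_a, ∂_b) ∂_c = R_{abc}^f ∂_f` where
`Rm(X, Y) Z = ∇_Y ∇_X Z - ∇_X ∇_Y Z + ∇_{[X,Y]} Z`. -/
def riemannUp (L : MetricPatch ι Z) (a b c f : ι) (z : Z) : ℝ :=
  L.pd b (L.christoffel f a c) z - L.pd a (L.christoffel f b c) z
    + ∑ e, (L.christoffel e a c z * L.christoffel f b e z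
      - L.christoffel e b c z * L.christoffel f a e z)

/-- The curvature tensor `R_{abcd} = g_{fd} R_{abc}^f`; with this convention `R_{abab} > 0` on the
round sphere. -/
def riemann (L : MetricPatch ι Z) (a b c d : ι) (z : Z) : ℝ :=
  ∑ f, L.coeff z f d * L.riemannUp a b c f z

/-- The Ricci tensor `R_{ab} = g^{cd} R_{acbd}`. -/
def ricci (L : MetricPatch ι Z) (a b : ι) (z : Z) : ℝ :=
  ∑ c, ∑ d, L.inv c d z * L.riemann a c b d z

/-- The scalar curvature `R = g^{ab} R_{ab}`. -/
def scalar (L : MetricPatch ι Z) (z : Z) : ℝ :=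
  ∑ a, ∑ b, L.inv a b z * L.ricci a b z

/-- `|Rm|² = g^{ae} g^{bf} g^{cg} g^{dh} R_{abcd} R_{efgh}`. -/
def riemannNormSq (L : MetricPatch ι Z) (z : Z) : ℝ :=
  ∑ a, ∑ b, ∑ c, ∑ d, ∑ a', ∑ b', ∑ c', ∑ d',
    L.inv a a' z * L.inv b b' z * L.inv c c' z * L.inv d d' z *
      (L.riemann a b c d z * L.riemann a' b' c' d' z)

/-- The Hessian of a function: `∇_a ∇_b f = ∂_a ∂_b f - Γ^m_{ab} ∂_m f`. -/
def hess (L : MetricPatch ι Z) (f : Z → ℝ) (a b : ι) (z : Z) : ℝ :=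
  L.pd a (L.pd b f) z - ∑ m, L.christoffel m a b z * L.pd m f z

/-- The covariant derivative of a 2-tensor: `cov L A c a b = ∇_c A_{ab}`. -/
def cov (L : MetricPatch ι Z) (A : ι → ι → Z → ℝ) (c a b : ι) (z : Z) : ℝ :=
  L.pd c (A a b) z
    - ∑ m, (L.christoffel m c a z * A m b z + L.christoffel m c b z * A a m z)

/-- The second covariant derivative of a 2-tensor: `cov₂ L A d c a b = ∇_d ∇_c A_{ab}`. -/
def cov₂ (L : MetricPatch ι Z) (A : ι → ι → Z → ℝ) (d c a b : ι) (z : Z) : ℝ :=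
  L.pd d (L.cov A c a b) z
    - ∑ m, (L.christoffel m d c z * L.cov A m a b z + L.christoffel m d a z * L.cov A c m b z
        + L.christoffel m d b z * L.cov A c a m z)

/-- The Laplacian of a 2-tensor: `Δ A_{ab} = g^{dc} ∇_d ∇_c A_{ab}`. -/
def lap (L : MetricPatch ι Z) (A : ι → ι → Z → ℝ) (a b : ι) (z : Z) : ℝ :=
  ∑ d, ∑ c, L.inv d c z * L.cov₂ A d c a b z

/-- The Ricci tensor with both indices raised, `R^{kl}`. -/
def ricciUp (L : MetricPatch ι Z) (k l : ι) (z : Z) : ℝ :=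
  ∑ p, ∑ q, L.inv k p z * L.inv l q z * L.ricci p q z

/-- Hamilton's `P_{ijk} = ∇_i R_{jk} - ∇_j R_{ik}`. -/
def harnackP (L : MetricPatch ι Z) (i j k : ι) (z : Z) : ℝ :=
  L.cov L.ricci i j k z - L.cov L.ricci j i k z

/-- Hamilton's
`M_{ij} = Δ R_{ij} - ½ ∇_i ∇_j R + 2 R_{ikjl} R^{kl} - R_{ik} R_j^k + (1 / 2t) R_{ij}`. -/
def harnackM (L : MetricPatch ι Z) (t : ℝ) (i j : ι) (z : Z) : ℝ :=
  L.lap L.ricci i j z - (1 / 2) * L.hess L.scalar i j z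
    + 2 * ∑ k, ∑ l, L.riemann i k j l z * L.ricciUp k l z
    - ∑ k, ∑ l, L.inv k l z * L.ricci i k z * L.ricci l j z
    + 1 / (2 * t) * L.ricci i j z

/-- Hamilton's Harnack expression
`Z(U, X) = R_{ijkl} U^{ij} U^{kl} + 2 P_{ijk} U^{ij} X^k + M_{ij} X^i X^j`. -/
def harnackZ (L : MetricPatch ι Z) (t : ℝ) (U : ι → ι → ℝ) (X : ι → ℝ) (z : Z) : ℝ :=
  (∑ i, ∑ j, ∑ k, ∑ l, L.riemann i j k l z * U i j * U k l)
    + 2 * (∑ i, ∑ j, ∑ k, L.harnackP i j k z * U i j * X k)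
    + ∑ i, ∑ j, L.harnackM t i j z * X i * X j

end MetricPatch

/-! ## Ricci flows -/

section Flow

variable {n : ℕ} {M : Type*} [TopologicalSpace M] [ChartedSpace (EuclideanSpace ℝ (Fin n)) M]
  [IsManifold (𝓡 n) ∞ M]

/-- Smooth Riemannian metrics on the manifold `M`. -/
abbrev SmoothMetric (n : ℕ) (M : Type*) [TopologicalSpace M]
    [ChartedSpace (EuclideanSpace ℝ (Fin n)) M] [IsManifold (𝓡 n) ∞ M] :=
  ContMDiffRiemannianMetric (𝓡 n) ∞ (EuclideanSpace ℝ (Fin n)) (TangentSpace (𝓡 n) : M → Type _)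

/-- The coordinate vector field `∂_i` of the chart `φ`, at the point with coordinates `x`. -/
def coordVec (φ : OpenPartialHomeomorph M (EuclideanSpace ℝ (Fin n))) (i : Fin n)
    (x : EuclideanSpace ℝ (Fin n)) : TangentSpace (𝓡 n) (φ.symm x) :=
  mfderiv (𝓡 n) (𝓡 n) φ.symm x (EuclideanSpace.single i (1 : ℝ))

/-- The metric `h` in the coordinates of the chart `φ`: `h_ij = h(∂_i, ∂_j)`. -/
def chartPatch (h : SmoothMetric n M) (φ : OpenPartialHomeomorph M (EuclideanSpace ℝ (Fin n))) :
    MetricPatch (Fin n) (EuclideanSpace ℝ (Fin n)) where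
  frame i := EuclideanSpace.single i (1 : ℝ)
  domain := φ.target
  coeff x := Matrix.of fun i j => h.inner (φ.symm x) (coordVec φ i x) (coordVec φ j x)

/-- `g(t)`, `0 < t ≤ T`, is a Ricci flow: it is smooth in space and time, and `∂_t g = -2 Ric`. -/
structure IsRicciFlow (g : ℝ → SmoothMetric n M) (T : ℝ) : Prop where
  smooth : ∀ φ ∈ IsManifold.maximalAtlas (𝓡 n) ∞ M, ∀ i j : Fin n,
    ContDiffOn ℝ ∞ (fun p : EuclideanSpace ℝ (Fin n) × ℝ => (chartPatch (g p.2) φ).coeff p.1 i j)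
      (φ.target ×ˢ Ioc 0 T)
  evolution : ∀ φ ∈ IsManifold.maximalAtlas (𝓡 n) ∞ M, ∀ i j : Fin n, ∀ x ∈ φ.target,
    ∀ t ∈ Ioc 0 T,
      HasDerivWithinAt (fun s => (chartPatch (g s) φ).coeff x i j)
        (-2 * (chartPatch (g t) φ).ricci i j x) (Ioc 0 T) t

/-- The Riemannian distance of the metric `h`. -/
def SmoothMetric.edist (h : SmoothMetric n M) (x y : M) : ENNReal :=
  letI : RiemannianBundle (TangentSpace (𝓡 n) : M → Type _) := ⟨h.toRiemannianMetric⟩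
  riemannianEDist (𝓡 n) x y

/-- The metric `h` is complete: every Cauchy sequence for its distance converges in `M`. -/
def SmoothMetric.IsComplete (h : SmoothMetric n M) : Prop :=
  ∀ u : ℕ → M,
    (∀ ε : ENNReal, 0 < ε → ∃ m, ∀ p ≥ m, ∀ q ≥ m, SmoothMetric.edist h (u p) (u q) < ε) →
      ∃ x, Tendsto u atTop (𝓝 x)

/-- The curvature is uniformly bounded: `|Rm| ≤ C` on `M × (0, T]`. -/
def HasBoundedCurvature (g : ℝ → SmoothMetric n M) (T : ℝ) : Prop :=
  ∃ C : ℝ, ∀ φ ∈ IsManifold.maximalAtlas (𝓡 n) ∞ M, ∀ x ∈ φ.target, ∀ t ∈ Ioc 0 T,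
    Real.sqrt ((chartPatch (g t) φ).riemannNormSq x) ≤ C

/-! ## The hyperbolic thermostat -/

/-- The metric of hyperbolic space `ℍ^N` with constant sectional curvature `-1 / (2N)`, in the
Poincaré model on the unit ball of `ℝ^N`: it is `2N` times the metric `4 |dy|² / (1 - |y|²)²` of
curvature `-1`. -/
def hyperbolicPatch (N : ℕ) : MetricPatch (Fin N) (EuclideanSpace ℝ (Fin N)) where
  frame α := EuclideanSpace.single α (1 : ℝ)
  domain := Metric.ball 0 1
  coeff y := (2 * (N : ℝ) * (4 / (1 - ‖y‖ ^ 2) ^ 2)) • (1 : Matrix (Fin N) (Fin N) ℝ)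

/-- Coordinate indices on `M × ℍ^N × (0, T]`. -/
abbrev TIdx (n N : ℕ) := Fin n ⊕ Fin N ⊕ Unit

/-- Coordinate values `(x, y, t)` on `M × ℍ^N × (0, T]`. -/
abbrev TSpace (n N : ℕ) := EuclideanSpace ℝ (Fin n) × EuclideanSpace ℝ (Fin N) × ℝ

/-- The index `i` of a coordinate on the `M` factor. -/
abbrev iM {n N : ℕ} (i : Fin n) : TIdx n N := Sum.inl i

/-- The index `α` of a coordinate on the `ℍ^N` factor. -/
abbrev iH {n N : ℕ} (α : Fin N) : TIdx n N := Sum.inr (Sum.inl α)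

/-- The index `0` of the time coordinate. -/
abbrev i0 {n N : ℕ} : TIdx n N := Sum.inr (Sum.inr ())

/-- The metric of the hyperbolic thermostat on `M × ℍ^N × (0, T]`, in the product of a chart `φ` of
`M`, the ball coordinates of `ℍ^N` and the time coordinate:
`g_ij` on `M`, `t g_αβ` on `ℍ^N`, `R - N / (2t)` on `(0, T]`, and no mixed components. -/
def thermostatPatch (g : ℝ → SmoothMetric n M) (T : ℝ)
    (φ : OpenPartialHomeomorph M (EuclideanSpace ℝ (Fin n))) (N : ℕ) :
    MetricPatch (TIdx n N) (TSpace n N) where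
  frame
    | Sum.inl i => (EuclideanSpace.single i 1, 0, 0)
    | Sum.inr (Sum.inl α) => (0, EuclideanSpace.single α 1, 0)
    | Sum.inr (Sum.inr _) => (0, 0, 1)
  domain := φ.target ×ˢ Metric.ball 0 1 ×ˢ Ioc 0 T
  coeff z := Matrix.of fun a b =>
    match a, b with
    | Sum.inl i, Sum.inl j => (chartPatch (g z.2.2) φ).coeff z.1 i j
    | Sum.inr (Sum.inl α), Sum.inr (Sum.inl β) => z.2.2 * (hyperbolicPatch N).coeff z.2.1 α β
    | Sum.inr (Sum.inr _), Sum.inr (Sum.inr _) =>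
        (chartPatch (g z.2.2) φ).scalar z.1 - (N : ℝ) / (2 * z.2.2)
    | _, _ => 0

end Flow

/-- The reference inner product `∑ dx_i² + g_{ℍ^N} + dt²` in which components are measured: the
Euclidean one of the coordinates in the directions of `M` and of time, and the hyperbolic metric
in the directions of `ℍ^N`. -/
def refCoeff (n : ℕ) {N : ℕ} (y : EuclideanSpace ℝ (Fin N)) :
    Matrix (TIdx n N) (TIdx n N) ℝ :=
  Matrix.of fun a b =>
    match a, b with
    | Sum.inl i, Sum.inl j => if i = j then 1 else 0
    | Sum.inr (Sum.inl α), Sum.inr (Sum.inl β) => (hyperbolicPatch N).coeff y α β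
    | Sum.inr (Sum.inr _), Sum.inr (Sum.inr _) => 1
    | _, _ => 0

/-- `|V|²` of a vector `V^a` in the reference inner product. -/
def vecNormSq {n N : ℕ} (y : EuclideanSpace ℝ (Fin N)) (V : TIdx n N → ℝ) : ℝ :=
  ∑ a, ∑ b, refCoeff n y a b * V a * V b

/-- `|W|²` of a 2-vector `W^{ab}` in the reference inner product. -/
def bivecNormSq {n N : ℕ} (y : EuclideanSpace ℝ (Fin N)) (W : TIdx n N → TIdx n N → ℝ) : ℝ :=
  ∑ a, ∑ b, ∑ c, ∑ d, refCoeff n y a c * refCoeff n y b d * W a b * W c d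

end

/-!
The theorem is a computation of the full curvature tensor of the thermostat metric, followed by
elementary estimates. Write `G = R - N / (2t)` for the coefficient of `dt²`, and `ε = 1 / G`. Since
`|Rm|` is bounded, so is `R` (`HasBoundedCurvature.scalar_le`), hence `G ≤ -N / (4T)` and `ε` is
`O(1/N)` for large `N`.

The components of the curvature are, exactly,

* `R̃_ijkl = R_ijkl - ε (R_ik R_jl - R_jk R_il)`,
* `R̃_ij0k = P_ijk + ½ ε (R_ik ∂_j R - R_jk ∂_i R)`,
* `R̃_i0j0 = M_ij + ε (¼ ∂_i R ∂_j R - ½ (∂_t R + R / t) R_ij)`,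
* `R̃_iαjβ`, `R̃_iα0β`, `R̃_0α0β`, which are `ε g_αβ` times quantities not involving `N`, and
* `R̃_αβγδ`, which is `-ε t R / (2N)` times `g_αγ g_βδ - g_αδ g_βγ`,

with `g_αβ` the metric of `ℍ^N`; the components of the remaining types vanish (`riem_MMMM`,
`riem_MM0M`, `riem_M0M0`, `riem_MHMH`, `riem_MH0H`, `riem_0H0H`, `riem_HHHH`, `hypCoeff_eq`).
The term `∂_t R_ij` in `R̃_i0j0` becomes part of `M_ij` through the evolution of the Ricci tensor
under Ricci flow, `∂_t R_ij = ΔR_ij + 2 R_ikjl R^kl - 2 R_ik R_j^k` (`CoordMetric.D_ric`). In the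
block along `ℍ^N`, the curvature `-1 / (2N)` is the one for which the terms of leading order cancel.

The Ricci tensor is a trace over `N` directions along `ℍ^N`, so the factor `ε` alone does not make
it small. But `N ε / t = 2 (ε R - 1)` (`N_mul_ε`), so that the trace along `ℍ^N` equals a
quantity that does not involve `N`, up to `O(ε)`, and this quantity is cancelled by the trace over
`M`: the cancellations are the contracted second Bianchi identity (`CoordMetric.two_mul_divRic`) and
the evolution of `R`, in the form `g^ij P_kij = ½ ∂_k R` and `g^ij M_ij = ½ (∂_t R + R / t)`
(`sum_gi_harnackP`, `sum_gi_harnackM`).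

These computations use only the rules of calculus, so they are carried out in an arbitrary
commutative `ℝ`-algebra with commuting derivations (`CoordMetric`, `Thermostat`). The
algebra to which they are applied is that of smooth functions on the range of the coordinates
`(x, y, t)`, which includes the boundary `t = T`: functions that agree there are identified
(`SmoothFun`), and the derivatives within the range are then commuting derivations. The coordinate
expressions of the theorem are values of elements of this algebra (`MetricRep`).

All errors are products of `ε` with bounded functions of `ε` and of quantities of the flow at
`(x, t)`. The latter are continuous and do not depend on `N`, so they are bounded on compact sets,
uniformly in `N` and in the point of `ℍ^N` (`IsRicciFlow.exists_bound`). In the quadratic forms, the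
coordinates along `ℍ^N` enter through `g_αβ` only, so the number of terms that are estimated
separately depends on the dimension of `M` and not on `N` (`Thermostat.Bound.ricci_le`,
`Thermostat.Bound.curvature_le`).
-/

noncomputable section

/-! ### Riemannian geometry over a commutative ring with commuting derivations -/

/-- Components of a metric in coordinates, with entries in a commutative `ℝ`-algebra `A` carrying
commuting derivations `D a` in the role of the partial derivatives `∂_a`. -/
structure CoordMetric (ι A : Type*) [Fintype ι] [DecidableEq ι] [CommRing A] [Algebra ℝ A] where
  /-- the partial derivatives -/
  D : ι → Derivation ℝ A A
  D_comm : ∀ a b f, D a (D b f) = D b (D a f)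
  /-- the metric `g_ab` -/
  g : Matrix ι ι A
  /-- the inverse metric `g^{ab}` -/
  gi : Matrix ι ι A
  g_symm : ∀ a b, g a b = g b a
  gi_mul : gi * g = 1

/-- A derivation applied to all entries of a matrix. -/
def Derivation.onMatrix {ι A : Type*} [CommRing A] [Algebra ℝ A]
    (d : Derivation ℝ A A) (X : Matrix ι ι A) : Matrix ι ι A := X.map d

namespace Derivation

variable {ι A : Type*} [CommRing A] [Algebra ℝ A]
  (d : Derivation ℝ A A) (X Y : Matrix ι ι A)

lemma onMatrix_apply (a b : ι) : d.onMatrix X a b = d (X a b) := rfl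

lemma onMatrix_add : d.onMatrix (X + Y) = d.onMatrix X + d.onMatrix Y := by
  ext; simp [onMatrix]

lemma onMatrix_sub : d.onMatrix (X - Y) = d.onMatrix X - d.onMatrix Y := by
  ext; simp [onMatrix]

lemma onMatrix_neg : d.onMatrix (-X) = -d.onMatrix X := by
  ext; simp [onMatrix]

lemma onMatrix_one [DecidableEq ι] : d.onMatrix (1 : Matrix ι ι A) = 0 := by
  ext a b; by_cases h : a = b <;> simp [onMatrix, h]

lemma onMatrix_mul [Fintype ι] : d.onMatrix (X * Y) = d.onMatrix X * Y + X * d.onMatrix Y := by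
  ext a b
  simp only [onMatrix, Matrix.map_apply, Matrix.mul_apply, Matrix.add_apply, map_sum,
    Derivation.leibniz, smul_eq_mul, Finset.sum_add_distrib]
  rw [add_comm]
  congr 1
  exact Finset.sum_congr rfl fun _ _ => mul_comm _ _

lemma onMatrix_transpose : d.onMatrix X.transpose = (d.onMatrix X).transpose := by
  ext; simp [onMatrix]

end Derivation

namespace CoordMetric

variable {ι A : Type*} [Fintype ι] [DecidableEq ι] [CommRing A] [Algebra ℝ A]
  (L : CoordMetric ι A)

/-- Christoffel symbols `Γ^k_{ab}`. -/
def chr (k a b : ι) : A :=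
  (1 / 2 : ℝ) • ∑ d, L.gi k d * (L.D a (L.g b d) + L.D b (L.g a d) - L.D d (L.g a b))

/-- The curvature `R_{abc}^f`. -/
def rUp (a b c f : ι) : A :=
  L.D b (L.chr f a c) - L.D a (L.chr f b c)
    + ∑ e, (L.chr e a c * L.chr f b e - L.chr e b c * L.chr f a e)

/-- The curvature `R_{abcd}`. -/
def riem (a b c d : ι) : A := ∑ f, L.g f d * L.rUp a b c f

/-- The Ricci tensor `R_{ab}`. -/
def ric (a b : ι) : A := ∑ c, ∑ d, L.gi c d * L.riem a c b d

/-- The scalar curvature. -/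
def scal : A := ∑ a, ∑ b, L.gi a b * L.ric a b

/-- The Hessian of a function. -/
def hess (f : A) (a b : ι) : A := L.D a (L.D b f) - ∑ m, L.chr m a b * L.D m f

/-- The covariant derivative `∇_c B_{ab}` of a 2-tensor. -/
def cov (B : ι → ι → A) (c a b : ι) : A :=
  L.D c (B a b) - ∑ m, (L.chr m c a * B m b + L.chr m c b * B a m)

/-- The second covariant derivative `∇_d ∇_c B_{ab}` of a 2-tensor. -/
def cov2 (B : ι → ι → A) (d c a b : ι) : A :=
  L.D d (L.cov B c a b)
    - ∑ m, (L.chr m d c * L.cov B m a b + L.chr m d a * L.cov B c m b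
        + L.chr m d b * L.cov B c a m)

/-- The Laplacian of a 2-tensor. -/
def lap (B : ι → ι → A) (a b : ι) : A := ∑ d, ∑ c, L.gi d c * L.cov2 B d c a b

/-- The connection matrix `(Γ_a)^k_b = Γ^k_{ab}`. -/
def conn (a : ι) : Matrix ι ι A := Matrix.of fun k b => L.chr k a b

/-- The curvature matrix `(Ω_{ab})^f_c = R_{abc}^f`. -/
def curv (a b : ι) : Matrix ι ι A :=
  (L.D b).onMatrix (L.conn a) - (L.D a).onMatrix (L.conn b)
    + (L.conn b * L.conn a - L.conn a * L.conn b)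

lemma conn_apply (a k b : ι) : L.conn a k b = L.chr k a b := rfl

lemma g_transpose : L.g.transpose = L.g := by
  ext a b; exact L.g_symm b a

lemma mul_gi : L.g * L.gi = 1 := mul_eq_one_comm.mp L.gi_mul

lemma gi_transpose : L.gi.transpose = L.gi := by
  have h : L.gi.transpose * L.g = 1 := by
    rw [← L.g_transpose, ← Matrix.transpose_mul, L.mul_gi, Matrix.transpose_one]
  calc L.gi.transpose = L.gi.transpose * (L.g * L.gi) := by rw [L.mul_gi, Matrix.mul_one]
    _ = L.gi := by rw [← Matrix.mul_assoc, h, Matrix.one_mul]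

lemma gi_symm (a b : ι) : L.gi a b = L.gi b a := by
  conv_lhs => rw [← L.gi_transpose]
  rfl

lemma curv_apply (a b f c : ι) : L.curv a b f c = L.rUp a b c f := by
  simp only [curv, rUp, Matrix.add_apply, Matrix.sub_apply, Matrix.mul_apply, conn_apply,
    Derivation.onMatrix_apply, Finset.sum_sub_distrib]
  congr 2 <;> exact Finset.sum_congr rfl fun _ _ => mul_comm _ _

lemma riem_eq (a b c d : ι) : L.riem a b c d = (L.g * L.curv a b) d c := by
  simp only [riem, Matrix.mul_apply, curv_apply]
  exact Finset.sum_congr rfl fun f _ => by rw [L.g_symm]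

lemma chr_symm (k a b : ι) : L.chr k a b = L.chr k b a := by
  simp only [chr]
  congr 1
  refine Finset.sum_congr rfl fun d _ => ?_
  rw [L.g_symm a b]; ring

/-- The lowered Christoffel symbols `Γ_{ab,c} = ½ (∂_a g_bc + ∂_b g_ac - ∂_c g_ab)`. -/
lemma g_mul_conn (a b c : ι) : (L.g * L.conn a) c b =
    (1 / 2 : ℝ) • (L.D a (L.g b c) + L.D b (L.g a c) - L.D c (L.g a b)) := by
  set v : ι → A := fun d => L.D a (L.g b d) + L.D b (L.g a d) - L.D d (L.g a b) with hv
  have h1 : ∀ k, L.conn a k b = (1 / 2 : ℝ) • (L.gi.mulVec v) k := fun k => rfl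
  have h2 : (L.g * L.conn a) c b = (1 / 2 : ℝ) • (L.g.mulVec (L.gi.mulVec v)) c := by
    simp only [Matrix.mul_apply, h1, mul_smul_comm, ← Finset.smul_sum]
    rfl
  rw [h2, Matrix.mulVec_mulVec, L.mul_gi, Matrix.one_mulVec]

/-- The metric is parallel: `∂_a g = Γ_aᵀ g + g Γ_a`. -/
lemma D_g (a : ι) : (L.D a).onMatrix L.g = (L.conn a).transpose * L.g + L.g * L.conn a := by
  ext b c
  have h : ((L.conn a).transpose * L.g) b c = (L.g * L.conn a) c b := by
    conv_lhs => rw [← L.g_transpose, ← Matrix.transpose_mul]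
    rfl
  rw [Matrix.add_apply, h, g_mul_conn, g_mul_conn, Derivation.onMatrix_apply, ← smul_add,
    L.g_symm c b]
  have : L.D a (L.g b c) + L.D b (L.g a c) - L.D c (L.g a b) +
      (L.D a (L.g b c) + L.D c (L.g a b) - L.D b (L.g a c)) = (2 : ℝ) • L.D a (L.g b c) := by
    rw [two_smul]; ring
  rw [this, smul_smul]; norm_num

/-- The inverse metric is parallel: `∂_a g⁻¹ = -(Γ_a g⁻¹ + g⁻¹ Γ_aᵀ)`. -/
lemma D_gi (a : ι) :
    (L.D a).onMatrix L.gi = -(L.conn a * L.gi + L.gi * (L.conn a).transpose) := by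
  have h := congrArg (L.D a).onMatrix L.gi_mul
  rw [Derivation.onMatrix_mul, Derivation.onMatrix_one, D_g] at h
  have h2 := congrArg (· * L.gi) h
  simp only [Matrix.add_mul, Matrix.mul_add, Matrix.mul_assoc, Matrix.zero_mul, L.mul_gi,
    Matrix.mul_one] at h2
  rw [← Matrix.mul_assoc L.gi L.g, L.gi_mul, Matrix.one_mul] at h2
  rw [eq_neg_of_add_eq_zero_left h2, add_comm]

/-! ### Symmetries of the curvature tensor -/

lemma rUp_antisymm (a b c f : ι) : L.rUp a b c f = -L.rUp b a c f := by
  simp only [rUp, Finset.sum_sub_distrib]; ring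

lemma curv_antisymm (a b : ι) : L.curv a b = -L.curv b a := by
  simp only [curv]; abel

lemma riem_antisymm (a b c d : ι) : L.riem a b c d = -L.riem b a c d := by
  simp only [riem, L.rUp_antisymm a b, mul_neg, Finset.sum_neg_distrib]

/-- The curvature endomorphisms are skew for the metric, since the metric is parallel. -/
lemma g_mul_curv (a b : ι) :
    (L.curv a b).transpose * L.g + L.g * L.curv a b = 0 := by
  have hc : (L.D b).onMatrix ((L.D a).onMatrix L.g) = (L.D a).onMatrix ((L.D b).onMatrix L.g) := by
    ext i j; exact L.D_comm _ _ _
  rw [L.D_g a, L.D_g b] at hc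
  simp only [Derivation.onMatrix_add, Derivation.onMatrix_mul, Derivation.onMatrix_transpose,
    L.D_g a, L.D_g b] at hc
  have h2 := sub_eq_zero.mpr hc
  simp only [curv, Matrix.transpose_add, Matrix.transpose_sub, Matrix.transpose_mul]
  rw [← h2]
  noncomm_ring

lemma riem_antisymm' (a b c d : ι) : L.riem a b c d = -L.riem a b d c := by
  have h := congrFun (congrFun (L.g_mul_curv a b) c) d
  have h1 : ((L.curv a b).transpose * L.g) c d = (L.g * L.curv a b) d c := by
    conv_lhs => rw [← L.g_transpose, ← Matrix.transpose_mul]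
    rfl
  rw [Matrix.add_apply, h1, ← riem_eq, ← riem_eq] at h
  exact eq_neg_of_add_eq_zero_left h

/-- The first Bianchi identity. -/
lemma rUp_bianchi (a b c f : ι) : L.rUp a b c f + L.rUp b c a f + L.rUp c a b f = 0 := by
  simp only [rUp, Finset.sum_sub_distrib]
  have e1 : ∀ x y z, ∑ e, L.chr e x y * L.chr f z e = ∑ e, L.chr e y x * L.chr f z e :=
    fun x y z => Finset.sum_congr rfl fun e _ => by rw [L.chr_symm e x y]
  rw [e1 c b a, e1 b a c, e1 c a b, L.chr_symm f c b, L.chr_symm f b a, L.chr_symm f c a]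
  ring

lemma riem_bianchi (a b c d : ι) : L.riem a b c d + L.riem b c a d + L.riem c a b d = 0 := by
  simp only [riem, ← Finset.sum_add_distrib, ← mul_add, rUp_bianchi, mul_zero,
    Finset.sum_const_zero]

lemma eq_of_two_mul {x y : A} (h : 2 * x = 2 * y) : x = y := by
  have h2 : (2 : ℝ) • x = (2 : ℝ) • y := by rw [two_smul, two_smul, ← two_mul, ← two_mul, h]
  have := congrArg (fun z => (1 / 2 : ℝ) • z) h2
  simpa [smul_smul] using this

lemma riem_pair (a b c d : ι) : L.riem a b c d = L.riem c d a b := by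
  apply eq_of_two_mul
  have h1 := L.riem_bianchi a b c d
  have h2 := L.riem_bianchi b c d a
  have h3 := L.riem_bianchi c d a b
  have h4 := L.riem_bianchi d a b c
  rw [L.riem_antisymm' b c d a, L.riem_antisymm' c d b a, L.riem_antisymm d b c a] at h2
  rw [L.riem_antisymm d a c b, L.riem_antisymm' a d c b, L.riem_antisymm a c d b,
    L.riem_antisymm' c a d b] at h3
  rw [L.riem_antisymm d a b c, L.riem_antisymm' a b d c, L.riem_antisymm' b d a c] at h4
  linear_combination h1 + h2 - h3 - h4

/-- The Ricci tensor as a trace of the curvature endomorphisms. -/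
lemma ric_eq (a b : ι) : L.ric a b = ∑ c, L.rUp a c b c := by
  simp only [ric]
  refine Finset.sum_congr rfl fun c _ => ?_
  simp only [riem_eq]
  have : (L.gi * (L.g * L.curv a c)) c b = L.rUp a c b c := by
    rw [← Matrix.mul_assoc, L.gi_mul, Matrix.one_mul, curv_apply]
  rw [← this, Matrix.mul_apply]

lemma ric_symm (a b : ι) : L.ric a b = L.ric b a := by
  simp only [ric]
  rw [Finset.sum_comm]
  refine Finset.sum_congr rfl fun c _ => Finset.sum_congr rfl fun d _ => ?_
  rw [L.riem_pair, L.gi_symm]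

end CoordMetric

namespace CoordMetric

variable {ι A : Type*} [Fintype ι] [DecidableEq ι] [CommRing A] [Algebra ℝ A]
  (L : CoordMetric ι A)

/-! ### The contracted second Bianchi identity -/

/-- The Ricci tensor as a matrix. -/
def ricM : Matrix ι ι A := Matrix.of L.ric

/-- The Ricci tensor with one index raised. -/
def ricMix : Matrix ι ι A := L.ricM * L.gi

/-- The covariant derivative `∇_a X = ∂_a X - Γ_aᵀ X - X Γ_a` of a matrix with two lower indices. -/
def covM (a : ι) (X : Matrix ι ι A) : Matrix ι ι A :=
  (L.D a).onMatrix X - (L.conn a).transpose * X - X * L.conn a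

/-- The covariant derivative `∇_a U = ∂_a U + Γ_a U + U Γ_aᵀ` of a matrix with two upper indices. -/
def covUp (a : ι) (U : Matrix ι ι A) : Matrix ι ι A :=
  (L.D a).onMatrix U + L.conn a * U + U * (L.conn a).transpose

/-- The curvature `R_{ab}{}^{fe}` with both endomorphism indices raised. -/
def curvUp (a b : ι) : Matrix ι ι A := L.curv a b * L.gi

lemma cov_eq (B : ι → ι → A) (c a b : ι) : L.cov B c a b = L.covM c (Matrix.of B) a b := by
  simp only [cov, covM, Matrix.sub_apply, Matrix.mul_apply, Derivation.onMatrix_apply,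
    Matrix.of_apply, Matrix.transpose_apply, conn_apply, Finset.sum_add_distrib]
  rw [Finset.sum_congr rfl fun m _ => mul_comm (L.chr m c b) (B a m)]
  ring

lemma ricM_transpose : L.ricM.transpose = L.ricM := by
  ext a b; exact L.ric_symm b a

lemma covM_transpose (a : ι) (X : Matrix ι ι A) :
    (L.covM a X).transpose = L.covM a X.transpose := by
  simp only [covM, Matrix.transpose_sub, Matrix.transpose_mul, Derivation.onMatrix_transpose,
    Matrix.transpose_transpose]
  abel

lemma cov_ric_symm (c a b : ι) : L.cov L.ric c a b = L.cov L.ric c b a := by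
  have h := congrFun (congrFun (L.covM_transpose c L.ricM) b) a
  rw [ricM_transpose] at h
  rw [cov_eq, cov_eq]; exact h

lemma covUp_transpose (a : ι) (X : Matrix ι ι A) :
    (L.covUp a X).transpose = L.covUp a X.transpose := by
  simp only [covUp, Matrix.transpose_add, Matrix.transpose_mul, Derivation.onMatrix_transpose,
    Matrix.transpose_transpose]
  abel

lemma covUp_neg (a : ι) (X : Matrix ι ι A) : L.covUp a (-X) = -L.covUp a X := by
  simp only [covUp, Derivation.onMatrix_neg, Matrix.mul_neg, Matrix.neg_mul]
  abel

lemma curvUp_transpose (a b : ι) : (L.curvUp a b).transpose = -L.curvUp a b := by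
  have h := L.g_mul_curv a b
  have h2 := congrArg (fun X => L.gi * X * L.gi) h
  simp only [Matrix.mul_add, Matrix.add_mul, Matrix.mul_zero, Matrix.zero_mul] at h2
  rw [Matrix.mul_assoc, Matrix.mul_assoc, L.mul_gi, Matrix.mul_one, ← Matrix.mul_assoc L.gi L.g,
    L.gi_mul, Matrix.one_mul] at h2
  rw [curvUp, Matrix.transpose_mul, L.gi_transpose]
  exact eq_neg_of_add_eq_zero_left h2

lemma curvUp_skew (a b f e : ι) : L.curvUp a b f e = -L.curvUp a b e f :=
  congrFun (congrFun (L.curvUp_transpose a b) e) f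

lemma curvUp_antisymm (a b : ι) : L.curvUp a b = -L.curvUp b a := by
  rw [curvUp, curvUp, L.curv_antisymm, Matrix.neg_mul]

/-- The second Bianchi identity, which is the Jacobi identity for the operators `∂_a + Γ_a`. -/
lemma covUp_curvUp_bianchi (a b c : ι) :
    L.covUp a (L.curvUp b c) + L.covUp b (L.curvUp c a) + L.covUp c (L.curvUp a b) = 0 := by
  have e : ∀ x y z, L.covUp x (L.curvUp y z) = ((L.D x).onMatrix (L.curv y z)
      + L.conn x * L.curv y z - L.curv y z * L.conn x) * L.gi := by
    intro x y z
    rw [covUp, curvUp, Derivation.onMatrix_mul, L.D_gi]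
    noncomm_ring
  have hc : ∀ x y (X : Matrix ι ι A), (L.D x).onMatrix ((L.D y).onMatrix X)
      = (L.D y).onMatrix ((L.D x).onMatrix X) := by
    intro x y X; ext i j; exact L.D_comm _ _ _
  rw [e, e, e, ← Matrix.add_mul, ← Matrix.add_mul]
  convert Matrix.zero_mul _
  simp only [curv, Derivation.onMatrix_add, Derivation.onMatrix_sub, Derivation.onMatrix_mul]
  rw [hc b a, hc c a, hc c b]
  noncomm_ring

lemma sum_curvUp (a m : ι) : ∑ b, L.curvUp a b b m = L.ricMix a m := by
  simp only [curvUp, ricMix, Matrix.mul_apply, ricM, Matrix.of_apply, ric_eq, ← curv_apply,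
    Finset.sum_mul]
  exact Finset.sum_comm

lemma sum_curvUp' (a m : ι) : ∑ b, L.curvUp a b m b = -L.ricMix a m := by
  rw [← sum_curvUp, ← Finset.sum_neg_distrib]
  exact Finset.sum_congr rfl fun b _ => L.curvUp_skew _ _ _ _

lemma sum_gi_mul (Y : Matrix ι ι A) :
    ∑ b, ∑ c, L.gi b c * Y b c = (L.gi * Y).trace := by
  simp only [Matrix.trace, Matrix.diag_apply, Matrix.mul_apply]
  rw [Finset.sum_comm]
  exact Finset.sum_congr rfl fun b _ => Finset.sum_congr rfl fun c _ => by rw [L.gi_symm]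

/-- Traces commute with covariant derivatives. -/
lemma trace_cov (B : ι → ι → A) (a : ι) :
    ∑ b, ∑ c, L.gi b c * L.cov B a b c = L.D a (∑ b, ∑ c, L.gi b c * B b c) := by
  simp only [cov_eq]
  have h2 : ∑ b, ∑ c, L.gi b c * B b c = (L.gi * Matrix.of B).trace :=
    L.sum_gi_mul (Matrix.of B)
  have h3 : ∀ X : Matrix ι ι A, L.D a X.trace = ((L.D a).onMatrix X).trace := by
    intro X; simp [Matrix.trace, Derivation.onMatrix_apply]
  rw [sum_gi_mul, h2, h3, Derivation.onMatrix_mul, L.D_gi]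
  simp only [covM, Matrix.mul_sub, Matrix.neg_mul, Matrix.add_mul, Matrix.trace_add,
    Matrix.trace_sub, Matrix.trace_neg]
  rw [Matrix.mul_assoc (L.conn a), Matrix.trace_mul_comm (L.conn a), Matrix.mul_assoc,
    Matrix.mul_assoc]
  ring

/-- The divergence of the Ricci tensor. -/
def divRic (c : ι) : A := ∑ a, ∑ d, L.gi a d * L.cov L.ric a c d

lemma divRic_eq (c : ι) : L.divRic c =
    ∑ a, L.D a (L.ricMix c a) - ∑ a, ∑ m, L.chr m a c * L.ricMix m a
      + ∑ a, ∑ m, L.chr a a m * L.ricMix c m := by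
  have h : ∀ a, L.covM a L.ricM * L.gi = (L.D a).onMatrix L.ricMix
      - (L.conn a).transpose * L.ricMix + L.ricMix * (L.conn a).transpose := by
    intro a
    rw [covM, ricMix, Derivation.onMatrix_mul, L.D_gi]
    noncomm_ring
  have h2 : ∀ a, ∑ d, L.gi a d * L.cov L.ric a c d = (L.covM a L.ricM * L.gi) c a := by
    intro a
    rw [Matrix.mul_apply]
    exact Finset.sum_congr rfl fun d _ => by rw [cov_eq, L.gi_symm, mul_comm]; rfl
  simp only [divRic, h2, h]
  simp only [Matrix.add_apply, Matrix.sub_apply, Derivation.onMatrix_apply,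
    Matrix.mul_apply, Matrix.transpose_apply, conn_apply, Finset.sum_add_distrib,
    Finset.sum_sub_distrib]
  congr 1
  exact Finset.sum_congr rfl fun d _ => Finset.sum_congr rfl fun _ _ => mul_comm (L.ricMix _ _) _

lemma scal_eq : L.scal = ∑ a, L.ricMix a a := by
  simp only [scal, ricMix, Matrix.mul_apply, ricM, Matrix.of_apply]
  exact Finset.sum_congr rfl fun a _ => Finset.sum_congr rfl fun b _ => by
    rw [L.gi_symm, mul_comm]

/-- The contracted second Bianchi identity `2 ∇^a R_ac = ∂_c R`. -/
lemma two_mul_divRic (c : ι) : 2 * L.divRic c = L.D c L.scal := by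
  have h0 : ∑ a, ∑ b, (L.covUp a (L.curvUp b c) b a + L.covUp b (L.curvUp c a) b a
      + L.covUp c (L.curvUp a b) b a) = 0 := by
    refine Finset.sum_eq_zero fun a _ => Finset.sum_eq_zero fun b _ => ?_
    have := congrFun (congrFun (L.covUp_curvUp_bianchi a b c) b) a
    simpa using this
  simp only [Finset.sum_add_distrib] at h0
  have h1 : ∑ a, ∑ b, L.covUp a (L.curvUp b c) b a = ∑ a, ∑ b, L.covUp b (L.curvUp c a) b a := by
    rw [Finset.sum_comm]
    refine Finset.sum_congr rfl fun a _ => Finset.sum_congr rfl fun b _ => ?_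
    have : L.covUp b (L.curvUp a c) = (L.covUp b (L.curvUp c a)).transpose := by
      rw [L.curvUp_antisymm, covUp_neg, covUp_transpose, curvUp_transpose, covUp_neg]
    rw [this]; rfl
  have h2 : ∑ a, ∑ b, L.covUp b (L.curvUp c a) b a =
      -(∑ b, L.D b (L.ricMix c b) + ∑ b, ∑ m, L.chr b b m * L.ricMix c m) := by
    rw [Finset.sum_comm]
    simp only [covUp, Matrix.add_apply, Matrix.mul_apply, Matrix.transpose_apply, conn_apply,
      Derivation.onMatrix_apply, Finset.sum_add_distrib]
    have t1 : ∀ b, ∑ a, L.D b (L.curvUp c a b a) = -L.D b (L.ricMix c b) := by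
      intro b; rw [← map_sum, sum_curvUp', map_neg]
    have t2 : ∀ b, ∑ a, ∑ m, L.chr b b m * L.curvUp c a m a
        = -∑ m, L.chr b b m * L.ricMix c m := by
      intro b
      rw [Finset.sum_comm]
      simp only [← Finset.mul_sum, sum_curvUp', mul_neg, Finset.sum_neg_distrib]
    -- a skew tensor contracted with the symmetric lower indices of `Γ`
    have t3 : ∑ b, ∑ a, ∑ m, L.curvUp c a b m * L.chr a b m = 0 := by
      rw [Finset.sum_comm]
      refine Finset.sum_eq_zero fun a _ => ?_
      have : ∑ b, ∑ m, L.curvUp c a b m * L.chr a b m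
          = -∑ b, ∑ m, L.curvUp c a b m * L.chr a b m := by
        conv_lhs => rw [Finset.sum_comm]
        simp only [← Finset.sum_neg_distrib]
        refine Finset.sum_congr rfl fun b _ => Finset.sum_congr rfl fun m _ => ?_
        rw [L.curvUp_skew, L.chr_symm, neg_mul]
      apply eq_of_two_mul
      linear_combination this
    simp only [t1, t2, t3, Finset.sum_neg_distrib]
    ring
  have h3 : ∑ a, ∑ b, L.covUp c (L.curvUp a b) b a =
      L.D c L.scal + 2 * ∑ a, ∑ m, L.chr m a c * L.ricMix m a := by
    simp only [covUp, Matrix.add_apply, Matrix.mul_apply, Matrix.transpose_apply, conn_apply,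
      Derivation.onMatrix_apply, Finset.sum_add_distrib]
    have t1 : ∑ a, ∑ b, L.D c (L.curvUp a b b a) = L.D c L.scal := by
      simp only [← map_sum, sum_curvUp, scal_eq]
    have t2 : ∑ a, ∑ b, ∑ m, L.chr b c m * L.curvUp a b m a
        = ∑ a, ∑ m, L.chr m a c * L.ricMix m a := by
      rw [Finset.sum_comm, Finset.sum_comm (f := fun a m => L.chr m a c * L.ricMix m a)]
      refine Finset.sum_congr rfl fun b _ => ?_
      rw [Finset.sum_comm]
      refine Finset.sum_congr rfl fun m _ => ?_
      rw [← Finset.mul_sum, ← sum_curvUp, L.chr_symm b c m]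
      congr 1
      refine Finset.sum_congr rfl fun a _ => ?_
      rw [L.curvUp_antisymm, Matrix.neg_apply, L.curvUp_skew b a m a, neg_neg]
    have t3 : ∑ a, ∑ b, ∑ m, L.curvUp a b b m * L.chr a c m
        = ∑ a, ∑ m, L.chr m a c * L.ricMix m a := by
      rw [Finset.sum_comm (f := fun a m => L.chr m a c * L.ricMix m a)]
      refine Finset.sum_congr rfl fun a _ => ?_
      rw [Finset.sum_comm]
      refine Finset.sum_congr rfl fun m _ => ?_
      rw [← Finset.sum_mul, sum_curvUp, L.chr_symm a c m, mul_comm]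
    rw [t1, t2, t3]; ring
  rw [h1, h2, h3] at h0
  rw [divRic_eq]
  linear_combination -h0

end CoordMetric

namespace CoordMetric

variable {ι A : Type*} [Fintype ι] [DecidableEq ι] [CommRing A] [Algebra ℝ A]
  (L : CoordMetric ι A)

/-! ### Commuting second covariant derivatives -/

/-- The Ricci tensor with both indices raised. -/
def ricUp (k l : ι) : A := ∑ p, ∑ q, L.gi k p * L.gi l q * L.ric p q

/-- The contraction `R_{akcl} R^{kl}`. -/
def riemRic (a c : ι) : A := ∑ k, ∑ l, L.riem a k c l * L.ricUp k l

/-- The contraction `R_{ak} R_c{}^k`. -/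
def ricSq (a c : ι) : A := ∑ k, ∑ l, L.gi k l * L.ric a k * L.ric l c

lemma ricUp_eq (k l : ι) : L.ricUp k l = (L.gi * L.ricM * L.gi) k l := by
  simp only [ricUp, Matrix.mul_apply, ricM, Matrix.of_apply, Finset.sum_mul]
  rw [Finset.sum_comm]
  refine Finset.sum_congr rfl fun p _ => Finset.sum_congr rfl fun q _ => ?_
  rw [L.gi_symm l]; ring

lemma ricUp_symm (k l : ι) : L.ricUp k l = L.ricUp l k := by
  have : (L.gi * L.ricM * L.gi).transpose = L.gi * L.ricM * L.gi := by
    simp only [Matrix.transpose_mul, L.gi_transpose, L.ricM_transpose, Matrix.mul_assoc]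
  rw [ricUp_eq, ricUp_eq]
  exact (congrFun (congrFun this l) k)

lemma riemRic_symm (a c : ι) : L.riemRic a c = L.riemRic c a := by
  simp only [riemRic]
  rw [Finset.sum_comm]
  refine Finset.sum_congr rfl fun k _ => Finset.sum_congr rfl fun l _ => ?_
  rw [L.riem_pair, L.ricUp_symm]

lemma ricSq_eq (a c : ι) : L.ricSq a c = (L.ricM * L.gi * L.ricM) a c := by
  simp only [ricSq, Matrix.mul_apply, ricM, Matrix.of_apply, Finset.sum_mul]
  rw [Finset.sum_comm]
  refine Finset.sum_congr rfl fun p _ => Finset.sum_congr rfl fun q _ => ?_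
  ring

lemma ricSq_symm (a c : ι) : L.ricSq a c = L.ricSq c a := by
  have : (L.ricM * L.gi * L.ricM).transpose = L.ricM * L.gi * L.ricM := by
    simp only [Matrix.transpose_mul, L.gi_transpose, L.ricM_transpose, Matrix.mul_assoc]
  rw [ricSq_eq, ricSq_eq]
  exact (congrFun (congrFun this c) a)

lemma cov2_eq (B : ι → ι → A) (d c a b : ι) : L.cov2 B d c a b =
    L.covM d (L.covM c (Matrix.of B)) a b - ∑ m, L.chr m d c * L.cov B m a b := by
  have h : L.covM d (L.covM c (Matrix.of B)) a b = L.cov (L.cov B c) d a b := by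
    rw [cov_eq]
    congr 2
    ext i j; rw [Matrix.of_apply, cov_eq]
  have h2 : L.cov (L.cov B c) d a b = L.D d (L.cov B c a b)
      - ∑ m, (L.chr m d a * L.cov B c m b + L.chr m d b * L.cov B c a m) := rfl
  rw [h, h2, cov2]
  simp only [Finset.sum_add_distrib]
  ring

/-- The Ricci identity: the commutator of second covariant derivatives of a 2-tensor. -/
lemma cov2_comm (B : ι → ι → A) (b a c k : ι) : L.cov2 B b a c k = L.cov2 B a b c k
    - ((L.curv a b).transpose * Matrix.of B) c k - (Matrix.of B * L.curv a b) c k := by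
  have hc : ∀ X : Matrix ι ι A, (L.D b).onMatrix ((L.D a).onMatrix X)
      = (L.D a).onMatrix ((L.D b).onMatrix X) := by
    intro X; ext i j; exact L.D_comm _ _ _
  have h : L.covM b (L.covM a (Matrix.of B)) = L.covM a (L.covM b (Matrix.of B))
      - (L.curv a b).transpose * Matrix.of B - Matrix.of B * L.curv a b := by
    simp only [covM, curv, Derivation.onMatrix_sub, Derivation.onMatrix_mul, hc,
      Derivation.onMatrix_transpose, Matrix.transpose_add, Matrix.transpose_sub,
      Matrix.transpose_mul]
    noncomm_ring
  rw [cov2_eq, cov2_eq, h, Finset.sum_congr rfl fun m _ => by rw [L.chr_symm m b a]]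
  simp only [Matrix.sub_apply]
  ring

lemma _root_.Finset.sum_rotate {ι A : Type*} [Fintype ι] [AddCommMonoid A] (f : ι → ι → ι → A) :
    ∑ b, ∑ k, ∑ m, f b k m = ∑ m, ∑ b, ∑ k, f b k m := by
  rw [Finset.sum_congr rfl fun b _ => Finset.sum_comm, Finset.sum_comm]

lemma _root_.Finset.sum_swap_pairs {ι A : Type*} [Fintype ι] [AddCommMonoid A]
    (f : ι → ι → ι → ι → A) :
    ∑ a, ∑ c, ∑ k, ∑ l, f a c k l = ∑ k, ∑ l, ∑ a, ∑ c, f a c k l := by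
  rw [Finset.sum_congr rfl fun a _ => Finset.sum_comm, Finset.sum_comm]
  exact Finset.sum_congr rfl fun k _ => Finset.sum_rotate _

/-- Contracting the second index of `∇_a ∇_b R_ck` with its fourth one. -/
lemma sum_gi_cov2_ric (a c : ι) :
    2 * ∑ b, ∑ k, L.gi b k * L.cov2 L.ric a b c k = L.hess L.scal a c := by
  have h : ∀ b k, L.cov2 L.ric a b c k = L.cov (fun b k => L.cov L.ric b c k) a b k
      - ∑ m, L.chr m a c * L.cov L.ric b m k := by
    intro b k
    have h2 : L.cov (fun b k => L.cov L.ric b c k) a b k = L.D a (L.cov L.ric b c k)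
      - ∑ m, (L.chr m a b * L.cov L.ric m c k + L.chr m a k * L.cov L.ric b c m) := rfl
    rw [h2, cov2]
    simp only [Finset.sum_add_distrib]
    ring
  have h2 : ∑ b, ∑ k, L.gi b k * ∑ m, L.chr m a c * L.cov L.ric b m k
      = ∑ m, L.chr m a c * L.divRic m := by
    simp only [divRic, Finset.mul_sum]
    rw [Finset.sum_rotate]
    simp only [mul_left_comm]
  have h3 : ∑ b, ∑ k, L.gi b k * L.cov L.ric b c k = L.divRic c := rfl
  simp only [h, mul_sub, Finset.sum_sub_distrib, trace_cov, h2, h3]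
  rw [hess, ← L.two_mul_divRic]
  simp only [← L.two_mul_divRic, mul_left_comm _ (2 : A), ← Finset.mul_sum]
  rw [two_mul (L.divRic c), map_add]
  ring

lemma gi_mul_riem (a b c m : ι) : L.curv a b m c = ∑ l, L.gi m l * L.riem a b c l := by
  simp only [riem_eq]
  rw [← Matrix.mul_apply, ← Matrix.mul_assoc, L.gi_mul, Matrix.one_mul]

/-- Contracting the first index of `∇_b ∇_a R_ck` with its fourth one: compared to the
contraction of the second index, commuting the derivatives costs curvature terms. -/
lemma sum_gi_cov2_ric' (a c : ι) :
    2 * ∑ b, ∑ k, L.gi b k * L.cov2 L.ric b a c k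
      = L.hess L.scal a c - 2 * L.riemRic a c + 2 * L.ricSq a c := by
  have h1 : ∑ b, ∑ k, L.gi b k * ((L.curv a b).transpose * Matrix.of L.ric) c k
      = L.riemRic a c := by
    simp only [riemRic, ricUp, Matrix.mul_apply, Matrix.transpose_apply, Matrix.of_apply,
      gi_mul_riem, Finset.mul_sum, Finset.sum_mul]
    refine Finset.sum_congr rfl fun b _ => ?_
    rw [Finset.sum_congr rfl fun k _ => Finset.sum_comm]
    rw [Finset.sum_comm]
    refine Finset.sum_congr rfl fun l _ => ?_
    refine Finset.sum_congr rfl fun k _ => Finset.sum_congr rfl fun m _ => ?_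
    rw [L.gi_symm m l, L.ric_symm]; ring
  have h2 : ∑ b, ∑ k, L.gi b k * (Matrix.of L.ric * L.curv a b) c k = -L.ricSq a c := by
    have : ∀ b, ∑ k, L.gi b k * (Matrix.of L.ric * L.curv a b) c k
        = ∑ m, L.ric c m * L.curvUp a b m b := by
      intro b
      simp only [curvUp, Matrix.mul_apply, Matrix.of_apply, Finset.mul_sum]
      rw [Finset.sum_comm]
      refine Finset.sum_congr rfl fun k _ => Finset.sum_congr rfl fun m _ => ?_
      rw [L.gi_symm]; ring
    simp only [this]
    rw [Finset.sum_comm]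
    simp only [← Finset.mul_sum, sum_curvUp', mul_neg, Finset.sum_neg_distrib]
    rw [ricSq_eq, ← ricMix, Matrix.mul_apply]
    congr 1
    refine Finset.sum_congr rfl fun m _ => ?_
    rw [L.ric_symm, mul_comm]; rfl
  simp only [L.cov2_comm L.ric _ a, mul_sub, Finset.sum_sub_distrib, h1, h2]
  rw [sum_gi_cov2_ric]
  ring

lemma sum_gi_ricSq : ∑ a, ∑ c, L.gi a c * L.ricSq a c = ∑ k, ∑ l, L.ric k l * L.ricUp k l := by
  simp only [ricSq_eq]
  rw [sum_gi_mul, Matrix.trace_mul_comm]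
  simp only [ricUp_eq, Matrix.trace, Matrix.diag_apply]
  refine Finset.sum_congr rfl fun k _ => ?_
  simp only [Matrix.mul_assoc]
  rw [Matrix.mul_apply]
  refine Finset.sum_congr rfl fun l _ => ?_
  rw [← Matrix.mul_assoc, ← ricUp_eq, ← ricUp_eq, L.ricUp_symm]; rfl

/-! ### Evolution of the Ricci tensor under Ricci flow -/

section Evolution

variable (d : Derivation ℝ A A) (hcomm : ∀ a f, d (L.D a f) = L.D a (d f))
  (hflow : ∀ a b, d (L.g a b) = (-2 : ℝ) • L.ric a b)

include hcomm hflow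

/-- The evolution of the connection,
`g_{kl} ∂_t Γ^l_{aj} = -(∇_a R_jk + ∇_j R_ak - ∇_k R_aj)`. -/
lemma g_mul_D_conn (a j k : ι) : (L.g * d.onMatrix (L.conn a)) k j =
    -(L.cov L.ric a j k + L.cov L.ric j a k - L.cov L.ric k a j) := by
  have hg : d.onMatrix L.g = (-2 : ℝ) • L.ricM := by ext i j; exact hflow i j
  have hc : ∀ a, d.onMatrix ((L.D a).onMatrix L.g) = (L.D a).onMatrix (d.onMatrix L.g) := by
    intro a; ext i j; exact hcomm a _
  have hs : ∀ a, (L.D a).onMatrix ((-2 : ℝ) • L.ricM) = (-2 : ℝ) • (L.D a).onMatrix L.ricM := by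
    intro a; ext i j; simp [Derivation.onMatrix_apply]
  have key : ∀ a, (d.onMatrix (L.conn a)).transpose * L.g + L.g * d.onMatrix (L.conn a)
      = (-2 : ℝ) • L.covM a L.ricM := by
    intro a
    have h := hc a
    rw [L.D_g, hg, hs] at h
    simp only [Derivation.onMatrix_add, Derivation.onMatrix_mul, Derivation.onMatrix_transpose,
      hg, Matrix.mul_smul, Matrix.smul_mul] at h
    simp only [covM, smul_sub]
    rw [← h]
    abel
  have key2 : ∀ a j k, (L.g * d.onMatrix (L.conn a)) j k + (L.g * d.onMatrix (L.conn a)) k j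
      = -2 * L.cov L.ric a j k := by
    intro a j k
    have h := congrFun (congrFun (key a) j) k
    have e : ((d.onMatrix (L.conn a)).transpose * L.g) j k
        = (L.g * d.onMatrix (L.conn a)) k j := by
      conv_lhs => rw [← L.g_transpose, ← Matrix.transpose_mul]
      rfl
    rw [Matrix.add_apply, e, Matrix.smul_apply] at h
    rw [cov_eq, add_comm, h, neg_smul, two_smul]
    change -(L.covM a L.ricM j k + L.covM a L.ricM j k) = -2 * L.covM a L.ricM j k
    ring
  have hsym : ∀ a j k, (L.g * d.onMatrix (L.conn a)) k j = (L.g * d.onMatrix (L.conn j)) k a := by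
    intro a j k
    simp only [Matrix.mul_apply, Derivation.onMatrix_apply, conn_apply]
    exact Finset.sum_congr rfl fun m _ => by rw [L.chr_symm]
  apply eq_of_two_mul
  linear_combination key2 a j k + key2 j a k - key2 k a j + hsym a j k - hsym a k j - hsym j k a

omit hcomm hflow in
/-- The right hand side of the evolution of the connection, `∇_a R_jk + ∇_j R_ak - ∇_k R_aj`. -/
def dConn (a : ι) : Matrix ι ι A :=
  Matrix.of fun k j => L.cov L.ric a j k + L.cov L.ric j a k - L.cov L.ric k a j

lemma D_conn (a : ι) : d.onMatrix (L.conn a) = -(L.gi * L.dConn a) := by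
  have h : L.g * d.onMatrix (L.conn a) = -L.dConn a := by
    ext k j; exact L.g_mul_D_conn d hcomm hflow a j k
  rw [← Matrix.mul_neg, ← h, ← Matrix.mul_assoc, L.gi_mul, Matrix.one_mul]

omit hcomm hflow in
lemma covM_dConn (a b c k : ι) : L.covM b (L.dConn a) k c =
    L.cov2 L.ric b a c k + L.cov2 L.ric b c a k - L.cov2 L.ric b k a c
      + ∑ m, L.chr m b a * L.dConn m k c := by
  simp only [covM, dConn, cov2, Matrix.sub_apply, Matrix.mul_apply, Matrix.transpose_apply,
    Derivation.onMatrix_apply, Matrix.of_apply, conn_apply, map_add, map_sub, mul_add, mul_sub,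
    add_mul, sub_mul, Finset.sum_add_distrib, Finset.sum_sub_distrib,
    mul_comm (L.cov _ _ _ _)]
  ring

omit hcomm hflow in
lemma sum_gi_dConn (c : ι) : ∑ b, ∑ k, L.gi b k * L.dConn b k c = L.D c L.scal := by
  have h : ∑ b, ∑ k, L.gi b k * L.cov L.ric b c k = ∑ b, ∑ k, L.gi b k * L.cov L.ric k b c := by
    rw [Finset.sum_comm]
    refine Finset.sum_congr rfl fun b _ => Finset.sum_congr rfl fun k _ => ?_
    rw [L.gi_symm, L.cov_ric_symm]
  simp only [dConn, Matrix.of_apply, mul_add, mul_sub, Finset.sum_add_distrib,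
    Finset.sum_sub_distrib, h, L.trace_cov L.ric c]
  rw [scal]
  ring

/-- Under Ricci flow `∂_t R_ac = ΔR_ac + 2 R_akcl R^kl - 2 R_ak R_c^k`. -/
theorem D_ric (a c : ι) :
    d (L.ric a c) = L.lap L.ric a c + 2 * L.riemRic a c - 2 * L.ricSq a c := by
  have hc : ∀ a (X : Matrix ι ι A),
      d.onMatrix ((L.D a).onMatrix X) = (L.D a).onMatrix (d.onMatrix X) := by
    intro a X; ext i j; exact hcomm a _
  have hS : ∀ a b, d.onMatrix (L.curv a b) =
      ((L.D b).onMatrix (d.onMatrix (L.conn a)) + L.conn b * d.onMatrix (L.conn a)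
        - d.onMatrix (L.conn a) * L.conn b)
      - ((L.D a).onMatrix (d.onMatrix (L.conn b)) + L.conn a * d.onMatrix (L.conn b)
        - d.onMatrix (L.conn b) * L.conn a) := by
    intro a b
    simp only [curv, Derivation.onMatrix_add, Derivation.onMatrix_sub, Derivation.onMatrix_mul, hc]
    noncomm_ring
  have hE : ∀ a b, (L.D b).onMatrix (d.onMatrix (L.conn a)) + L.conn b * d.onMatrix (L.conn a)
        - d.onMatrix (L.conn a) * L.conn b = -(L.gi * L.covM b (L.dConn a)) := by
    intro a b
    rw [L.D_conn d hcomm hflow, Derivation.onMatrix_neg, Derivation.onMatrix_mul, L.D_gi, covM]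
    noncomm_ring
  have h1 : d (L.ric a c) = ∑ b, d.onMatrix (L.curv a b) b c := by
    simp only [ric_eq, map_sum, ← curv_apply, Derivation.onMatrix_apply]
  -- the divergence of `∂_t Γ`
  have h2 : ∑ b, (-(L.gi * L.covM b (L.dConn a))) b c =
      -(∑ b, ∑ k, L.gi b k * L.cov2 L.ric b a c k + ∑ b, ∑ k, L.gi b k * L.cov2 L.ric b c a k
        - L.lap L.ric a c) + ∑ b, ∑ m, L.chr m b a * d.onMatrix (L.conn m) b c := by
    simp only [L.D_conn d hcomm hflow, Matrix.neg_apply, Matrix.mul_apply, covM_dConn, mul_add,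
      mul_sub, Finset.sum_add_distrib, Finset.sum_sub_distrib, Finset.sum_neg_distrib, lap]
    have : ∀ b, ∑ k, L.gi b k * ∑ m, L.chr m b a * L.dConn m k c
        = -∑ m, L.chr m b a * -∑ k, L.gi b k * L.dConn m k c := by
      intro b
      simp only [Finset.mul_sum, mul_neg, Finset.sum_neg_distrib, neg_neg]
      rw [Finset.sum_comm]
      simp only [mul_left_comm]
    simp only [this, Finset.sum_neg_distrib]
    ring
  -- the Hessian of the trace of `∂_t Γ`
  have h3 : ∑ b, ((L.D a).onMatrix (d.onMatrix (L.conn b)) + L.conn a * d.onMatrix (L.conn b)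
        - d.onMatrix (L.conn b) * L.conn a) b c =
      -L.hess L.scal a c + ∑ b, ∑ m, L.chr m b a * d.onMatrix (L.conn m) b c := by
    have ht : ∀ c, ∑ b, d.onMatrix (L.conn b) b c = -L.D c L.scal := by
      intro c
      simp only [L.D_conn d hcomm hflow, Matrix.neg_apply, Matrix.mul_apply,
        Finset.sum_neg_distrib, sum_gi_dConn]
    simp only [Matrix.sub_apply, Matrix.add_apply, Finset.sum_add_distrib,
      Finset.sum_sub_distrib, Derivation.onMatrix_apply (L.D a), ← map_sum, ht]
    simp only [Matrix.mul_apply, hess]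
    have e1 : ∑ b, ∑ m, L.conn a b m * d.onMatrix (L.conn b) m c
        = ∑ b, ∑ m, L.chr m b a * d.onMatrix (L.conn m) b c := by
      rw [Finset.sum_comm]
      refine Finset.sum_congr rfl fun b _ => Finset.sum_congr rfl fun m _ => ?_
      rw [conn_apply, L.chr_symm]
    have e2 : ∑ b, ∑ m, d.onMatrix (L.conn b) b m * L.conn a m c
        = -∑ m, L.chr m a c * L.D m L.scal := by
      rw [Finset.sum_comm, ← Finset.sum_neg_distrib]
      refine Finset.sum_congr rfl fun m _ => ?_
      rw [← Finset.sum_mul, ht, conn_apply]; ring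
    rw [e1, e2, map_neg]; ring
  rw [h1]
  simp only [hS, hE, Matrix.sub_apply, Finset.sum_sub_distrib, h2]
  simp only [← hE, h3]
  have e1 := L.sum_gi_cov2_ric' a c
  have e2 := L.sum_gi_cov2_ric' c a
  have e3 : L.hess L.scal c a = L.hess L.scal a c := by
    simp only [hess, L.chr_symm _ c a, L.D_comm c a]
  rw [L.riemRic_symm c a, L.ricSq_symm c a, e3] at e2
  apply eq_of_two_mul
  linear_combination -e1 - e2

omit hcomm in
/-- Under Ricci flow `∂_t R = g^{ac} ∂_t R_ac + 2 |Ric|²`. -/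
theorem D_scal : d L.scal = ∑ a, ∑ c, L.gi a c * d (L.ric a c)
    + 2 * ∑ a, ∑ c, L.gi a c * L.ricSq a c := by
  have hg : d.onMatrix L.g = (-2 : ℝ) • L.ricM := by ext i j; exact hflow i j
  have h := congrArg d.onMatrix L.gi_mul
  rw [Derivation.onMatrix_mul, Derivation.onMatrix_one, hg] at h
  have h2 := congrArg (· * L.gi) h
  simp only [Matrix.add_mul, Matrix.mul_assoc, L.mul_gi, Matrix.mul_one, Matrix.zero_mul,
    Matrix.smul_mul, Matrix.mul_smul] at h2
  have h3 : d.onMatrix L.gi = (2 : ℝ) • (L.gi * L.ricM * L.gi) := by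
    rw [eq_neg_of_add_eq_zero_left h2, neg_smul, neg_neg, Matrix.mul_assoc]
  have h4 : ∀ k l, d (L.gi k l) = 2 * L.ricUp k l := by
    intro k l
    have := congrFun (congrFun h3 k) l
    rw [Matrix.smul_apply, ← ricUp_eq, two_smul, ← two_mul] at this
    exact this
  simp only [scal, map_sum, Derivation.leibniz, h4, smul_eq_mul, Finset.sum_add_distrib,
    sum_gi_ricSq, Finset.mul_sum]
  congr 1
  refine Finset.sum_congr rfl fun k _ => Finset.sum_congr rfl fun l _ => ?_
  ring

/-- The trace of the evolution equation: `g^{ac} ∂_t R_ac = ΔR`. -/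
theorem sum_gi_D_ric : ∑ a, ∑ c, L.gi a c * d (L.ric a c)
    = ∑ a, ∑ c, L.gi a c * L.hess L.scal a c := by
  have h1 : ∑ a, ∑ c, L.gi a c * L.riemRic a c = ∑ a, ∑ c, L.gi a c * L.ricSq a c := by
    have e1 : ∑ a, ∑ c, L.gi a c * L.riemRic a c = ∑ k, ∑ l, L.ric k l * L.ricUp k l := by
      have : ∀ k l, L.ric k l = ∑ a, ∑ c, L.gi a c * L.riem a k c l := by
        intro k l
        simp only [ric]
        refine Finset.sum_congr rfl fun a _ => Finset.sum_congr rfl fun c _ => ?_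
        rw [L.riem_antisymm k a, L.riem_antisymm' a k, neg_neg]
      simp only [this, riemRic, Finset.mul_sum, Finset.sum_mul]
      rw [Finset.sum_swap_pairs]
      simp only [mul_assoc]
    rw [e1, sum_gi_ricSq]
  have h2 : ∑ a, ∑ c, L.gi a c * L.lap L.ric a c = ∑ a, ∑ c, L.gi a c * L.hess L.scal a c := by
    have e1 : ∀ k e, ∑ a, ∑ c, L.gi a c * L.cov2 L.ric k e a c = L.hess L.scal k e := by
      intro k e
      have h : ∀ a c, L.cov2 L.ric k e a c = L.cov (L.cov L.ric e) k a c
          - ∑ m, L.chr m k e * L.cov L.ric m a c := by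
        intro a c
        rw [cov2_eq, cov_eq]
        congr 3
        ext i j; exact (L.cov_eq L.ric e i j).symm
      have h' : ∑ a, ∑ c, L.gi a c * ∑ m, L.chr m k e * L.cov L.ric m a c
          = ∑ m, L.chr m k e * ∑ a, ∑ c, L.gi a c * L.cov L.ric m a c := by
        simp only [Finset.mul_sum]
        rw [Finset.sum_rotate]
        simp only [mul_left_comm]
      simp only [h, mul_sub, Finset.sum_sub_distrib, h', trace_cov]
      rfl
    simp only [← e1, lap, Finset.mul_sum]
    rw [Finset.sum_swap_pairs]
    simp only [mul_left_comm]
  simp only [L.D_ric d hcomm hflow, mul_add, mul_sub, Finset.sum_add_distrib,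
    Finset.sum_sub_distrib, mul_left_comm _ (2 : A), ← Finset.mul_sum, h1, h2]
  ring

end Evolution

end CoordMetric

/-! ### The thermostat metric over a ring with derivations -/

/-- The data of the thermostat over a commutative `ℝ`-algebra with commuting derivations: a
Ricci flow `g` on the base, the time coordinate `t`, the ball coordinates `y` together with
`u = 2 / (1 - |y|²)`, and the inverse `ε` of the coefficient `R - r / (2t)` of `dt²`, where `r = N`.
The hyperbolic metric is `2 r u² |dy|²`. -/
structure Thermostat (n N : ℕ) (A : Type*) [CommRing A] [Algebra ℝ A] where
  /-- the partial derivatives -/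
  D : TIdx n N → Derivation ℝ A A
  D_comm : ∀ a b f, D a (D b f) = D b (D a f)
  /-- the metric of the Ricci flow -/
  g : Matrix (Fin n) (Fin n) A
  /-- the inverse metric of the Ricci flow -/
  gi : Matrix (Fin n) (Fin n) A
  g_symm : ∀ a b, g a b = g b a
  gi_mul : gi * g = 1
  /-- the time coordinate -/
  t : A
  /-- the inverse of the time coordinate -/
  ti : A
  /-- the ball coordinates -/
  y : Fin N → A
  /-- the function `2 / (1 - |y|²)` -/
  u : A
  /-- the inverse of `u` -/
  ui : A
  /-- the inverse of the `dt²` coefficient -/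
  ε : A
  /-- the dimension of the hyperbolic space, as a real number -/
  r : ℝ
  r_ne : r ≠ 0
  r_eq : r = N
  t_mul : t * ti = 1
  u_mul : u * ui = 1
  u_sq : u * ∑ α, y α * y α = u - 2
  D_H_g : ∀ α i j, D (iH α) (g i j) = 0
  D_M_t : ∀ i, D (iM i) t = 0
  D_H_t : ∀ α, D (iH α) t = 0
  D_0_t : D i0 t = 1
  D_M_u : ∀ i, D (iM i) u = 0
  D_0_u : D i0 u = 0
  D_H_u : ∀ α, D (iH α) u = u * u * y α
  D_M_y : ∀ i α, D (iM i) (y α) = 0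
  D_0_y : ∀ α, D i0 (y α) = 0
  D_H_y : ∀ α β, D (iH α) (y β) = if α = β then 1 else 0
  flow : ∀ i j, D i0 (g i j) = (-2 : ℝ) •
    (CoordMetric.mk (fun i => D (iM i)) (fun _ _ _ => D_comm _ _ _) g gi g_symm gi_mul).ric i j
  ε_mul : ε * ((CoordMetric.mk (fun i => D (iM i)) (fun _ _ _ => D_comm _ _ _) g gi g_symm
    gi_mul).scal - (r / 2) • ti) = 1

namespace Thermostat

variable {n N : ℕ} {A : Type*} [CommRing A] [Algebra ℝ A] (H : Thermostat n N A)

/-- The metric of the Ricci flow. -/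
def base : CoordMetric (Fin n) A :=
  CoordMetric.mk (fun i => H.D (iM i)) (fun _ _ _ => H.D_comm _ _ _) H.g H.gi H.g_symm H.gi_mul

/-- The coefficient `R - r / (2t)` of `dt²`. -/
def G : A := H.base.scal - (H.r / 2) • H.ti

/-- The conformal factor of the hyperbolic metric. -/
def lam : A := (2 * H.r) • (H.u * H.u)

/-- The inverse of the conformal factor of the hyperbolic metric. -/
def lami : A := (1 / (2 * H.r)) • (H.ui * H.ui)

/-- The components of the thermostat metric. -/
def gT : Matrix (TIdx n N) (TIdx n N) A := Matrix.of fun a b =>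
  match a, b with
  | Sum.inl i, Sum.inl j => H.g i j
  | Sum.inr (Sum.inl α), Sum.inr (Sum.inl β) => if α = β then H.t * H.lam else 0
  | Sum.inr (Sum.inr _), Sum.inr (Sum.inr _) => H.G
  | _, _ => 0

/-- The components of the inverse of the thermostat metric. -/
def giT : Matrix (TIdx n N) (TIdx n N) A := Matrix.of fun a b =>
  match a, b with
  | Sum.inl i, Sum.inl j => H.gi i j
  | Sum.inr (Sum.inl α), Sum.inr (Sum.inl β) => if α = β then H.ti * H.lami else 0
  | Sum.inr (Sum.inr _), Sum.inr (Sum.inr _) => H.ε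
  | _, _ => 0

section Blocks
variable (i j : Fin n) (α β : Fin N)
@[simp] lemma gT_MM : H.gT (iM i) (iM j) = H.g i j := rfl
@[simp] lemma gT_MH : H.gT (iM i) (iH α) = 0 := rfl
@[simp] lemma gT_M0 (v : Unit) : H.gT (iM i) (Sum.inr (Sum.inr v)) = 0 := rfl
@[simp] lemma gT_HM : H.gT (iH α) (iM i) = 0 := rfl
@[simp] lemma gT_HH : H.gT (iH α) (iH β) = if α = β then H.t * H.lam else 0 := rfl
@[simp] lemma gT_H0 (v : Unit) : H.gT (iH α) (Sum.inr (Sum.inr v)) = 0 := rfl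
@[simp] lemma gT_0M (v : Unit) : H.gT (Sum.inr (Sum.inr v)) (iM i) = 0 := rfl
@[simp] lemma gT_0H (v : Unit) : H.gT (Sum.inr (Sum.inr v)) (iH α) = 0 := rfl
@[simp] lemma gT_00 (v w : Unit) :
    H.gT (Sum.inr (Sum.inr v)) (Sum.inr (Sum.inr w)) = H.G := rfl
@[simp] lemma giT_MM : H.giT (iM i) (iM j) = H.gi i j := rfl
@[simp] lemma giT_MH : H.giT (iM i) (iH α) = 0 := rfl
@[simp] lemma giT_M0 (v : Unit) : H.giT (iM i) (Sum.inr (Sum.inr v)) = 0 := rfl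
@[simp] lemma giT_HM : H.giT (iH α) (iM i) = 0 := rfl
@[simp] lemma giT_HH : H.giT (iH α) (iH β) = if α = β then H.ti * H.lami else 0 := rfl
@[simp] lemma giT_H0 (v : Unit) : H.giT (iH α) (Sum.inr (Sum.inr v)) = 0 := rfl
@[simp] lemma giT_0M (v : Unit) : H.giT (Sum.inr (Sum.inr v)) (iM i) = 0 := rfl
@[simp] lemma giT_0H (v : Unit) : H.giT (Sum.inr (Sum.inr v)) (iH α) = 0 := rfl
@[simp] lemma giT_00 (v w : Unit) :
    H.giT (Sum.inr (Sum.inr v)) (Sum.inr (Sum.inr w)) = H.ε := rfl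
end Blocks

lemma lami_mul : H.lami * H.lam = 1 := by
  have := H.r_ne
  have h : H.ui * H.ui * (H.u * H.u) = 1 := by linear_combination (H.u * H.ui + 1) * H.u_mul
  rw [lami, lam, smul_mul_smul_comm, h]
  rw [show (1 / (2 * H.r)) * (2 * H.r) = 1 by field_simp, one_smul]

lemma ε_mul_G : H.ε * H.G = 1 := H.ε_mul

/-- The thermostat metric. -/
def full : CoordMetric (TIdx n N) A where
  D := H.D
  D_comm := H.D_comm
  g := H.gT
  gi := H.giT
  g_symm := by
    rintro (i | α | _) (j | β | _)
    · exact H.g_symm i j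
    · rfl
    · rfl
    · rfl
    · simp only [gT_HH, eq_comm]
    all_goals rfl
  gi_mul := by
    have h1 : ∀ i j, ∑ k, H.gi i k * H.g k j = if i = j then 1 else 0 := by
      intro i j
      have := congrFun (congrFun H.gi_mul i) j
      rwa [Matrix.mul_apply, Matrix.one_apply] at this
    have h2 : H.ti * H.lami * (H.t * H.lam) = 1 := by
      linear_combination H.lami * H.lam * H.t_mul + H.lami_mul
    ext a b
    rw [Matrix.mul_apply, Matrix.one_apply]
    rcases a with (i | α | _) <;> rcases b with (j | β | _) <;>
      simp [Fintype.sum_sum_type, h1, h2, H.ε_mul_G]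

@[simp] lemma full_D (a : TIdx n N) : H.full.D a = H.D a := rfl
@[simp] lemma full_g : H.full.g = H.gT := rfl
@[simp] lemma full_gi : H.full.gi = H.giT := rfl

/-! ### Derivatives of the components -/

lemma base_D (i : Fin n) : H.base.D i = H.D (iM i) := rfl

lemma D_gi_eq_zero (d : Derivation ℝ A A) (h : ∀ i j, d (H.g i j) = 0) (i j : Fin n) :
    d (H.gi i j) = 0 := by
  have hg : d.onMatrix H.g = 0 := by ext i j; exact h i j
  have h1 := congrArg d.onMatrix H.gi_mul
  rw [Derivation.onMatrix_mul, Derivation.onMatrix_one, hg, Matrix.mul_zero, add_zero] at h1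
  have h2 := congrArg (· * H.gi) h1
  simp only [Matrix.mul_assoc, Matrix.zero_mul] at h2
  rw [show H.g * H.gi = 1 from H.base.mul_gi, Matrix.mul_one] at h2
  exact congrFun (congrFun h2 i) j

@[simp] lemma D_H_gi (α : Fin N) (i j : Fin n) : H.D (iH α) (H.gi i j) = 0 :=
  H.D_gi_eq_zero _ (H.D_H_g α) i j

/-- The geometry of the base does not depend on the point of the hyperbolic space. -/
lemma D_H_chr (α : Fin N) (k i j : Fin n) : H.D (iH α) (H.base.chr k i j) = 0 := by
  have hc : ∀ i j l, H.D (iH α) (H.base.D i (H.base.g j l)) = 0 := by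
    intro i j l
    rw [base_D, H.D_comm]
    exact (congrArg _ (H.D_H_g α j l)).trans (map_zero _)
  have hgi : ∀ i j, H.D (iH α) (H.base.gi i j) = 0 := H.D_H_gi α
  simp [CoordMetric.chr, Derivation.leibniz, hc, hgi]

lemma D_H_rUp (α : Fin N) (i j k l : Fin n) : H.D (iH α) (H.base.rUp i j k l) = 0 := by
  simp [CoordMetric.rUp, Derivation.leibniz, D_H_chr, base_D, H.D_comm (iH α)]

lemma D_H_ric (α : Fin N) (i j : Fin n) : H.D (iH α) (H.base.ric i j) = 0 := by
  simp [CoordMetric.ric_eq, D_H_rUp]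

lemma D_H_scal (α : Fin N) : H.D (iH α) H.base.scal = 0 := by
  have hgi : ∀ i j, H.D (iH α) (H.base.gi i j) = 0 := H.D_H_gi α
  simp [CoordMetric.scal, D_H_ric, hgi]

lemma D_of_mul_eq_one (d : Derivation ℝ A A) {a b : A} (h : a * b = 1) :
    d a = -(a * a * d b) := by
  have h1 := congrArg d h
  rw [Derivation.leibniz, Derivation.map_one_eq_zero, smul_eq_mul, smul_eq_mul] at h1
  linear_combination a * h1 - d a * h

lemma D_ti (a : TIdx n N) : H.D a H.ti = -(H.ti * H.ti * H.D a H.t) :=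
  D_of_mul_eq_one _ (by rw [mul_comm]; exact H.t_mul)

lemma D_ε (a : TIdx n N) : H.D a H.ε = -(H.ε * H.ε * H.D a H.G) :=
  D_of_mul_eq_one _ H.ε_mul_G

lemma D_M_G (i : Fin n) : H.D (iM i) H.G = H.D (iM i) H.base.scal := by
  simp [G, D_ti, D_M_t]

lemma D_H_G (α : Fin N) : H.D (iH α) H.G = 0 := by
  simp [G, D_ti, D_H_t, D_H_scal]

lemma D_0_G : H.D i0 H.G = H.D i0 H.base.scal + (H.r / 2) • (H.ti * H.ti) := by
  simp [G, D_ti, D_0_t]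

lemma D_M_lam (i : Fin n) : H.D (iM i) H.lam = 0 := by simp [lam, D_M_u]

lemma D_0_lam : H.D i0 H.lam = 0 := by simp [lam, D_0_u]

lemma D_H_lam (α : Fin N) : H.D (iH α) H.lam = 2 * H.lam * H.u * H.y α := by
  simp only [lam, Derivation.map_smul, Derivation.leibniz, D_H_u, smul_eq_mul, smul_mul_assoc,
    mul_smul_comm]
  congr 1; ring

/-! ### Christoffel symbols of the thermostat -/

lemma base_g : H.base.g = H.g := rfl
lemma base_gi : H.base.gi = H.gi := rfl

lemma D_0_g (i j : Fin n) : H.D i0 (H.g i j) = (-2 : ℝ) • H.base.ric i j := H.flow i j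

/-- The Ricci tensor of the base with its first index raised, `R^k_i`. -/
def ricMix (k i : Fin n) : A := ∑ l, H.gi k l * H.base.ric i l

lemma half_two_mul (x : A) : (1 / 2 : ℝ) • (2 * x) = x := by
  rw [two_mul, ← two_smul ℝ x, smul_smul]; norm_num

section Chr

variable (i j k : Fin n) (α β γ : Fin N)

lemma chr_MMM : H.full.chr (iM k) (iM i) (iM j) = H.base.chr k i j := by
  simp [CoordMetric.chr, Fintype.sum_sum_type, base_D, base_g, base_gi]

lemma chr_MMH : H.full.chr (iM k) (iM i) (iH α) = 0 := by
  simp [CoordMetric.chr, Fintype.sum_sum_type, D_H_g]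

lemma chr_MM0 : H.full.chr (iM k) (iM i) i0 = -H.ricMix k i := by
  simp [CoordMetric.chr, Fintype.sum_sum_type, D_0_g, ricMix, Finset.smul_sum, smul_smul]

lemma chr_MHH : H.full.chr (iM k) (iH α) (iH β) = 0 := by
  by_cases h : α = β <;>
    simp [CoordMetric.chr, Fintype.sum_sum_type, h, Derivation.leibniz, D_M_t, D_M_lam]

lemma chr_MH0 : H.full.chr (iM k) (iH α) i0 = 0 := by
  simp [CoordMetric.chr, Fintype.sum_sum_type]

lemma chr_HMM : H.full.chr (iH α) (iM i) (iM j) = 0 := by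
  simp [CoordMetric.chr, Fintype.sum_sum_type, D_H_g]

lemma chr_HMH : H.full.chr (iH α) (iM i) (iH β) = 0 := by
  by_cases h : β = α <;>
    simp [CoordMetric.chr, Fintype.sum_sum_type, h, Derivation.leibniz, D_M_t, D_M_lam]

lemma chr_HM0 : H.full.chr (iH α) (iM i) i0 = 0 := by
  simp [CoordMetric.chr, Fintype.sum_sum_type]

lemma chr_H00 : H.full.chr (iH α) i0 i0 = 0 := by
  simp [CoordMetric.chr, Fintype.sum_sum_type, D_H_G]

lemma chr_HH0 : H.full.chr (iH α) (iH β) i0 = if α = β then (1 / 2 : ℝ) • H.ti else 0 := by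
  have h1 : H.ti * H.lami * H.lam = H.ti := by linear_combination H.ti * H.lami_mul
  by_cases h : α = β
  · subst h
    simp [CoordMetric.chr, Fintype.sum_sum_type, Derivation.leibniz, D_0_lam, D_0_t, h1]
  · simp [CoordMetric.chr, Fintype.sum_sum_type, h, Ne.symm h]

lemma chr_HHH : H.full.chr (iH α) (iH β) (iH γ) =
    (if α = β then H.u * H.y γ else 0) + (if α = γ then H.u * H.y β else 0)
      - (if β = γ then H.u * H.y α else 0) := by
  have h1 : ∀ x : A, H.ti * H.lami * (H.t * (2 * H.lam * H.u * x)) = 2 * (H.u * x) := by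
    intro x
    linear_combination 2 * H.u * x * (H.lami * H.lam * H.t_mul + H.lami_mul)
  have hD : ∀ δ, H.D (iH δ) (H.t * H.lam) = H.t * (2 * H.lam * H.u * H.y δ) := by
    intro δ; simp [Derivation.leibniz, D_H_t, D_H_lam]
  have hite : ∀ (δ : Fin N) (p : Prop) [Decidable p], H.D (iH δ) (if p then H.t * H.lam else 0)
      = if p then H.t * (2 * H.lam * H.u * H.y δ) else 0 := by
    intro δ p _; split_ifs <;> simp [hD]
  have e : H.full.chr (iH α) (iH β) (iH γ) = (1 / 2 : ℝ) • (H.ti * H.lami *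
      (H.D (iH β) (H.gT (iH γ) (iH α)) + H.D (iH γ) (H.gT (iH β) (iH α))
        - H.D (iH α) (H.gT (iH β) (iH γ)))) := by
    simp [CoordMetric.chr, Fintype.sum_sum_type]
  rw [e]
  simp only [gT_HH, hite, mul_add, mul_sub, mul_ite, mul_zero, h1, smul_add, smul_sub, smul_ite,
    smul_zero, half_two_mul, @eq_comm _ γ α, @eq_comm _ β α]
  ring

lemma chr_0MM : H.full.chr i0 (iM i) (iM j) = H.ε * H.base.ric i j := by
  simp [CoordMetric.chr, Fintype.sum_sum_type, D_0_g, smul_smul]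

lemma chr_0MH : H.full.chr i0 (iM i) (iH α) = 0 := by
  simp [CoordMetric.chr, Fintype.sum_sum_type]

lemma chr_0M0 : H.full.chr i0 (iM i) i0 = (1 / 2 : ℝ) • (H.ε * H.D (iM i) H.base.scal) := by
  simp [CoordMetric.chr, Fintype.sum_sum_type, D_M_G]

lemma chr_0HH : H.full.chr i0 (iH α) (iH β) =
    if α = β then -(1 / 2 : ℝ) • (H.ε * H.lam) else 0 := by
  by_cases h : α = β <;>
    simp [CoordMetric.chr, Fintype.sum_sum_type, h, Derivation.leibniz, D_0_lam, D_0_t]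

lemma chr_0H0 : H.full.chr i0 (iH α) i0 = 0 := by
  simp [CoordMetric.chr, Fintype.sum_sum_type, D_H_G]

lemma chr_000 : H.full.chr i0 i0 i0 = (1 / 2 : ℝ) • (H.ε * H.D i0 H.G) := by
  simp [CoordMetric.chr, Fintype.sum_sum_type]

end Chr

end Thermostat

namespace Thermostat

variable {n N : ℕ} {A : Type*} [CommRing A] [Algebra ℝ A] (H : Thermostat n N A)

/-! ### Curvature of the thermostat -/

section Swapped

variable (i j k : Fin n) (α β γ : Fin N)

lemma chr_MHM : H.full.chr (iM k) (iH α) (iM i) = 0 := by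
  rw [CoordMetric.chr_symm, chr_MMH]

lemma chr_M0M : H.full.chr (iM k) i0 (iM i) = -H.ricMix k i := by
  rw [CoordMetric.chr_symm, chr_MM0]

lemma chr_M0H : H.full.chr (iM k) i0 (iH α) = 0 := by
  rw [CoordMetric.chr_symm, chr_MH0]

lemma chr_HHM : H.full.chr (iH α) (iH β) (iM i) = 0 := by
  rw [CoordMetric.chr_symm, chr_HMH]

lemma chr_H0M : H.full.chr (iH α) i0 (iM i) = 0 := by
  rw [CoordMetric.chr_symm, chr_HM0]

lemma chr_H0H : H.full.chr (iH α) i0 (iH β) = if α = β then (1 / 2 : ℝ) • H.ti else 0 := by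
  rw [CoordMetric.chr_symm, chr_HH0]

lemma chr_0HM : H.full.chr i0 (iH α) (iM i) = 0 := by
  rw [CoordMetric.chr_symm, chr_0MH]

lemma chr_00M : H.full.chr i0 i0 (iM i) = (1 / 2 : ℝ) • (H.ε * H.D (iM i) H.base.scal) := by
  rw [CoordMetric.chr_symm, chr_0M0]

lemma chr_00H : H.full.chr i0 i0 (iH α) = 0 := by
  rw [CoordMetric.chr_symm, chr_0H0]

end Swapped

/-- Sums over the coordinate indices of the thermostat. -/
lemma _root_.sum_TIdx {B : Type*} [AddCommMonoid B] (f : TIdx n N → B) :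
    ∑ a, f a = ∑ i, f (iM i) + ∑ α, f (iH α) + f i0 := by
  rw [Fintype.sum_sum_type, Fintype.sum_sum_type, add_assoc]
  simp

/-- Hamilton's `P_{ijk}`. -/
def harnackP (i j k : Fin n) : A :=
  H.base.cov H.base.ric i j k - H.base.cov H.base.ric j i k

/-- Hamilton's `M_{ij}`. -/
def harnackM (i j : Fin n) : A :=
  H.base.lap H.base.ric i j - (1 / 2 : ℝ) • H.base.hess H.base.scal i j
    + (2 : ℝ) • H.base.riemRic i j - H.base.ricSq i j + (1 / 2 : ℝ) • (H.ti * H.base.ric i j)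

lemma half_mul_two : algebraMap ℝ A (1 / 2) * 2 = 1 := by
  rw [show (2 : A) = algebraMap ℝ A 2 from (map_ofNat _ 2).symm, ← map_mul]
  norm_num

lemma quarter_eq : algebraMap ℝ A (1 / 4) = algebraMap ℝ A (1 / 2) * algebraMap ℝ A (1 / 2) := by
  rw [← map_mul]; norm_num

section Curvature

variable (i j k l : Fin n) (α β γ δ : Fin N)

lemma sum_g_mul_ricMix : ∑ k, H.g k j * H.ricMix k i = H.base.ric i j := by
  have h : ∀ k, H.ricMix k i = H.gi.mulVec (H.base.ric i) k := fun k => rfl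
  have h2 : ∑ k, H.g k j * H.ricMix k i = H.g.mulVec (H.gi.mulVec (H.base.ric i)) j := by
    simp only [h]
    exact Finset.sum_congr rfl fun k _ => by rw [H.g_symm k j]
  rw [h2, Matrix.mulVec_mulVec, show H.g * H.gi = 1 from H.base.mul_gi, Matrix.one_mulVec]

lemma riem_MMMM : H.full.riem (iM i) (iM j) (iM k) (iM l) = H.base.riem i j k l
    - H.ε * (H.base.ric i k * H.base.ric j l - H.base.ric j k * H.base.ric i l) := by
  have h : ∀ f, H.full.rUp (iM i) (iM j) (iM k) (iM f) = H.base.rUp i j k f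
      - H.ε * (H.base.ric i k * H.ricMix f j - H.base.ric j k * H.ricMix f i) := by
    intro f
    simp only [CoordMetric.rUp, sum_TIdx, full_D, base_D, chr_MMM, chr_HMM,
      chr_MMH, chr_0MM, chr_MM0, zero_mul, sub_zero, Finset.sum_const_zero, add_zero]
    ring
  simp only [CoordMetric.riem, sum_TIdx, full_g, gT_MM, gT_HM, gT_0M, zero_mul,
    Finset.sum_const_zero, add_zero, h, base_g]
  rw [← H.sum_g_mul_ricMix j l, ← H.sum_g_mul_ricMix i l]
  simp only [Finset.mul_sum, ← Finset.sum_sub_distrib]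
  exact Finset.sum_congr rfl fun f _ => by ring

lemma riem_MMM0 : H.full.riem (iM i) (iM j) (iM k) i0 = -H.harnackP i j k
    - (1 / 2 : ℝ) • (H.ε * (H.base.ric i k * H.D (iM j) H.base.scal
      - H.base.ric j k * H.D (iM i) H.base.scal)) := by
  have h : H.full.rUp (iM i) (iM j) (iM k) i0 = H.ε * -H.harnackP i j k
      - (1 / 2 : ℝ) • (H.ε * H.ε * (H.base.ric i k * H.D (iM j) H.base.scal
        - H.base.ric j k * H.D (iM i) H.base.scal)) := by
    simp only [CoordMetric.rUp, sum_TIdx, full_D, base_D, chr_MMM, chr_HMM, chr_0M0, harnackP,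
      chr_0MM, zero_mul, Finset.sum_const_zero, add_zero, CoordMetric.cov,
      Derivation.leibniz, D_ε, D_M_G, smul_eq_mul, Finset.sum_sub_distrib, Finset.sum_add_distrib,
      mul_left_comm _ H.ε, ← Finset.mul_sum, H.base.chr_symm _ j i]
    rw [Finset.sum_congr rfl fun m _ => mul_comm (H.base.chr m i k) _,
      Finset.sum_congr rfl fun m _ => mul_comm (H.base.chr m j k) _]
    simp only [Algebra.smul_def]
    linear_combination H.ε * H.ε * (H.base.ric i k * H.D (iM j) H.base.scal
        - H.base.ric j k * H.D (iM i) H.base.scal) * half_mul_two (A := A)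
  simp only [CoordMetric.riem, sum_TIdx, full_g, gT_M0, gT_H0, gT_00, zero_mul,
    Finset.sum_const_zero, zero_add, h]
  simp only [Algebra.smul_def]
  linear_combination (-H.harnackP i j k - algebraMap ℝ A (1 / 2) * (H.ε *
    (H.base.ric i k * H.D (iM j) H.base.scal - H.base.ric j k * H.D (iM i) H.base.scal)))
      * H.ε_mul_G

lemma riem_MM0M : H.full.riem (iM i) (iM j) i0 (iM k) = H.harnackP i j k
    + (1 / 2 : ℝ) • (H.ε * (H.base.ric i k * H.D (iM j) H.base.scal
      - H.base.ric j k * H.D (iM i) H.base.scal)) := by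
  rw [CoordMetric.riem_antisymm', riem_MMM0]; ring

lemma sum_ricMix_mul_ric : ∑ m, H.ricMix m j * H.base.ric i m = H.base.ricSq i j := by
  simp only [ricMix, CoordMetric.ricSq, Finset.sum_mul]
  refine Finset.sum_congr rfl fun k _ => Finset.sum_congr rfl fun l _ => ?_
  rw [H.base.ric_symm j l, base_gi]; ring

lemma D_0_ric : H.D i0 (H.base.ric i j) =
    H.base.lap H.base.ric i j + 2 * H.base.riemRic i j - 2 * H.base.ricSq i j :=
  H.base.D_ric _ (fun _ _ => H.D_comm _ _ _) H.D_0_g i j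

lemma harnackM_eq : H.harnackM i j = H.D i0 (H.base.ric i j) + H.base.ricSq i j
    - (1 / 2 : ℝ) • H.base.hess H.base.scal i j + (1 / 2 : ℝ) • (H.ti * H.base.ric i j) := by
  rw [harnackM, D_0_ric, two_smul]; ring

/-- `∂_t R + R / t`. -/
def dtScal : A := H.D i0 H.base.scal + H.ti * H.base.scal

/-- The Christoffel symbol `Γ^0_{00}` equals `-1 / (2t)` up to terms of order `1 / N`. -/
lemma chr_000' : H.full.chr i0 i0 i0 =
    (1 / 2 : ℝ) • (H.ε * H.dtScal - H.ti) := by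
  rw [chr_000, D_0_G]
  congr 1
  have h := H.ε_mul_G
  rw [G] at h
  simp only [Algebra.smul_def, dtScal] at h ⊢
  linear_combination -H.ti * h

lemma riem_M0M0 : H.full.riem (iM i) i0 (iM j) i0 = H.harnackM i j
    + H.ε * ((1 / 4 : ℝ) • (H.D (iM i) H.base.scal * H.D (iM j) H.base.scal)
      - (1 / 2 : ℝ) • (H.dtScal * H.base.ric i j)) := by
  have h : H.full.rUp (iM i) i0 (iM j) i0 = H.ε * (H.harnackM i j
    + H.ε * ((1 / 4 : ℝ) • (H.D (iM i) H.base.scal * H.D (iM j) H.base.scal)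
      - (1 / 2 : ℝ) • (H.dtScal * H.base.ric i j))) := by
    have hG : H.ε * H.D i0 H.G = H.ε * H.dtScal - H.ti := by
      have := (H.chr_000).symm.trans H.chr_000'
      have h2 := congrArg (fun x => (2 : ℝ) • x) this
      simpa [smul_smul] using h2
    have e1 : ∑ m, H.base.chr m i j * (1 / 2 : ℝ) • (H.ε * H.D (iM m) H.base.scal)
        = (1 / 2 : ℝ) • (H.ε * ∑ m, H.base.chr m i j * H.D (iM m) H.base.scal) := by
      simp only [mul_smul_comm, ← Finset.smul_sum, mul_left_comm _ H.ε, ← Finset.mul_sum]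
    have e2 : ∑ m, -H.ricMix m j * (H.ε * H.base.ric i m) = -(H.ε * H.base.ricSq i j) := by
      simp only [neg_mul, mul_left_comm _ H.ε, ← Finset.mul_sum, Finset.sum_neg_distrib,
        sum_ricMix_mul_ric, mul_neg]
    simp only [CoordMetric.rUp, sum_TIdx, full_D, chr_MMM, chr_HMM, chr_0M0, chr_00M, chr_M0M,
      chr_0MM, chr_000', chr_H0M, zero_mul, Finset.sum_const_zero, add_zero,
      harnackM_eq, CoordMetric.hess, base_D, Finset.sum_sub_distrib, e1, e2,
      Derivation.leibniz, Derivation.map_smul, D_ε, D_M_G, smul_eq_mul]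
    simp only [Algebra.smul_def, quarter_eq]
    linear_combination -(H.ε * H.base.ric i j) * hG
      + (H.ε * H.base.ric i j * (H.ε * H.dtScal - H.ti) - algebraMap ℝ A (1 / 2) * H.ε * H.ε
        * H.D (iM i) H.base.scal * H.D (iM j) H.base.scal) * half_mul_two (A := A)
  simp only [CoordMetric.riem, sum_TIdx, full_g, gT_M0, gT_H0, gT_00, zero_mul,
    Finset.sum_const_zero, zero_add, h]
  rw [← mul_assoc, mul_comm H.G, H.ε_mul_G, one_mul]

lemma riem_MHMH : H.full.riem (iM i) (iH α) (iM j) (iH β) =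
    if α = β then (1 / 2 : ℝ) • (H.ε * H.lam * H.base.ric i j) else 0 := by
  have h : ∀ γ, H.full.rUp (iM i) (iH α) (iM j) (iH γ) =
      if α = γ then (1 / 2 : ℝ) • (H.ε * H.ti * H.base.ric i j) else 0 := by
    intro γ
    simp only [CoordMetric.rUp, sum_TIdx, full_D, chr_HMM, chr_HHM, chr_HH0, chr_0MM, chr_MHM,
      chr_HMH, chr_0HM, zero_mul, mul_zero, sub_zero, Finset.sum_const_zero, add_zero, map_zero,
      zero_add, @eq_comm _ γ α, mul_ite]
    split_ifs
    · simp only [Algebra.smul_def]; ring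
    · rfl
  simp only [CoordMetric.riem, sum_TIdx, full_g, gT_MH, gT_HH, gT_0H, zero_mul, h,
    Finset.sum_const_zero, zero_add, add_zero, mul_ite, mul_zero, Finset.sum_ite_eq,
    Finset.mem_univ, if_true]
  by_cases hαβ : α = β
  · simp only [hαβ, if_true, Algebra.smul_def]
    linear_combination algebraMap ℝ A (1 / 2) * H.ε * H.lam * H.base.ric i j * H.t_mul
  · simp [hαβ]

lemma riem_MH0H : H.full.riem (iM i) (iH α) i0 (iH β) =
    if α = β then (1 / 4 : ℝ) • (H.ε * H.lam * H.D (iM i) H.base.scal) else 0 := by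
  have h : ∀ γ, H.full.rUp (iM i) (iH α) i0 (iH γ) =
      if α = γ then (1 / 4 : ℝ) • (H.ε * H.ti * H.D (iM i) H.base.scal) else 0 := by
    intro γ
    simp only [CoordMetric.rUp, sum_TIdx, full_D, chr_HM0, chr_HHM, chr_HH0, chr_0M0, chr_MH0,
      chr_HMH, chr_0H0, zero_mul, mul_zero, sub_zero, Finset.sum_const_zero, add_zero, map_zero,
      zero_add, @eq_comm _ γ α, mul_ite, apply_ite (H.D (iM i)), Derivation.map_smul, D_ti,
      D_M_t, neg_zero, smul_zero, ite_self]
    split_ifs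
    · simp only [Algebra.smul_def, quarter_eq]; ring
    · rfl
  simp only [CoordMetric.riem, sum_TIdx, full_g, gT_MH, gT_HH, gT_0H, zero_mul, h,
    Finset.sum_const_zero, zero_add, add_zero, mul_ite, mul_zero, Finset.sum_ite_eq,
    Finset.mem_univ, if_true]
  by_cases hαβ : α = β
  · simp only [hαβ, if_true, Algebra.smul_def]
    linear_combination algebraMap ℝ A (1 / 4) * H.ε * H.lam * H.D (iM i) H.base.scal * H.t_mul
  · simp [hαβ]

lemma riem_0H0H : H.full.riem i0 (iH α) i0 (iH β) =
    if α = β then (1 / 4 : ℝ) • (H.ε * H.lam * H.dtScal) else 0 := by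
  have h : ∀ γ, H.full.rUp i0 (iH α) i0 (iH γ) =
      if α = γ then (1 / 4 : ℝ) • (H.ε * H.ti * H.dtScal) else 0 := by
    intro γ
    have e : ∀ β, (if α = β then (1 / 2 : ℝ) • H.ti else 0) * (if β = γ then (1 / 2 : ℝ) • H.ti
      else 0) = if α = β then (if α = γ then (1 / 4 : ℝ) • (H.ti * H.ti) else 0) else 0 := by
      intro β
      split_ifs <;> simp_all [smul_smul]
      norm_num
    simp only [CoordMetric.rUp, sum_TIdx, full_D, chr_H00, chr_HHM, chr_HH0, chr_000', chr_MH0,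
      chr_H0H, chr_0H0, zero_mul, mul_zero, Finset.sum_const_zero, add_zero, map_zero,
      zero_add, @eq_comm _ γ, @eq_comm _ _ α, e, Finset.sum_sub_distrib, Finset.sum_ite_eq,
      Finset.mem_univ, if_true, apply_ite (H.D i0), Derivation.map_smul, D_ti, D_0_t]
    split_ifs
    · simp only [Algebra.smul_def, quarter_eq]
      linear_combination -(algebraMap ℝ A (1 / 2) * H.ti * H.ti) * half_mul_two (A := A)
    · simp
  simp only [CoordMetric.riem, sum_TIdx, full_g, gT_MH, gT_HH, gT_0H, zero_mul, h,
    Finset.sum_const_zero, zero_add, add_zero, mul_ite, mul_zero, Finset.sum_ite_eq,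
    Finset.mem_univ, if_true]
  by_cases hαβ : α = β
  · simp only [hαβ, if_true, Algebra.smul_def]
    linear_combination algebraMap ℝ A (1 / 4) * H.ε * H.lam * H.dtScal * H.t_mul
  · simp [hαβ]

end Curvature

section CurvatureZero

variable (i j k l : Fin n) (α β γ δ : Fin N)

lemma rUp_MMMH : H.full.rUp (iM i) (iM j) (iM k) (iH α) = 0 := by
  simp [CoordMetric.rUp, chr_HMM, chr_HMH, chr_HM0]

lemma rUp_MMHH : H.full.rUp (iM i) (iM j) (iH α) (iH β) = 0 := by
  simp [CoordMetric.rUp, chr_MMH, chr_HMH, chr_0MH]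

lemma rUp_MM0H : H.full.rUp (iM i) (iM j) i0 (iH α) = 0 := by
  simp [CoordMetric.rUp, chr_HMM, chr_HMH, chr_HM0]

lemma rUp_M0MH : H.full.rUp (iM i) i0 (iM j) (iH α) = 0 := by
  simp [CoordMetric.rUp, chr_HMM, chr_HMH, chr_HM0, chr_H0M, chr_H00]

lemma rUp_M00H : H.full.rUp (iM i) i0 i0 (iH α) = 0 := by
  simp [CoordMetric.rUp, chr_HMM, chr_HMH, chr_HM0, chr_H0M, chr_H00]

lemma rUp_M0HH : H.full.rUp (iM i) i0 (iH α) (iH β) = 0 := by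
  have : H.D (iM i) H.ti = 0 := by simp [D_ti, D_M_t]
  simp [CoordMetric.rUp, chr_HMM, chr_HMH, chr_HM0, chr_H0M, chr_H00, chr_MMH, chr_0MH,
    chr_H0H, chr_M0H, chr_00H, apply_ite (H.D (iM i)), this]

lemma rUp_MHHH : H.full.rUp (iM i) (iH α) (iH β) (iH γ) = 0 := by
  have e : H.D (iM i) (H.full.chr (iH γ) (iH α) (iH β)) = 0 := by
    simp [chr_HHH, apply_ite (H.D (iM i)), D_M_u, D_M_y]
  simp [CoordMetric.rUp, chr_HMM, chr_HMH, chr_HM0, chr_MMH, chr_0MH, e]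

lemma rUp_0HHH : H.full.rUp i0 (iH α) (iH β) (iH γ) = 0 := by
  have e : H.D i0 (H.full.chr (iH γ) (iH α) (iH β)) = 0 := by
    simp [chr_HHH, apply_ite (H.D i0), D_0_u, D_0_y]
  have e' : ∀ x, H.D (iH x) H.ti = 0 := fun x => by simp [D_ti, D_H_t]
  have e2 : ∑ x, H.full.chr (iH x) i0 (iH β) * H.full.chr (iH γ) (iH α) (iH x)
      = ∑ x, H.full.chr (iH x) (iH α) (iH β) * H.full.chr (iH γ) i0 (iH x) := by
    simp [chr_H0H, mul_comm]
  have e3 : H.D (iH α) (H.full.chr (iH γ) i0 (iH β)) = 0 := by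
    simp [chr_H0H, apply_ite (H.D (iH α)), e']
  simp only [CoordMetric.rUp, sum_TIdx, full_D, e, e3, Finset.sum_sub_distrib, e2]
  simp [chr_H0M, chr_M0H, chr_00H, chr_H00, chr_HHM, chr_MHH]

end CurvatureZero

section Hyperbolic

variable (α β γ δ : Fin N)

/-- The Kronecker symbol with values in `A`. -/
def _root_.krd (A : Type*) [CommRing A] (α β : Fin N) : A := if α = β then 1 else 0

omit [Algebra ℝ A] in
lemma _root_.krd_symm : krd A α β = krd A β α := by
  simp only [krd, eq_comm]

omit [Algebra ℝ A] in
lemma _root_.sum_krd_mul (f : Fin N → A) : ∑ e, krd A e α * f e = f α := by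
  simp [krd]

lemma D_krd (d : Derivation ℝ A A) : d (krd A α β) = 0 := by
  rw [krd]; split_ifs <;> simp

lemma chr_HHH' : H.full.chr (iH α) (iH β) (iH γ) =
    H.u * (krd A α β * H.y γ + krd A α γ * H.y β - krd A β γ * H.y α) := by
  rw [chr_HHH]; simp only [krd]; split_ifs <;> ring

lemma D_chr_HHH : H.D (iH β) (H.full.chr (iH δ) (iH α) (iH γ)) =
    H.u * H.u * H.y β * (krd A δ α * H.y γ + krd A δ γ * H.y α - krd A α γ * H.y δ)
      + H.u * (krd A δ α * krd A β γ + krd A δ γ * krd A β α - krd A α γ * krd A β δ) := by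
  have hy : ∀ α β, H.D (iH α) (H.y β) = krd A α β := H.D_H_y
  simp only [chr_HHH', Derivation.leibniz, map_add, map_sub, D_krd, hy, D_H_u, smul_eq_mul]
  ring

lemma sum_chr_mul_chr : ∑ e, H.full.chr (iH e) (iH α) (iH γ) * H.full.chr (iH δ) (iH β) (iH e) =
    H.u * H.y γ * H.full.chr (iH δ) (iH β) (iH α) + H.u * H.y α * H.full.chr (iH δ) (iH β) (iH γ)
      - H.u * (H.u - 2) * krd A α γ * krd A δ β := by
  have h1 : ∀ e, H.full.chr (iH e) (iH α) (iH γ) * H.full.chr (iH δ) (iH β) (iH e) =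
      krd A e α * (H.u * H.y γ * H.full.chr (iH δ) (iH β) (iH e))
      + krd A e γ * (H.u * H.y α * H.full.chr (iH δ) (iH β) (iH e))
      - H.u * krd A α γ * (H.y e * H.full.chr (iH δ) (iH β) (iH e)) := by
    intro e; rw [chr_HHH' H e]; ring
  have h2 : ∑ e, H.y e * H.full.chr (iH δ) (iH β) (iH e) = (H.u - 2) * krd A δ β := by
    have h3 : ∀ e, H.y e * H.full.chr (iH δ) (iH β) (iH e) =
        H.u * krd A δ β * (H.y e * H.y e) + krd A e δ * (H.u * H.y β * H.y e)
          - krd A e β * (H.u * H.y δ * H.y e) := by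
      intro e; rw [chr_HHH', krd_symm δ e, krd_symm β e]; ring
    simp only [h3, Finset.sum_add_distrib, Finset.sum_sub_distrib, ← Finset.mul_sum, sum_krd_mul]
    linear_combination krd A δ β * H.u_sq
  simp only [h1, Finset.sum_add_distrib, Finset.sum_sub_distrib, ← Finset.mul_sum, sum_krd_mul, h2]
  ring

/-- The coefficient of the curvature of the thermostat along the hyperbolic space: since the
metric `t g_αβ` has curvature `-1 / (2Nt)` and `ε` is about `-2t / N`, it is of order `1 / N²`. -/
def hypCoeff : A := H.t * (H.u * H.u) * H.lam + (1 / 4 : ℝ) • (H.ε * (H.lam * H.lam))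

lemma riem_HHHH : H.full.riem (iH α) (iH β) (iH γ) (iH δ) =
    -(H.hypCoeff * (krd A α γ * krd A β δ - krd A α δ * krd A β γ)) := by
  have h : ∀ δ, H.full.rUp (iH α) (iH β) (iH γ) (iH δ) =
      -((H.u * H.u + (1 / 4 : ℝ) • (H.ε * H.lam * H.ti))
        * (krd A α γ * krd A β δ - krd A α δ * krd A β γ)) := by
    intro δ
    have k1 : ∀ x y, H.full.chr i0 (iH x) (iH y) =
        -(algebraMap ℝ A (1 / 2)) * (H.ε * H.lam) * krd A x y := by
      intro x y
      rw [chr_0HH, krd]; split_ifs <;> simp [Algebra.smul_def]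
    have k2 : ∀ x y, H.full.chr (iH x) (iH y) i0 = algebraMap ℝ A (1 / 2) * H.ti * krd A x y := by
      intro x y
      rw [chr_HH0, krd]; split_ifs <;> simp [Algebra.smul_def]
    simp only [CoordMetric.rUp, sum_TIdx, full_D, chr_MHH, zero_mul,
      Finset.sum_const_zero, zero_add, Finset.sum_sub_distrib, sum_chr_mul_chr, D_chr_HHH, k1, k2]
    simp only [chr_HHH', Algebra.smul_def, quarter_eq, krd_symm δ α, krd_symm δ β,
      krd_symm δ γ, krd_symm β α]
    ring
  simp only [CoordMetric.riem, sum_TIdx, full_g, gT_MH, gT_HH, gT_0H, zero_mul, h,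
    Finset.sum_const_zero, zero_add, add_zero, ite_mul, zero_mul, Finset.sum_ite_eq',
    Finset.mem_univ, if_true, hypCoeff, Algebra.smul_def]
  linear_combination -(algebraMap ℝ A (1 / 4) * H.ε * H.lam * H.lam)
    * (krd A α γ * krd A β δ - krd A α δ * krd A β γ) * H.t_mul

end Hyperbolic

end Thermostat

namespace Thermostat

variable {n N : ℕ} {A : Type*} [CommRing A] [Algebra ℝ A] (H : Thermostat n N A)

/-! ### The remaining blocks of the curvature tensor -/

section Zero

variable (i j k l : Fin n) (α β γ δ : Fin N)

lemma riem_H_eq_zero {a b c : TIdx n N} (h : ∀ γ, H.full.rUp a b c (iH γ) = 0) :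
    H.full.riem a b c (iH δ) = 0 := by
  simp [CoordMetric.riem, h]

lemma riem_MMMH : H.full.riem (iM i) (iM j) (iM k) (iH α) = 0 :=
  H.riem_H_eq_zero _ (H.rUp_MMMH i j k)

lemma riem_MMHH : H.full.riem (iM i) (iM j) (iH α) (iH β) = 0 :=
  H.riem_H_eq_zero _ (H.rUp_MMHH i j α)

lemma riem_MM0H : H.full.riem (iM i) (iM j) i0 (iH α) = 0 :=
  H.riem_H_eq_zero _ (H.rUp_MM0H i j)

lemma riem_M0MH : H.full.riem (iM i) i0 (iM j) (iH α) = 0 :=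
  H.riem_H_eq_zero _ (H.rUp_M0MH i j)

lemma riem_M00H : H.full.riem (iM i) i0 i0 (iH α) = 0 :=
  H.riem_H_eq_zero _ (H.rUp_M00H i)

lemma riem_M0HH : H.full.riem (iM i) i0 (iH α) (iH β) = 0 :=
  H.riem_H_eq_zero _ (H.rUp_M0HH i α)

lemma riem_MHHH : H.full.riem (iM i) (iH α) (iH β) (iH γ) = 0 :=
  H.riem_H_eq_zero _ (H.rUp_MHHH i α β)

lemma riem_0HHH : H.full.riem i0 (iH α) (iH β) (iH γ) = 0 :=
  H.riem_H_eq_zero _ (H.rUp_0HHH α β)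

lemma riem_0HMH : H.full.riem i0 (iH α) (iM i) (iH β) =
    if α = β then (1 / 4 : ℝ) • (H.ε * H.lam * H.D (iM i) H.base.scal) else 0 := by
  rw [CoordMetric.riem_pair, riem_MH0H]
  simp only [eq_comm]

lemma riem_MHMM : H.full.riem (iM i) (iH α) (iM j) (iM k) = 0 := by
  rw [CoordMetric.riem_pair, riem_MMMH]

lemma riem_HHMM : H.full.riem (iH α) (iH β) (iM i) (iM j) = 0 := by
  rw [CoordMetric.riem_pair, riem_MMHH]

lemma riem_0HMM : H.full.riem i0 (iH α) (iM i) (iM j) = 0 := by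
  rw [CoordMetric.riem_pair, riem_MM0H]

lemma riem_MHM0 : H.full.riem (iM i) (iH α) (iM j) i0 = 0 := by
  rw [CoordMetric.riem_pair, riem_M0MH]

lemma riem_0HM0 : H.full.riem i0 (iH α) (iM i) i0 = 0 := by
  rw [CoordMetric.riem_pair, riem_M00H]

lemma riem_HHM0 : H.full.riem (iH α) (iH β) (iM i) i0 = 0 := by
  rw [CoordMetric.riem_pair, riem_M0HH]

lemma riem_HHMH : H.full.riem (iH α) (iH β) (iM i) (iH γ) = 0 := by
  rw [CoordMetric.riem_pair, riem_MHHH]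

lemma riem_HH0H : H.full.riem (iH α) (iH β) i0 (iH γ) = 0 := by
  rw [CoordMetric.riem_pair, riem_0HHH]

/-- The leading terms of `hypCoeff` cancel since `ℍ^N` has curvature `-1 / (2N)`. -/
lemma hypCoeff_eq : H.hypCoeff =
    (1 / (2 * H.r)) • (H.ε * H.lam * H.lam * (H.t * H.base.scal)) := by
  have hr := H.r_ne
  have h1 : H.u * H.u = (1 / (2 * H.r)) • H.lam := by
    rw [lam, smul_smul, show 1 / (2 * H.r) * (2 * H.r) = 1 by field_simp, one_smul]
  have hG := H.ε_mul_G
  have h2 : algebraMap ℝ A (1 / 4) = algebraMap ℝ A (1 / (2 * H.r)) * algebraMap ℝ A (H.r / 2) := by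
    rw [← map_mul]; congr 1; field_simp; norm_num
  rw [hypCoeff, h1]
  simp only [Algebra.smul_def, h2, G] at hG ⊢
  linear_combination -(algebraMap ℝ A (1 / (2 * H.r)) * H.t * H.lam * H.lam) * hG
    - algebraMap ℝ A (1 / (2 * H.r)) * algebraMap ℝ A (H.r / 2) * H.ε * H.lam * H.lam * H.t_mul

end Zero

/-! ### The Ricci tensor of the thermostat -/

lemma sum_gi_ric : ∑ k, ∑ l, H.gi k l * H.base.ric k l = H.base.scal := rfl

/-- A form of the contracted second Bianchi identity. -/
lemma sum_gi_harnackP (i : Fin n) : ∑ k, ∑ l, H.gi k l * H.harnackP i k l =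
    (1 / 2 : ℝ) • H.D (iM i) H.base.scal := by
  have h1 : ∑ k, ∑ l, H.gi k l * H.base.cov H.base.ric i k l = H.D (iM i) H.base.scal :=
    H.base.trace_cov H.base.ric i
  have h2 : ∑ k, ∑ l, H.gi k l * H.base.cov H.base.ric k i l = H.base.divRic i := rfl
  have h3 : 2 * H.base.divRic i = H.D (iM i) H.base.scal := H.base.two_mul_divRic i
  simp only [harnackP, mul_sub, Finset.sum_sub_distrib, h1, h2]
  rw [Algebra.smul_def]
  linear_combination -H.base.divRic i * half_mul_two (A := A) + (algebraMap ℝ A (1 / 2) - 1) * h3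

/-- A form of the evolution equation of the scalar curvature under Ricci flow. -/
lemma sum_gi_harnackM : ∑ i, ∑ j, H.gi i j * H.harnackM i j = (1 / 2 : ℝ) • H.dtScal := by
  have h1 : ∑ i, ∑ j, H.gi i j * H.D i0 (H.base.ric i j)
      = ∑ i, ∑ j, H.gi i j * H.base.hess H.base.scal i j :=
    H.base.sum_gi_D_ric (H.D i0) (fun _ _ => H.D_comm _ _ _) H.D_0_g
  have h2 : H.D i0 H.base.scal = ∑ i, ∑ j, H.gi i j * H.D i0 (H.base.ric i j)
      + 2 * ∑ i, ∑ j, H.gi i j * H.base.ricSq i j :=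
    H.base.D_scal (H.D i0) H.D_0_g
  simp only [harnackM_eq, mul_add, mul_sub, Finset.sum_add_distrib, Finset.sum_sub_distrib,
    mul_smul_comm, ← Finset.smul_sum, mul_left_comm _ H.ti, ← Finset.mul_sum, sum_gi_ric, dtScal,
    h2, h1]
  simp only [Algebra.smul_def]
  linear_combination -(∑ i, ∑ j, H.gi i j * H.base.hess H.base.scal i j
    + ∑ i, ∑ j, H.gi i j * H.base.ricSq i j) * half_mul_two (A := A)

/-- A sum of `N` terms of order `ε` need not be small: the product `N ε` tends to `-2t`. -/
lemma N_mul_ε : (N : A) * (H.ti * H.ε) = 2 * (H.ε * H.base.scal - 1) := by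
  have hG := H.ε_mul_G
  have h : (N : A) = 2 * algebraMap ℝ A (H.r / 2) := by
    rw [show (2 : A) = algebraMap ℝ A 2 from (map_ofNat _ 2).symm, ← map_mul, H.r_eq,
      mul_div_cancel₀ _ (two_ne_zero' ℝ), map_natCast]
  simp only [G, Algebra.smul_def] at hG
  rw [h]
  linear_combination -2 * hG

section Ricci

variable (i j k l : Fin n) (α β γ δ : Fin N)

/-- The Ricci tensor of the thermostat as a sum over the three kinds of coordinates. -/
lemma full_ric (a b : TIdx n N) : H.full.ric a b =
    ∑ k, ∑ l, H.gi k l * H.full.riem a (iM k) b (iM l)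
      + H.ti * H.lami * ∑ α, H.full.riem a (iH α) b (iH α) + H.ε * H.full.riem a i0 b i0 := by
  rw [CoordMetric.ric]
  simp [Finset.mul_sum, add_assoc]

lemma ti_lami_mul (x : A) : H.ti * H.lami * ((N : A) * (H.ε * H.lam * x)) =
    2 * (H.ε * H.base.scal - 1) * x := by
  linear_combination (N : A) * H.ti * H.ε * x * H.lami_mul + x * H.N_mul_ε

lemma ric_MM : H.full.ric (iM i) (iM j) = H.ε * (H.base.ricSq i j + H.harnackM i j
    + H.ε * ((1 / 4 : ℝ) • (H.D (iM i) H.base.scal * H.D (iM j) H.base.scal)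
      - (1 / 2 : ℝ) • (H.dtScal * H.base.ric i j))) := by
  have h1 : ∑ k, ∑ l, H.gi k l * H.base.riem i k j l = H.base.ric i j := rfl
  have h2 : ∑ k, ∑ l, H.gi k l * (H.base.ric k j * H.base.ric i l) = H.base.ricSq i j := by
    simp only [CoordMetric.ricSq]
    rw [Finset.sum_comm]
    refine Finset.sum_congr rfl fun k _ => Finset.sum_congr rfl fun l _ => ?_
    rw [base_gi, show H.gi k l = H.gi l k from H.base.gi_symm k l]; ring
  have h3 : ∑ k, ∑ l, H.gi k l * (H.base.ric i j * H.base.ric k l)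
      = H.base.ric i j * H.base.scal := by
    simp only [mul_left_comm, ← Finset.mul_sum, sum_gi_ric]
  have h4 : ∑ α, H.full.riem (iM i) (iH α) (iM j) (iH α)
      = (N : A) * (H.ε * H.lam * ((1 / 2 : ℝ) • H.base.ric i j)) := by
    simp [riem_MHMH]
  rw [full_ric, h4, ti_lami_mul]
  simp only [riem_MMMM, riem_M0M0, mul_sub, Finset.sum_sub_distrib, mul_left_comm _ H.ε,
    ← Finset.mul_sum, h1, h2, h3]
  simp only [Algebra.smul_def]
  linear_combination (H.ε * H.base.scal - 1) * H.base.ric i j * half_mul_two (A := A)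

lemma ric_M0 : H.full.ric (iM i) i0 = (1 / 2 : ℝ) •
    (H.ε * ∑ k, ∑ l, H.gi k l * (H.base.ric i l * H.D (iM k) H.base.scal)) := by
  have h3 : ∑ k, ∑ l, H.gi k l * (H.base.ric k l * H.D (iM i) H.base.scal)
      = H.base.scal * H.D (iM i) H.base.scal := by
    simp only [← mul_assoc, ← Finset.sum_mul, sum_gi_ric]
  have h4 : ∑ α, H.full.riem (iM i) (iH α) i0 (iH α)
      = (N : A) * (H.ε * H.lam * ((1 / 4 : ℝ) • H.D (iM i) H.base.scal)) := by
    simp [riem_MH0H]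
  have h5 : H.full.riem (iM i) i0 i0 i0 = 0 := by
    apply CoordMetric.eq_of_two_mul
    linear_combination H.full.riem_antisymm' (iM i) i0 i0 i0
  rw [full_ric, h4, ti_lami_mul, h5]
  simp only [riem_MM0M, mul_add, mul_sub, Finset.sum_sub_distrib, Finset.sum_add_distrib,
    mul_smul_comm, ← Finset.smul_sum, mul_left_comm _ H.ε, ← Finset.mul_sum, h3,
    sum_gi_harnackP]
  simp only [Algebra.smul_def, quarter_eq]
  linear_combination algebraMap ℝ A (1 / 2) * (H.ε * H.base.scal - 1) * H.D (iM i) H.base.scal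
    * half_mul_two (A := A)

lemma ric_MH : H.full.ric (iM i) (iH α) = 0 := by
  have h1 : ∀ k l, H.full.riem (iM i) (iM k) (iH α) (iM l) = 0 := fun k l => by
    rw [CoordMetric.riem_antisymm', riem_MMMH, neg_zero]
  have h2 : H.full.riem (iM i) i0 (iH α) i0 = 0 := by
    rw [CoordMetric.riem_antisymm', riem_M00H, neg_zero]
  simp [full_ric, h1, h2, riem_MHHH]

lemma ric_H0 : H.full.ric (iH α) i0 = 0 := by
  have h1 : ∀ k l, H.full.riem (iH α) (iM k) i0 (iM l) = 0 := fun k l => by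
    rw [CoordMetric.riem_antisymm', CoordMetric.riem_antisymm, riem_MHM0]; simp
  have h2 : H.full.riem (iH α) i0 i0 i0 = 0 := by
    apply CoordMetric.eq_of_two_mul
    linear_combination H.full.riem_antisymm' (iH α) i0 i0 i0
  simp [full_ric, h1, h2, riem_HH0H]

lemma ric_00 : H.full.ric i0 i0 = (1 / 4 : ℝ) •
    (H.ε * ∑ k, ∑ l, H.gi k l * (H.D (iM k) H.base.scal * H.D (iM l) H.base.scal)) := by
  have h1 : ∀ k l, H.full.riem i0 (iM k) i0 (iM l) = H.full.riem (iM k) i0 (iM l) i0 :=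
    fun k l => by rw [CoordMetric.riem_antisymm, CoordMetric.riem_antisymm', neg_neg]
  have h4 : ∑ α, H.full.riem i0 (iH α) i0 (iH α)
      = (N : A) * (H.ε * H.lam * ((1 / 4 : ℝ) • H.dtScal)) := by
    simp [riem_0H0H]
  have h3 : ∑ k, ∑ l, H.gi k l * (H.dtScal * H.base.ric k l) = H.dtScal * H.base.scal := by
    simp only [mul_left_comm, ← Finset.mul_sum, sum_gi_ric]
  have h5 : H.full.riem i0 i0 i0 i0 = 0 := by
    apply CoordMetric.eq_of_two_mul
    linear_combination H.full.riem_antisymm' i0 i0 i0 i0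
  rw [full_ric, h4, ti_lami_mul, h5]
  simp only [h1, riem_M0M0, mul_add, mul_sub, Finset.sum_sub_distrib, Finset.sum_add_distrib,
    mul_smul_comm, ← Finset.smul_sum, mul_left_comm _ H.ε, ← Finset.mul_sum, h3,
    sum_gi_harnackM]
  simp only [Algebra.smul_def, quarter_eq]
  linear_combination (algebraMap ℝ A (1 / 2) * (H.ε * H.base.scal - 1) * H.dtScal)
    * half_mul_two (A := A)

lemma ric_HH : H.full.ric (iH α) (iH β) = krd A α β * (H.ε * H.lam *
    ((1 / (2 * H.r)) • H.base.scal + (1 / 4 : ℝ) • (H.ε * H.dtScal))) := by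
  have h1 : ∀ k l, H.full.riem (iH α) (iM k) (iH β) (iM l)
      = krd A α β * ((1 / 2 : ℝ) • (H.ε * H.lam * H.base.ric k l)) :=
    fun k l => by
      rw [CoordMetric.riem_antisymm, CoordMetric.riem_antisymm', neg_neg, riem_MHMH, krd]
      split_ifs <;> simp
  have h2 : H.full.riem (iH α) i0 (iH β) i0
      = krd A α β * ((1 / 4 : ℝ) • (H.ε * H.lam * H.dtScal)) := by
    rw [CoordMetric.riem_antisymm, CoordMetric.riem_antisymm', neg_neg, riem_0H0H, krd]
    split_ifs <;> simp
  have h3 : ∑ γ, H.full.riem (iH α) (iH γ) (iH β) (iH γ)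
      = -(H.hypCoeff * (((N : A) - 1) * krd A α β)) := by
    have : ∀ γ, H.full.riem (iH α) (iH γ) (iH β) (iH γ)
        = -(H.hypCoeff * (krd A α β * krd A γ γ - krd A γ α * krd A γ β)) := by
      intro γ; rw [riem_HHHH, krd_symm γ α]
    have h : ∀ γ : Fin N, krd A γ γ = 1 := fun γ => by simp [krd]
    simp only [this, h, Finset.sum_neg_distrib, ← Finset.mul_sum, Finset.sum_sub_distrib,
      sum_krd_mul, Finset.sum_const, Finset.card_univ, Fintype.card_fin, nsmul_eq_mul]
    ring
  have h5 : ∑ k, ∑ l, H.gi k l * (H.ε * H.lam * H.base.ric k l) = H.ε * H.lam * H.base.scal := by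
    simp only [mul_left_comm, ← Finset.mul_sum, sum_gi_ric]
  rw [full_ric, h3, h2]
  simp only [h1, mul_left_comm _ (krd A α β), mul_smul_comm, ← Finset.smul_sum, ← Finset.mul_sum,
    h5, hypCoeff_eq]
  have hN : algebraMap ℝ A (1 / (2 * H.r)) * (N : A) = algebraMap ℝ A (1 / 2) := by
    have := H.r_ne
    rw [← map_natCast (algebraMap ℝ A), ← map_mul, ← H.r_eq]
    congr 1; field_simp
  simp only [Algebra.smul_def]
  linear_combination -(krd A α β * H.ε * H.lam * H.base.scal) * hN
    - (algebraMap ℝ A (1 / (2 * H.r)) * H.ε * H.base.scal * ((N : A) - 1) * krd A α β * H.lam)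
      * (H.lami * H.lam * H.t_mul + H.lami_mul)

end Ricci

end Thermostat

/-! ### Smooth functions on a set with unique derivatives -/

section SmoothFun

variable {Z : Type*} [NormedAddCommGroup Z] [NormedSpace ℝ Z]

/-- The algebra of functions on a set `S` that are restrictions of functions smooth on `S`.
Identifying functions that agree on `S` makes the derivatives within `S` into derivations. -/
def SmoothFun (S : Set Z) : Subalgebra ℝ (S → ℝ) where
  carrier := {f | ∃ F : Z → ℝ, ContDiffOn ℝ ∞ F S ∧ ∀ p : S, F p = f p}
  mul_mem' := by
    rintro f g ⟨F, hF, hf⟩ ⟨G, hG, hg⟩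
    exact ⟨F * G, hF.mul hG, fun p => by simp [hf, hg]⟩
  add_mem' := by
    rintro f g ⟨F, hF, hf⟩ ⟨G, hG, hg⟩
    exact ⟨F + G, hF.add hG, fun p => by simp [hf, hg]⟩
  algebraMap_mem' r := ⟨fun _ => r, contDiffOn_const, fun p => by simp⟩

namespace SmoothFun

variable {S : Set Z}

/-- The restriction to `S` of a function smooth on `S`. -/
def mk (F : Z → ℝ) (hF : ContDiffOn ℝ ∞ F S) : SmoothFun S :=
  ⟨fun p => F p, F, hF, fun _ => rfl⟩

@[simp] lemma mk_apply (F : Z → ℝ) (hF : ContDiffOn ℝ ∞ F S) (p : S) : (mk F hF).1 p = F p := rfl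

/-- A smooth extension of a smooth function on `S`. -/
def extend (f : SmoothFun S) : Z → ℝ := f.2.choose

lemma extend_contDiffOn (f : SmoothFun S) : ContDiffOn ℝ ∞ (extend f) S := f.2.choose_spec.1

lemma extend_apply (f : SmoothFun S) (p : S) : (extend f) p = f.1 p := f.2.choose_spec.2 p

lemma extend_diff (f : SmoothFun S) {p : Z} (hp : p ∈ S) :
    DifferentiableWithinAt ℝ (extend f) S p :=
  (extend_contDiffOn f).differentiableOn (by simp) p hp

lemma fderivWithin_extend (f : SmoothFun S) {F : Z → ℝ} (hF : ∀ p : S, F p = f.1 p) (p : S) :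
    fderivWithin ℝ (extend f) S p = fderivWithin ℝ F S p :=
  fderivWithin_congr (fun q hq => by rw [extend_apply f ⟨q, hq⟩, hF ⟨q, hq⟩])
    (by rw [extend_apply f, hF])

/-- The derivative of smooth functions on `S` in the direction `v`. -/
def dirDeriv (hS : UniqueDiffOn ℝ S) (v : Z) : Derivation ℝ (SmoothFun S) (SmoothFun S) :=
  Derivation.mk'
    { toFun := fun f => mk (fun z => fderivWithin ℝ (extend f) S z v)
        (((extend_contDiffOn f).fderivWithin hS (by simp)).clm_apply contDiffOn_const)
      map_add' := by
        intro f g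
        ext p
        have h := fderivWithin_extend (f + g) (F := (extend f) + (extend g))
          (fun q => by simp [extend_apply]) p
        simp only [mk_apply, h]
        rw [fderivWithin_add (hS p p.2) (extend_diff f p.2) (extend_diff g p.2)]
        rfl
      map_smul' := by
        intro r f
        ext p
        have h := fderivWithin_extend (r • f) (F := r • (extend f))
          (fun q => by simp [extend_apply]) p
        simp only [mk_apply, h]
        rw [fderivWithin_const_smul (hS p p.2) (extend_diff f p.2)]
        rfl }
    (by
      intro f g
      ext p
      have h := fderivWithin_extend (f * g) (F := (extend f) * (extend g))
        (fun q => by simp [extend_apply]) p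
      change fderivWithin ℝ (extend (f * g)) S p v
        = f.1 p * fderivWithin ℝ (extend g) S p v + g.1 p * fderivWithin ℝ (extend f) S p v
      rw [h, fderivWithin_mul (hS p p.2) (extend_diff f p.2) (extend_diff g p.2), ← extend_apply,
        ← extend_apply]
      rfl)

lemma dirDeriv_apply (hS : UniqueDiffOn ℝ S) (v : Z) (f : SmoothFun S) (p : S) {F : Z → ℝ}
    (hF : ∀ p : S, F p = f.1 p) : (dirDeriv hS v f).1 p = fderivWithin ℝ F S p v := by
  rw [← fderivWithin_extend f hF]; rfl

lemma dirDeriv_comm (hS : UniqueDiffOn ℝ S) (hS' : S ⊆ closure (interior S)) (v w : Z)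
    (f : SmoothFun S) : dirDeriv hS v (dirDeriv hS w f) = dirDeriv hS w (dirDeriv hS v f) := by
  ext p
  have key : ∀ v w : Z, (dirDeriv hS v (dirDeriv hS w f)).1 p
      = fderivWithin ℝ (fderivWithin ℝ (extend f) S) S p v w := by
    intro v w
    rw [dirDeriv_apply hS v _ p (F := fun z => fderivWithin ℝ (extend f) S z w) (fun _ => rfl)]
    have hd : DifferentiableWithinAt ℝ (fderivWithin ℝ (extend f) S) S p :=
      ((extend_contDiffOn f).fderivWithin hS (m := ∞) (by simp)).differentiableOn (by simp) p p.2
    rw [fderivWithin_clm_apply (hS p p.2) hd (differentiableWithinAt_const w)]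
    simp
  rw [key, key]
  exact ((extend_contDiffOn f) p p.2).isSymmSndFDerivWithinAt
    (by simpa using WithTop.coe_le_coe.mpr (le_top : (2 : ℕ∞) ≤ ⊤)) hS (hS' p.2) p.2 v w

/-- A smooth function without zeros is invertible. -/
lemma isUnit_of_ne_zero (f : SmoothFun S) (h : ∀ p, f.1 p ≠ 0) : IsUnit f := by
  have hF : ContDiffOn ℝ ∞ (fun z => ((extend f) z)⁻¹) S :=
    (extend_contDiffOn f).inv fun z hz => by rw [extend_apply f ⟨z, hz⟩]; exact h _
  refine IsUnit.of_mul_eq_one (mk _ hF) ?_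
  ext p
  change f.1 p * ((extend f) p)⁻¹ = 1
  rw [extend_apply f, mul_inv_cancel₀ (h p)]

/-- Evaluation at a point. -/
def eval (p : S) : SmoothFun S →ₐ[ℝ] ℝ :=
  (Pi.evalAlgHom ℝ (fun _ : S => ℝ) p).comp (SmoothFun S).val

lemma eval_apply (p : S) (f : SmoothFun S) : eval p f = f.1 p := rfl

/-- The derivation in the direction `v` is the line derivative, wherever the latter is unique. -/
lemma lineDerivWithin_eq (hS : UniqueDiffOn ℝ S) (v : Z) (p : S)
    (hline : UniqueDiffWithinAt ℝ ((fun s : ℝ => (p : Z) + s • v) ⁻¹' S) 0)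
    (f : SmoothFun S) {F : Z → ℝ} (hF : ∀ p : S, F p = f.1 p) :
    lineDerivWithin ℝ F S p v = (dirDeriv hS v f).1 p := by
  have h1 : lineDerivWithin ℝ F S p v = lineDerivWithin ℝ (extend f) S p v :=
    lineDerivWithin_congr' (fun q hq => by rw [extend_apply f ⟨q, hq⟩, hF ⟨q, hq⟩]) p.2
  rw [h1, dirDeriv_apply hS v f p (extend_apply f)]
  exact ((extend_diff f p.2).hasFDerivWithinAt.hasLineDerivWithinAt v).derivWithin hline

end SmoothFun

end SmoothFun

/-! ### Coordinate expressions represented by elements of a ring -/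

section Transport

variable {ι X τ Z : Type*} {A : Subalgebra ℝ (X → ℝ)}

/-- The family of functions `h s` on a coordinate space, with parameters `s`, is represented by the
element `f` of a ring of functions on a space `X` that maps to the parameters and coordinates. -/
def Represents (pt : X → τ × Z) (h : τ → Z → ℝ) (f : A) : Prop :=
  ∀ p, h (pt p).1 (pt p).2 = f.1 p

namespace Represents

variable {pt : X → τ × Z} {h h' : τ → Z → ℝ} {f f' : A}

lemma add (hf : Represents pt h f) (hf' : Represents pt h' f') :
    Represents pt (fun s z => h s z + h' s z) (f + f') := fun p => by simp [hf p, hf' p]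

lemma sub (hf : Represents pt h f) (hf' : Represents pt h' f') :
    Represents pt (fun s z => h s z - h' s z) (f - f') := fun p => by simp [hf p, hf' p]

lemma mul (hf : Represents pt h f) (hf' : Represents pt h' f') :
    Represents pt (fun s z => h s z * h' s z) (f * f') := fun p => by simp [hf p, hf' p]

lemma const_mul (r : ℝ) (hf : Represents pt h f) :
    Represents pt (fun s z => r * h s z) (r • f) := fun p => by simp [hf p]

lemma sum {κ : Type*} [Fintype κ] {h : κ → τ → Z → ℝ} {f : κ → A}
    (hf : ∀ k, Represents pt (h k) (f k)) :
    Represents pt (fun s z => ∑ k, h k s z) (∑ k, f k) := fun p => by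
  simp [fun k => hf k p]

end Represents

variable [Fintype ι] [DecidableEq ι] [AddCommGroup Z] [Module ℝ Z]

/-- The patches `L s` are represented by the abstract metric `C`: components and partial
derivatives correspond. -/
structure MetricRep (pt : X → τ × Z) (L : τ → MetricPatch ι Z) (C : CoordMetric ι A) : Prop where
  coeff : ∀ a b, Represents pt (fun s z => (L s).coeff z a b) (C.g a b)
  pd : ∀ a h f, Represents pt h f → Represents pt (fun s z => (L s).pd a (h s) z) (C.D a f)

namespace MetricRep

variable {pt : X → τ × Z} {L : τ → MetricPatch ι Z} {C : CoordMetric ι A}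
  (R : MetricRep pt L C)

include R

lemma inv (a b : ι) : Represents pt (fun s z => (L s).inv a b z) (C.gi a b) := by
  intro p
  let e : A →+* ℝ := ((Pi.evalAlgHom ℝ (fun _ : X => ℝ) p).comp A.val : A →ₐ[ℝ] ℝ)
  have h1 : C.g.map e = (L (pt p).1).coeff (pt p).2 := by
    ext a b; exact (R.coeff a b p).symm
  have h2 : C.gi.map e * C.g.map e = 1 := by
    rw [← Matrix.map_mul, C.gi_mul, Matrix.map_one e (map_zero e) (map_one e)]
  rw [h1] at h2
  change ((L (pt p).1).coeff (pt p).2)⁻¹ a b = (C.gi.map e) a b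
  rw [Matrix.inv_eq_left_inv h2]

lemma christoffel (a b c : ι) :
    Represents pt (fun s z => (L s).christoffel a b c z) (C.chr a b c) :=
  .const_mul _ <| .sum fun d => (R.inv a d).mul <|
    ((R.pd b _ _ (R.coeff c d)).add (R.pd c _ _ (R.coeff b d))).sub (R.pd d _ _ (R.coeff b c))

lemma riemannUp (a b c f : ι) :
    Represents pt (fun s z => (L s).riemannUp a b c f z) (C.rUp a b c f) :=
  ((R.pd b _ _ (R.christoffel f a c)).sub (R.pd a _ _ (R.christoffel f b c))).add <|
    .sum fun e => ((R.christoffel e a c).mul (R.christoffel f b e)).sub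
      ((R.christoffel e b c).mul (R.christoffel f a e))

lemma riemann (a b c d : ι) :
    Represents pt (fun s z => (L s).riemann a b c d z) (C.riem a b c d) :=
  .sum fun f => (R.coeff f d).mul (R.riemannUp a b c f)

lemma ricci (a b : ι) : Represents pt (fun s z => (L s).ricci a b z) (C.ric a b) :=
  .sum fun c => .sum fun d => (R.inv c d).mul (R.riemann a c b d)

lemma scalar : Represents pt (fun s z => (L s).scalar z) C.scal :=
  .sum fun a => .sum fun b => (R.inv a b).mul (R.ricci a b)

lemma hess {h : τ → Z → ℝ} {f : A} (hf : Represents pt h f) (a b : ι) :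
    Represents pt (fun s z => (L s).hess (h s) a b z) (C.hess f a b) :=
  (R.pd a _ _ (R.pd b _ _ hf)).sub <| .sum fun m => (R.christoffel m a b).mul (R.pd m _ _ hf)

lemma cov {B : τ → ι → ι → Z → ℝ} {B' : ι → ι → A}
    (hB : ∀ a b, Represents pt (fun s z => B s a b z) (B' a b)) (c a b : ι) :
    Represents pt (fun s z => (L s).cov (B s) c a b z) (C.cov B' c a b) :=
  (R.pd c _ _ (hB a b)).sub <| .sum fun m => ((R.christoffel m c a).mul (hB m b)).add
    ((R.christoffel m c b).mul (hB a m))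

lemma cov₂ {B : τ → ι → ι → Z → ℝ} {B' : ι → ι → A}
    (hB : ∀ a b, Represents pt (fun s z => B s a b z) (B' a b)) (d c a b : ι) :
    Represents pt (fun s z => (L s).cov₂ (B s) d c a b z) (C.cov2 B' d c a b) :=
  (R.pd d _ _ (R.cov hB c a b)).sub <| .sum fun m =>
    (((R.christoffel m d c).mul (R.cov hB m a b)).add
      ((R.christoffel m d a).mul (R.cov hB c m b))).add
      ((R.christoffel m d b).mul (R.cov hB c a m))

lemma lap {B : τ → ι → ι → Z → ℝ} {B' : ι → ι → A}
    (hB : ∀ a b, Represents pt (fun s z => B s a b z) (B' a b)) (a b : ι) :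
    Represents pt (fun s z => (L s).lap (B s) a b z) (C.lap B' a b) :=
  .sum fun d => .sum fun c => (R.inv d c).mul (R.cov₂ hB d c a b)

lemma ricciUp (k l : ι) : Represents pt (fun s z => (L s).ricciUp k l z) (C.ricUp k l) :=
  .sum fun p => .sum fun q => ((R.inv k p).mul (R.inv l q)).mul (R.ricci p q)

lemma harnackP (i j k : ι) : Represents pt (fun s z => (L s).harnackP i j k z)
    (C.cov C.ric i j k - C.cov C.ric j i k) :=
  (R.cov R.ricci i j k).sub (R.cov R.ricci j i k)

end MetricRep

end Transport

/-! ### The scalar curvature is controlled by the norm of the curvature tensor -/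

section ScalarBound

variable {ι Z : Type*} [Fintype ι] [DecidableEq ι] [AddCommGroup Z] [Module ℝ Z]

omit [DecidableEq ι] in
/-- The squared norm of a 4-tensor in terms of its components in an orthonormal frame, when
`h` is the inverse metric: the rows of `C` are the frame. -/
lemma sum_mul_sq_of_eq (C h : Matrix ι ι ℝ) (hC : h = C.transpose * C) (R : ι → ι → ι → ι → ℝ) :
    ∑ a, ∑ b, ∑ c, ∑ d, ∑ a', ∑ b', ∑ c', ∑ d',
      h a a' * h b b' * h c c' * h d d' * (R a b c d * R a' b' c' d')
    = ∑ p, ∑ q, ∑ r, ∑ s, (∑ a, ∑ b, ∑ c, ∑ d, C p a * C q b * C r c * C s d * R a b c d) ^ 2 := by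
  have h1 : ∀ a b, h a b = ∑ p, C p a * C p b := by
    intro a b; rw [hC, Matrix.mul_apply]; rfl
  have h2 : ∀ (X : ι × ι × ι × ι → ℝ), ∑ a, ∑ b, ∑ c, ∑ d, X (a, b, c, d) = ∑ x, X x := by
    intro X; simp only [Fintype.sum_prod_type]
  let K : ι × ι × ι × ι → ι × ι × ι × ι → ℝ := fun p a =>
    C p.1 a.1 * C p.2.1 a.2.1 * C p.2.2.1 a.2.2.1 * C p.2.2.2 a.2.2.2
  let Rt : ι × ι × ι × ι → ℝ := fun a => R a.1 a.2.1 a.2.2.1 a.2.2.2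
  have h3 : ∀ a b : ι × ι × ι × ι, h a.1 b.1 * h a.2.1 b.2.1 * h a.2.2.1 b.2.2.1 *
      h a.2.2.2 b.2.2.2 = ∑ p, K p a * K p b := by
    intro a b
    have e : ∀ p q r s, K (p, q, r, s) a * K (p, q, r, s) b = C p a.1 * C p b.1 *
        (C q a.2.1 * C q b.2.1 * (C r a.2.2.1 * C r b.2.2.1 * (C s a.2.2.2 * C s b.2.2.2))) := by
      intro p q r s; simp only [K]; ring
    rw [← h2 fun p => K p a * K p b]
    simp only [e, h1, ← Finset.mul_sum, ← Finset.sum_mul]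
    ring
  have hl : ∑ a, ∑ b, ∑ c, ∑ d, ∑ a', ∑ b', ∑ c', ∑ d',
      h a a' * h b b' * h c c' * h d d' * (R a b c d * R a' b' c' d')
      = ∑ a, ∑ b, (∑ p, K p a * K p b) * (Rt a * Rt b) := by
    simp only [← h3]
    simp only [← h2, Rt]
  have hr : ∑ p, ∑ q, ∑ r, ∑ s,
      (∑ a, ∑ b, ∑ c, ∑ d, C p a * C q b * C r c * C s d * R a b c d) ^ 2
      = ∑ p, (∑ a, K p a * Rt a) ^ 2 := by
    simp only [← h2, K, Rt]
  rw [hl, hr]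
  simp only [sq, Finset.sum_mul, Finset.mul_sum]
  rw [Finset.sum_congr rfl fun a _ => Finset.sum_comm, Finset.sum_comm]
  refine Finset.sum_congr rfl fun p _ => Finset.sum_congr rfl fun a _ =>
    Finset.sum_congr rfl fun b _ => ?_
  ring

/-- In an orthonormal frame the scalar curvature is a sum of `(dim)²` components of `Rm`. -/
lemma MetricPatch.scalar_sq_le (L : MetricPatch ι Z) (z : Z) (hpos : (L.coeff z).PosDef) :
    L.scalar z ^ 2 ≤ (Fintype.card ι : ℝ) ^ 2 * L.riemannNormSq z := by
  obtain ⟨C, hC⟩ : ∃ C : Matrix ι ι ℝ, (L.coeff z)⁻¹ = C.transpose * C := by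
    open scoped MatrixOrder ComplexOrder Matrix.Norms.L2Operator in
    obtain ⟨C, hC⟩ := CStarAlgebra.nonneg_iff_eq_star_mul_self.mp hpos.inv.posSemidef.nonneg
    exact ⟨C, by rw [hC, Matrix.star_eq_conjTranspose,
      Matrix.conjTranspose_eq_transpose_of_trivial]⟩
  have h1 : ∀ a b, L.inv a b z = ∑ p, C p a * C p b := by
    intro a b; rw [MetricPatch.inv, hC, Matrix.mul_apply]; rfl
  let Q : ι → ι → ι → ι → ℝ := fun p q r s =>
    ∑ a, ∑ b, ∑ c, ∑ d, C p a * C q b * C r c * C s d * L.riemann a b c d z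
  have h2 : L.riemannNormSq z = ∑ p, ∑ q, ∑ r, ∑ s, Q p q r s ^ 2 :=
    sum_mul_sq_of_eq C (L.coeff z)⁻¹ hC fun a b c d => L.riemann a b c d z
  have h3 : L.scalar z = ∑ p, ∑ q, Q p q p q := by
    have e : ∀ p q, Q p q p q = ∑ a, ∑ b, ∑ c, ∑ d,
        (C p a * C p b) * (C q c * C q d) * L.riemann a c b d z := by
      intro p q
      refine Finset.sum_congr rfl fun a _ => ?_
      rw [Finset.sum_comm]
      refine Finset.sum_congr rfl fun b _ => Finset.sum_congr rfl fun c _ =>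
        Finset.sum_congr rfl fun d _ => ?_
      ring
    simp only [MetricPatch.scalar, MetricPatch.ricci, h1, e]
    rw [Finset.sum_swap_pairs]
    refine Finset.sum_congr rfl fun a _ => Finset.sum_congr rfl fun b _ => ?_
    rw [Finset.sum_swap_pairs, Finset.mul_sum]
    refine Finset.sum_congr rfl fun c _ => ?_
    rw [Finset.mul_sum]
    refine Finset.sum_congr rfl fun d _ => ?_
    simp only [← Finset.sum_mul, ← Finset.mul_sum]
    ring
  have h4 : (∑ p, ∑ q, Q p q p q) ^ 2 ≤ (Fintype.card ι : ℝ) ^ 2 * ∑ p, ∑ q, Q p q p q ^ 2 := by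
    have := sq_sum_le_card_mul_sum_sq (s := (Finset.univ : Finset (ι × ι)))
      (f := fun x => Q x.1 x.2 x.1 x.2)
    simpa [Fintype.sum_prod_type, sq] using this
  rw [h3, h2]
  refine h4.trans ?_
  -- dropping the components of `Rm` other than `R_pqpq`
  gcongr with p _ q _
  calc Q p q p q ^ 2 ≤ ∑ s, Q p q p s ^ 2 :=
        Finset.single_le_sum (f := fun s => Q p q p s ^ 2) (fun _ _ => sq_nonneg _)
          (Finset.mem_univ q)
    _ ≤ ∑ r, ∑ s, Q p q r s ^ 2 :=
        Finset.single_le_sum (f := fun r => ∑ s, Q p q r s ^ 2)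
          (fun _ _ => Finset.sum_nonneg fun _ _ => sq_nonneg _) (Finset.mem_univ p)

end ScalarBound

/-! ### Riemannian metrics in charts -/

section Chart

variable {n : ℕ} {M : Type*} [TopologicalSpace M] [ChartedSpace (EuclideanSpace ℝ (Fin n)) M]

lemma coordVec_sum (φ : OpenPartialHomeomorph M (EuclideanSpace ℝ (Fin n)))
    (x : EuclideanSpace ℝ (Fin n)) (v : Fin n → ℝ) :
    ∑ i, v i • coordVec φ i x = mfderiv (𝓡 n) (𝓡 n) φ.symm x (WithLp.toLp 2 v) := by
  have h : (WithLp.toLp 2 v : EuclideanSpace ℝ (Fin n))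
      = ∑ i, v i • EuclideanSpace.single i (1 : ℝ) := by
    ext j; simp [Pi.single_apply]
  let D : EuclideanSpace ℝ (Fin n) →L[ℝ] TangentSpace (𝓡 n) (φ.symm x) :=
    mfderiv (𝓡 n) (𝓡 n) φ.symm x
  change ∑ i, v i • D (EuclideanSpace.single i (1 : ℝ)) = D (WithLp.toLp 2 v)
  rw [h, map_sum]
  simp only [map_smul]

variable [IsManifold (𝓡 n) ∞ M]

/-- The components of a Riemannian metric in a chart form a positive definite matrix. -/
lemma chartPatch_posDef (h : SmoothMetric n M)
    {φ : OpenPartialHomeomorph M (EuclideanSpace ℝ (Fin n))}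
    (hφ : φ ∈ IsManifold.maximalAtlas (𝓡 n) ∞ M) {x : EuclideanSpace ℝ (Fin n)}
    (hx : x ∈ φ.target) : ((chartPatch h φ).coeff x).PosDef := by
  have hdiff : φ.MDifferentiable (𝓡 n) (𝓡 n) :=
    ⟨(contMDiffOn_of_mem_maximalAtlas hφ).mdifferentiableOn (by simp),
      (contMDiffOn_symm_of_mem_maximalAtlas hφ).mdifferentiableOn (by simp)⟩
  refine Matrix.PosDef.of_dotProduct_mulVec_pos ?_ ?_
  · ext i j
    simp [chartPatch, h.symm]
  · intro v hv
    have hne : mfderiv (𝓡 n) (𝓡 n) φ.symm x (WithLp.toLp 2 v) ≠ 0 := by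
      intro h0
      have := hdiff.symm.mfderiv_injective hx (h0.trans (map_zero _).symm)
      exact hv ((WithLp.toLp_eq_zero 2).mp this)
    have hp := h.pos (φ.symm x) _ hne
    rw [← coordVec_sum] at hp
    simp only [map_sum, map_smul, _root_.sum_apply, _root_.smul_apply,
      smul_eq_mul] at hp
    simp only [dotProduct, Matrix.mulVec, chartPatch, Matrix.of_apply, Pi.star_apply, star_trivial]
    refine hp.trans_eq (Finset.sum_congr rfl fun i _ => ?_)
    refine congrArg (v i * ·) (Finset.sum_congr rfl fun j _ => ?_)
    rw [h.symm, mul_comm]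

/-- The scalar curvature of a flow with bounded curvature is bounded. -/
lemma HasBoundedCurvature.scalar_le {g : ℝ → SmoothMetric n M} {T : ℝ}
    (hb : HasBoundedCurvature g T) : ∃ C : ℝ, 0 ≤ C ∧
      ∀ φ ∈ IsManifold.maximalAtlas (𝓡 n) ∞ M, ∀ x ∈ φ.target, ∀ t ∈ Ioc 0 T,
        |(chartPatch (g t) φ).scalar x| ≤ C := by
  obtain ⟨C, hC⟩ := hb
  refine ⟨n * |C|, by positivity, fun φ hφ x hx t ht => ?_⟩
  have h1 := (chartPatch (g t) φ).scalar_sq_le x (chartPatch_posDef (g t) hφ hx)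
  have h2 := hC φ hφ x hx t ht
  rw [Fintype.card_fin] at h1
  have h3 : (chartPatch (g t) φ).riemannNormSq x ≤ |C| ^ 2 :=
    (Real.sqrt_le_left (abs_nonneg _)).mp (h2.trans (le_abs_self C))
  apply abs_le_of_sq_le_sq _ (by positivity)
  rw [mul_pow]
  exact h1.trans (by gcongr)

end Chart

namespace SmoothFun

variable {Z : Type*} [NormedAddCommGroup Z] [NormedSpace ℝ Z] {S : Set Z}

lemma dirDeriv_eq_zero (hS : UniqueDiffOn ℝ S) (v : Z)
    (hline : ∀ p : S, UniqueDiffWithinAt ℝ ((fun s : ℝ => (p : Z) + s • v) ⁻¹' S) 0)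
    (f : SmoothFun S) {F : Z → ℝ} (hF : ∀ p : S, F p = f.1 p)
    (hc : ∀ (p : Z) (s : ℝ), F (p + s • v) = F p) : dirDeriv hS v f = 0 := by
  ext p
  rw [← lineDerivWithin_eq hS v p (hline p) f hF, lineDerivWithin]
  simp only [hc]
  simp

lemma dirDeriv_clm (hS : UniqueDiffOn ℝ S) (v : Z) (f : SmoothFun S) (F : Z →L[ℝ] ℝ)
    (hF : ∀ p : S, F p = f.1 p) : dirDeriv hS v f = algebraMap ℝ _ (F v) := by
  ext p
  rw [dirDeriv_apply hS v f p hF, F.fderivWithin (hS p p.2)]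
  rfl

end SmoothFun

/-! ### Coordinates on the thermostat -/

section Concrete

variable {n : ℕ} {M : Type*} [TopologicalSpace M]
  (φ : OpenPartialHomeomorph M (EuclideanSpace ℝ (Fin n))) (T : ℝ) (N : ℕ)

/-- The range of the coordinates `(x, y, t)` on `M × ℍ^N × (0, T]`. -/
def thermoDomain : Set (TSpace n N) := φ.target ×ˢ Metric.ball 0 1 ×ˢ Ioc 0 T

/-- The coordinate directions on `M × ℍ^N × (0, T]`. -/
def thermoFrame {n N : ℕ} : TIdx n N → TSpace n N
  | Sum.inl i => (EuclideanSpace.single i 1, 0, 0)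
  | Sum.inr (Sum.inl α) => (0, EuclideanSpace.single α 1, 0)
  | Sum.inr (Sum.inr _) => (0, 0, 1)

lemma thermoDomain_uniqueDiffOn : UniqueDiffOn ℝ (thermoDomain φ T N) :=
  φ.open_target.uniqueDiffOn.prod (Metric.isOpen_ball.uniqueDiffOn.prod (uniqueDiffOn_Ioc 0 T))

lemma thermoDomain_subset_closure_interior :
    thermoDomain φ T N ⊆ closure (interior (thermoDomain φ T N)) := by
  rintro ⟨x, y, t⟩ ⟨hx, hy, ht⟩
  simp only [thermoDomain, interior_prod_eq, closure_prod_eq, φ.open_target.interior_eq,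
    Metric.isOpen_ball.interior_eq, interior_Ioc]
  refine ⟨subset_closure hx, subset_closure hy, ?_⟩
  rw [closure_Ioo (ht.1.trans_le ht.2).ne]
  exact Ioc_subset_Icc_self ht

lemma thermoDomain_line (a : TIdx n N) (p : thermoDomain φ T N) :
    UniqueDiffWithinAt ℝ
      ((fun s : ℝ => (p : TSpace n N) + s • thermoFrame a) ⁻¹' thermoDomain φ T N) 0 := by
  obtain ⟨⟨x, y, t⟩, hx, hy, ht⟩ := p
  rcases a with i | α | _
  · have h : (fun s : ℝ => (x, y, t) + s • thermoFrame (N := N) (iM i)) ⁻¹' thermoDomain φ T N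
        = (fun s : ℝ => x + s • EuclideanSpace.single i (1 : ℝ)) ⁻¹' φ.target := by
      ext s
      simp only [mem_preimage, thermoDomain, thermoFrame, mem_prod, Prod.fst_add, Prod.snd_add,
        Prod.smul_fst, Prod.smul_snd, smul_zero, add_zero]
      exact ⟨fun h => h.1, fun h => ⟨h, hy, ht⟩⟩
    change UniqueDiffWithinAt ℝ
      ((fun s : ℝ => (x, y, t) + s • thermoFrame (N := N) (iM i)) ⁻¹' thermoDomain φ T N) 0
    rw [h]
    refine (φ.open_target.preimage (by fun_prop)).uniqueDiffWithinAt ?_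
    simpa using hx
  · have h : (fun s : ℝ => (x, y, t) + s • thermoFrame (N := N) (iH α)) ⁻¹' thermoDomain φ T N
        = (fun s : ℝ => y + s • EuclideanSpace.single α (1 : ℝ)) ⁻¹' Metric.ball 0 1 := by
      ext s
      simp only [mem_preimage, thermoDomain, thermoFrame, mem_prod, Prod.fst_add, Prod.snd_add,
        Prod.smul_fst, Prod.smul_snd, smul_zero, add_zero]
      exact ⟨fun h => h.2.1, fun h => ⟨hx, h, ht⟩⟩
    change UniqueDiffWithinAt ℝ
      ((fun s : ℝ => (x, y, t) + s • thermoFrame (N := N) (iH α)) ⁻¹' thermoDomain φ T N) 0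
    rw [h]
    refine (Metric.isOpen_ball.preimage (by fun_prop)).uniqueDiffWithinAt ?_
    simpa using hy
  · have h : (fun s : ℝ => (x, y, t) + s • thermoFrame (N := N) i0) ⁻¹' thermoDomain φ T N
        = Ioc (-t) (T - t) := by
      ext s
      simp only [mem_preimage, thermoDomain, thermoFrame, mem_prod, Prod.fst_add, Prod.snd_add,
        Prod.smul_fst, Prod.smul_snd, smul_zero, add_zero, mem_Ioc, smul_eq_mul, mul_one]
      constructor
      · rintro ⟨-, -, h1, h2⟩; constructor <;> linarith
      · rintro ⟨h1, h2⟩; exact ⟨hx, hy, by linarith, by linarith⟩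
    change UniqueDiffWithinAt ℝ
      ((fun s : ℝ => (x, y, t) + s • thermoFrame (N := N) i0) ⁻¹' thermoDomain φ T N) 0
    rw [h]
    exact uniqueDiffOn_Ioc _ _ 0 ⟨by linarith [ht.1], by linarith [ht.2]⟩

/-- The partial derivatives on smooth functions of the coordinates `(x, y, t)`. -/
def thermoDeriv (a : TIdx n N) :
    Derivation ℝ (SmoothFun (thermoDomain φ T N)) (SmoothFun (thermoDomain φ T N)) :=
  SmoothFun.dirDeriv (thermoDomain_uniqueDiffOn φ T N) (thermoFrame a)

lemma thermoDeriv_comm (a b : TIdx n N) (f : SmoothFun (thermoDomain φ T N)) :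
    thermoDeriv φ T N a (thermoDeriv φ T N b f) = thermoDeriv φ T N b (thermoDeriv φ T N a f) :=
  SmoothFun.dirDeriv_comm _ (thermoDomain_subset_closure_interior φ T N) _ _ f

variable {φ T N}

/-- The time derivative is a one-variable derivative within `(0, T]`. -/
lemma hasDerivWithinAt_thermoDeriv (f : SmoothFun (thermoDomain φ T N)) (F : TSpace n N → ℝ)
    (hF : ∀ p : thermoDomain φ T N, F p = f.1 p) (p : thermoDomain φ T N) :
    HasDerivWithinAt (fun s => F (p.1.1, p.1.2.1, s)) ((thermoDeriv φ T N i0 f).1 p) (Ioc 0 T)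
      p.1.2.2 := by
  have h1 : HasFDerivWithinAt F (fderivWithin ℝ F (thermoDomain φ T N) p) (thermoDomain φ T N)
      p := by
    refine DifferentiableWithinAt.hasFDerivWithinAt ?_
    refine (SmoothFun.extend_diff f p.2).congr (fun q hq => ?_) ?_
    · rw [hF ⟨q, hq⟩, SmoothFun.extend_apply f ⟨q, hq⟩]
    · rw [hF, SmoothFun.extend_apply f]
  have h2 : HasDerivWithinAt (fun s : ℝ => ((p.1.1, p.1.2.1, s) : TSpace n N)) (0, 0, 1) (Ioc 0 T)
      p.1.2.2 :=
    (hasDerivWithinAt_const _ _ _).prodMk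
      ((hasDerivWithinAt_const _ _ _).prodMk (hasDerivWithinAt_id _ _))
  have h3 := HasFDerivWithinAt.comp_hasDerivWithinAt
    (f := fun s : ℝ => ((p.1.1, p.1.2.1, s) : TSpace n N)) p.1.2.2 h1 h2
    (fun s hs => ⟨p.2.1, p.2.2.1, hs⟩)
  rw [thermoDeriv, SmoothFun.dirDeriv_apply _ _ f p hF]
  exact h3

variable (N)

/-- The coordinate `t`. -/
def timeFun : SmoothFun (thermoDomain φ T N) :=
  SmoothFun.mk (fun z => z.2.2) (by fun_prop)

/-- The coordinates `y` of the ball. -/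
def ballFun (α : Fin N) : SmoothFun (thermoDomain φ T N) :=
  SmoothFun.mk (fun z => z.2.1 α) (by fun_prop)

/-- The function `(1 - |y|²) / 2`; the hyperbolic metric is `2N` times its inverse square. -/
def invConfFun : SmoothFun (thermoDomain φ T N) :=
  (1 / 2 : ℝ) • (1 - ∑ α, ballFun N α * ballFun N α)

lemma invConfFun_apply (p : thermoDomain φ T N) :
    (invConfFun N).1 p = (1 - ‖p.1.2.1‖ ^ 2) / 2 := by
  change SmoothFun.eval p (invConfFun N) = _
  simp only [invConfFun, map_smul, map_sub, map_one, map_sum, map_mul, smul_eq_mul]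
  rw [EuclideanSpace.norm_sq_eq]
  simp only [Real.norm_eq_abs, sq_abs]
  simp only [sq, SmoothFun.eval_apply, ballFun, SmoothFun.mk_apply]
  ring

lemma isUnit_timeFun : IsUnit (timeFun N : SmoothFun (thermoDomain φ T N)) :=
  SmoothFun.isUnit_of_ne_zero _ fun p => p.2.2.2.1.ne'

lemma isUnit_invConfFun : IsUnit (invConfFun N : SmoothFun (thermoDomain φ T N)) := by
  refine SmoothFun.isUnit_of_ne_zero _ fun p => ?_
  rw [invConfFun_apply]
  have h : ‖p.1.2.1‖ < 1 := by simpa using p.2.2.1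
  have := norm_nonneg p.1.2.1
  nlinarith

lemma inverse_timeFun_apply (p : thermoDomain φ T N) :
    (Ring.inverse (timeFun N : SmoothFun (thermoDomain φ T N))).1 p = p.1.2.2⁻¹ := by
  have h := congrArg (SmoothFun.eval p)
    (Ring.mul_inverse_cancel _ (isUnit_timeFun (φ := φ) (T := T) N))
  rw [map_mul, map_one] at h
  exact eq_inv_of_mul_eq_one_right h

lemma thermoDeriv_invConfFun (a : TIdx n N) :
    thermoDeriv φ T N a (invConfFun N) = -∑ α, ballFun N α * thermoDeriv φ T N a (ballFun N α) := by
  simp only [invConfFun, Derivation.map_smul, map_sub, Derivation.map_one_eq_zero, map_sum,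
    Derivation.leibniz, smul_eq_mul, zero_sub, smul_neg]
  rw [neg_inj, Finset.smul_sum]
  refine Finset.sum_congr rfl fun α _ => ?_
  rw [← two_smul ℝ, smul_smul]
  norm_num

lemma thermoDeriv_inverse (a : TIdx n N) {f : SmoothFun (thermoDomain φ T N)} (hf : IsUnit f) :
    thermoDeriv φ T N a (Ring.inverse f)
      = -(Ring.inverse f * Ring.inverse f * thermoDeriv φ T N a f) :=
  Thermostat.D_of_mul_eq_one _ (Ring.inverse_mul_cancel f hf)

lemma thermoDeriv_ballFun (a : TIdx n N) (α : Fin N) :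
    thermoDeriv φ T N a (ballFun N α) = algebraMap ℝ _ ((thermoFrame a).2.1 α) :=
  SmoothFun.dirDeriv_clm (thermoDomain_uniqueDiffOn φ T N) (thermoFrame a) _ 
    ((EuclideanSpace.proj (𝕜 := ℝ) α).comp
      ((ContinuousLinearMap.fst ℝ (EuclideanSpace ℝ (Fin N)) ℝ).comp
        (ContinuousLinearMap.snd ℝ (EuclideanSpace ℝ (Fin n)) (EuclideanSpace ℝ (Fin N) × ℝ))))
    fun _ => rfl

lemma thermoDeriv_timeFun (a : TIdx n N) :
    thermoDeriv φ T N a (timeFun N) = algebraMap ℝ _ (thermoFrame a).2.2 :=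
  SmoothFun.dirDeriv_clm (thermoDomain_uniqueDiffOn φ T N) (thermoFrame a) _ 
    ((ContinuousLinearMap.snd ℝ (EuclideanSpace ℝ (Fin N)) ℝ).comp
      (ContinuousLinearMap.snd ℝ (EuclideanSpace ℝ (Fin n)) (EuclideanSpace ℝ (Fin N) × ℝ)))
    fun _ => rfl

lemma inverse_invConfFun_apply (p : thermoDomain φ T N) :
    (Ring.inverse (invConfFun N : SmoothFun (thermoDomain φ T N))).1 p
      = 2 / (1 - ‖p.1.2.1‖ ^ 2) := by
  have h := congrArg (SmoothFun.eval p)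
    (Ring.mul_inverse_cancel _ (isUnit_invConfFun (φ := φ) (T := T) N))
  rw [map_mul, map_one, SmoothFun.eval_apply, invConfFun_apply] at h
  rw [← inv_div]
  exact eq_inv_of_mul_eq_one_right h

end Concrete

/-! ### The thermostat of a Ricci flow in a chart -/

section Flow

variable {n : ℕ} {M : Type*} [TopologicalSpace M] [ChartedSpace (EuclideanSpace ℝ (Fin n)) M]
  [IsManifold (𝓡 n) ∞ M]
  {T : ℝ} {g : ℝ → SmoothMetric n M} (hflow : IsRicciFlow g T)
  {φ : OpenPartialHomeomorph M (EuclideanSpace ℝ (Fin n))}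
  (hφ : φ ∈ IsManifold.maximalAtlas (𝓡 n) ∞ M) (N : ℕ)

namespace IsRicciFlow

/-- The metric of the flow, as a matrix of smooth functions of `(x, y, t)`. -/
def metricFun : Matrix (Fin n) (Fin n) (SmoothFun (thermoDomain φ T N)) :=
  Matrix.of fun i j => SmoothFun.mk (fun z => (chartPatch (g z.2.2) φ).coeff z.1 i j) <|
    (hflow.smooth φ hφ i j).comp (f := fun z : TSpace n N => (z.1, z.2.2))
      (by fun_prop) fun _ hz => ⟨hz.1, hz.2.2⟩

lemma metricFun_apply (i j : Fin n) (p : thermoDomain φ T N) :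
    (hflow.metricFun hφ N i j).1 p = (chartPatch (g p.1.2.2) φ).coeff p.1.1 i j := rfl

lemma isUnit_det_metricFun : IsUnit (hflow.metricFun hφ N).det := by
  refine SmoothFun.isUnit_of_ne_zero _ fun p => ?_
  have h : (hflow.metricFun hφ N).det.1 p = ((chartPatch (g p.1.2.2) φ).coeff p.1.1).det := by
    change SmoothFun.eval p (hflow.metricFun hφ N).det = _
    rw [AlgHom.map_det]
    rfl
  rw [h]
  exact (chartPatch_posDef (g p.1.2.2) hφ p.2.1).det_pos.ne'

/-- The metric of the flow over the ring of smooth functions of `(x, y, t)`, with the partial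
derivatives in the directions of `M`. -/
def baseMetric : CoordMetric (Fin n) (SmoothFun (thermoDomain φ T N)) where
  D i := thermoDeriv φ T N (iM i)
  D_comm _ _ _ := thermoDeriv_comm φ T N _ _ _
  g := hflow.metricFun hφ N
  gi := (hflow.metricFun hφ N)⁻¹
  g_symm i j := by
    ext p
    rw [metricFun_apply, metricFun_apply]
    exact (g p.1.2.2).symm _ _ _
  gi_mul := Matrix.nonsing_inv_mul _ (hflow.isUnit_det_metricFun hφ N)

/-- The metrics `g(t)` in the chart `φ` are represented by `baseMetric`. -/
lemma baseMetric_rep : MetricRep (fun p : thermoDomain φ T N => (p.1.2.2, p.1.1))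
    (fun s => chartPatch (g s) φ) (hflow.baseMetric hφ N) where
  coeff _ _ _ := rfl
  pd i h f hf := by
    intro p
    have h1 := SmoothFun.lineDerivWithin_eq (thermoDomain_uniqueDiffOn φ T N) (thermoFrame (iM i))
      p (thermoDomain_line φ T N _ p) f (F := fun z => h z.2.2 z.1) hf
    refine Eq.trans ?_ h1
    obtain ⟨⟨x, y, t⟩, hx, hy, ht⟩ := p
    simp only [MetricPatch.pd, lineDerivWithin, chartPatch, thermoFrame, Prod.smul_mk, smul_zero,
      Prod.mk_add_mk, add_zero]
    congr 1
    ext s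
    exact ⟨fun h => ⟨h, hy, ht⟩, fun h => h.1⟩

lemma thermoDeriv_metricFun (i j : Fin n) :
    thermoDeriv φ T N i0 (hflow.metricFun hφ N i j)
      = (-2 : ℝ) • (hflow.baseMetric hφ N).ric i j := by
  ext p
  have h1 := hasDerivWithinAt_thermoDeriv (hflow.metricFun hφ N i j)
    (fun z => (chartPatch (g z.2.2) φ).coeff z.1 i j) (fun _ => rfl) p
  have h2 := hflow.evolution φ hφ i j p.1.1 p.2.1 p.1.2.2 p.2.2.2
  have h3 := (uniqueDiffOn_Ioc 0 T p.1.2.2 p.2.2.2).eq_deriv _ h1 h2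
  rw [h3]
  exact congrArg ((-2 : ℝ) * ·) ((hflow.baseMetric_rep hφ N).ricci i j p)

/-- The coefficient `R - N / (2t)` of `dt²`. -/
def lapseFun : SmoothFun (thermoDomain φ T N) :=
  (hflow.baseMetric hφ N).scal - ((N : ℝ) / 2) • Ring.inverse (timeFun N)

lemma lapseFun_apply (p : thermoDomain φ T N) : (hflow.lapseFun hφ N).1 p
    = (chartPatch (g p.1.2.2) φ).scalar p.1.1 - N / (2 * p.1.2.2) := by
  have h : (chartPatch (g p.1.2.2) φ).scalar p.1.1 = (hflow.baseMetric hφ N).scal.1 p :=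
    (hflow.baseMetric_rep hφ N).scalar p
  change _ - (N / 2 : ℝ) * (Ring.inverse (timeFun N : SmoothFun (thermoDomain φ T N))).1 p = _
  rw [inverse_timeFun_apply, h]
  rw [div_mul_eq_div_div, div_eq_mul_inv _ p.1.2.2]

/-- The thermostat of a Ricci flow in a chart, over the ring of smooth functions of `(x, y, t)`,
when the coefficient of `dt²` has no zeros. -/
def thermostat (hN : N ≠ 0) (hG : ∀ p, (hflow.lapseFun hφ N).1 p ≠ 0) :
    Thermostat n N (SmoothFun (thermoDomain φ T N)) where
  D := thermoDeriv φ T N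
  D_comm := thermoDeriv_comm φ T N
  g := hflow.metricFun hφ N
  gi := (hflow.metricFun hφ N)⁻¹
  g_symm := (hflow.baseMetric hφ N).g_symm
  gi_mul := (hflow.baseMetric hφ N).gi_mul
  t := timeFun N
  ti := Ring.inverse (timeFun N)
  y := ballFun N
  u := Ring.inverse (invConfFun N)
  ui := invConfFun N
  ε := Ring.inverse (hflow.lapseFun hφ N)
  r := N
  r_ne := Nat.cast_ne_zero.mpr hN
  r_eq := rfl
  t_mul := Ring.mul_inverse_cancel _ (isUnit_timeFun N)
  u_mul := Ring.inverse_mul_cancel _ (isUnit_invConfFun N)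
  u_sq := by
    have h : (2 : SmoothFun (thermoDomain φ T N)) * invConfFun N
        = 1 - ∑ α, ballFun N α * ballFun N α := by
      rw [invConfFun, mul_smul_comm, two_mul, ← two_smul ℝ, smul_smul]; norm_num
    linear_combination Ring.inverse (invConfFun N) * h
      - 2 * Ring.inverse_mul_cancel _ (isUnit_invConfFun (φ := φ) (T := T) N)
  D_H_g α i j := SmoothFun.dirDeriv_eq_zero _ _ (thermoDomain_line φ T N _) _
    (F := fun z => (chartPatch (g z.2.2) φ).coeff z.1 i j) (fun _ => rfl) fun p s => by
      simp [thermoFrame]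
  D_M_t i := by rw [thermoDeriv_timeFun]; exact map_zero _
  D_H_t α := by rw [thermoDeriv_timeFun]; exact map_zero _
  D_0_t := by rw [thermoDeriv_timeFun]; exact map_one _
  D_M_u i := by
    rw [thermoDeriv_inverse _ _ (isUnit_invConfFun N), thermoDeriv_invConfFun]
    simp [thermoDeriv_ballFun, thermoFrame]
  D_0_u := by
    rw [thermoDeriv_inverse _ _ (isUnit_invConfFun N), thermoDeriv_invConfFun]
    simp [thermoDeriv_ballFun, thermoFrame]
  D_H_u α := by
    rw [thermoDeriv_inverse _ _ (isUnit_invConfFun N), thermoDeriv_invConfFun]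
    simp only [thermoDeriv_ballFun, thermoFrame, PiLp.single_apply, apply_ite (algebraMap ℝ _),
      map_one, map_zero, mul_ite, mul_one, mul_zero, Finset.sum_ite_eq', Finset.mem_univ, if_true]
    ring
  D_M_y i α := by rw [thermoDeriv_ballFun]; exact map_zero _
  D_0_y α := by rw [thermoDeriv_ballFun]; exact map_zero _
  D_H_y α β := by
    rw [thermoDeriv_ballFun]
    by_cases h : α = β <;> simp [thermoFrame, h, eq_comm]
  flow := hflow.thermoDeriv_metricFun hφ N
  ε_mul := Ring.inverse_mul_cancel _ (SmoothFun.isUnit_of_ne_zero _ hG)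

variable {N}

lemma thermostat_lam_apply (hN : N ≠ 0) (hG : ∀ p, (hflow.lapseFun hφ N).1 p ≠ 0)
    (p : thermoDomain φ T N) : (hflow.thermostat hφ N hN hG).lam.1 p
      = 2 * (N : ℝ) * (4 / (1 - ‖p.1.2.1‖ ^ 2) ^ 2) := by
  have h : (hflow.thermostat hφ N hN hG).lam.1 p = 2 * (N : ℝ) *
      ((Ring.inverse (invConfFun N : SmoothFun (thermoDomain φ T N))).1 p *
        (Ring.inverse (invConfFun N : SmoothFun (thermoDomain φ T N))).1 p) := rfl
  rw [h, inverse_invConfFun_apply]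
  generalize 1 - ‖p.1.2.1‖ ^ 2 = d
  ring

/-- The thermostat metric in a chart is represented by its counterpart over the ring of smooth
functions. -/
lemma thermostat_rep (hN : N ≠ 0) (hG : ∀ p, (hflow.lapseFun hφ N).1 p ≠ 0) :
    MetricRep (fun p : thermoDomain φ T N => ((), p.1)) (fun _ => thermostatPatch g T φ N)
      (hflow.thermostat hφ N hN hG).full where
  coeff a b p := by
    rcases a with i | α | _ <;> rcases b with j | β | _
    · rfl
    · rfl
    · rfl
    · rfl
    · have h : (hflow.thermostat hφ N hN hG).full.g (iH α) (iH β)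
          = if α = β then timeFun N * (hflow.thermostat hφ N hN hG).lam else 0 := rfl
      rw [h]
      change p.1.2.2 * (hyperbolicPatch N).coeff p.1.2.1 α β = _
      by_cases e : α = β
      · simp only [e, if_true]
        change _ = p.1.2.2 * (hflow.thermostat hφ N hN hG).lam.1 p
        rw [thermostat_lam_apply]
        simp [hyperbolicPatch]
      · simp [e, hyperbolicPatch]
    · rfl
    · rfl
    · rfl
    · exact (hflow.lapseFun_apply hφ N p).symm
  pd a h f hf p := by
    have h1 := SmoothFun.lineDerivWithin_eq (thermoDomain_uniqueDiffOn φ T N) (thermoFrame a)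
      p (thermoDomain_line φ T N _ p) f (F := h ()) hf
    refine Eq.trans ?_ h1
    rcases a with i | α | _ <;> rfl

end IsRicciFlow

end Flow

namespace Thermostat

variable {n N : ℕ} {A : Type*} [CommRing A] [Algebra ℝ A] (H : Thermostat n N A) (e : A →ₐ[ℝ] ℝ)

/-! ### The curvature operator as a quadratic form -/

/-- A symmetric double sum over the coordinate indices, split into blocks. -/
lemma sum_TIdx_symm (F : TIdx n N → TIdx n N → ℝ) (hF : ∀ a b, F a b = F b a)
    (h0 : F i0 i0 = 0) :
    ∑ a, ∑ b, F a b = ∑ i, ∑ j, F (iM i) (iM j) + 2 * ∑ i, ∑ α, F (iM i) (iH α)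
      + 2 * ∑ i, F (iM i) i0 + ∑ α, ∑ β, F (iH α) (iH β) + 2 * ∑ α, F i0 (iH α) := by
  simp only [sum_TIdx, Finset.sum_add_distrib, h0]
  have h1 : ∑ α, ∑ i, F (iH α) (iM i) = ∑ i, ∑ α, F (iM i) (iH α) := by
    rw [Finset.sum_comm]
    exact Finset.sum_congr rfl fun _ _ => Finset.sum_congr rfl fun _ _ => hF _ _
  have h2 : ∑ i, F i0 (iM i) = ∑ i, F (iM i) i0 := Finset.sum_congr rfl fun _ _ => hF _ _
  have h3 : ∑ α, F (iH α) i0 = ∑ α, F i0 (iH α) := Finset.sum_congr rfl fun _ _ => hF _ _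
  rw [h1, h2, h3]
  ring

variable (W : TIdx n N → TIdx n N → ℝ)

/-- The curvature operator applied to the bivector `W`. -/
def curvOp (a b : TIdx n N) : ℝ := ∑ c, ∑ d, e (H.full.riem a b c d) * W c d

variable {W} (hW : ∀ a b, W a b = -W b a)

include hW

/-- The sum over all pairs of indices reduces to one over pairs that are ordered by kind. The pairs
`0, k` are preferred to `k, 0` since `harnackZ` uses the components `W^{0k}`. -/
lemma curvOp_eq (a b : TIdx n N) : H.curvOp e W a b
    = ∑ k, ∑ l, e (H.full.riem a b (iM k) (iM l)) * W (iM k) (iM l)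
      + 2 * ∑ k, ∑ γ, e (H.full.riem a b (iM k) (iH γ)) * W (iM k) (iH γ)
      + 2 * ∑ k, e (H.full.riem a b i0 (iM k)) * W i0 (iM k)
      + ∑ γ, ∑ δ, e (H.full.riem a b (iH γ) (iH δ)) * W (iH γ) (iH δ)
      + 2 * ∑ γ, e (H.full.riem a b i0 (iH γ)) * W i0 (iH γ) := by
  rw [curvOp, sum_TIdx_symm (fun c d => e (H.full.riem a b c d) * W c d)]
  · congr 3
    congr 1
    refine Finset.sum_congr rfl fun k _ => ?_
    rw [H.full.riem_antisymm' a b (iM k) i0, map_neg, hW (iM k) i0, neg_mul_neg]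
  · intro c d
    rw [H.full.riem_antisymm' a b c d, map_neg, hW c d, neg_mul_neg]
  · have h := hW i0 i0
    have h0 : W i0 i0 = 0 := by linarith
    rw [h0, mul_zero]

lemma sum_riem_mul_eq :
    ∑ a, ∑ b, ∑ c, ∑ d, e (H.full.riem a b c d) * W a b * W c d
      = ∑ i, ∑ j, W (iM i) (iM j) * H.curvOp e W (iM i) (iM j)
      + 2 * ∑ i, ∑ α, W (iM i) (iH α) * H.curvOp e W (iM i) (iH α)
      + 2 * ∑ i, W (iM i) i0 * H.curvOp e W (iM i) i0
      + ∑ α, ∑ β, W (iH α) (iH β) * H.curvOp e W (iH α) (iH β)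
      + 2 * ∑ α, W i0 (iH α) * H.curvOp e W i0 (iH α) := by
  rw [← sum_TIdx_symm (fun a b => W a b * H.curvOp e W a b)]
  · refine Finset.sum_congr rfl fun a _ => Finset.sum_congr rfl fun b _ => ?_
    simp only [curvOp, Finset.mul_sum]
    exact Finset.sum_congr rfl fun c _ => Finset.sum_congr rfl fun d _ => by ring
  · intro a b
    have h : H.curvOp e W a b = -H.curvOp e W b a := by
      simp only [curvOp, ← Finset.sum_neg_distrib]
      refine Finset.sum_congr rfl fun c _ => Finset.sum_congr rfl fun d _ => ?_
      rw [H.full.riem_antisymm, map_neg, neg_mul]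
    rw [h, hW a b, neg_mul_neg]
  · have h := hW i0 i0
    have h0 : W i0 i0 = 0 := by linarith
    rw [h0, zero_mul]

lemma curvOp_MM (i j : Fin n) : H.curvOp e W (iM i) (iM j)
    = ∑ k, ∑ l, e (H.full.riem (iM i) (iM j) (iM k) (iM l)) * W (iM k) (iM l)
      + 2 * ∑ k, e (H.full.riem (iM i) (iM j) i0 (iM k)) * W i0 (iM k) := by
  rw [H.curvOp_eq e hW]
  simp [H.riem_MMMH, H.riem_MMHH, H.riem_MM0H]

lemma curvOp_M0 (i : Fin n) : H.curvOp e W (iM i) i0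
    = -∑ k, ∑ l, e (H.full.riem (iM k) (iM l) i0 (iM i)) * W (iM k) (iM l)
      - 2 * ∑ k, e (H.full.riem (iM i) i0 (iM k) i0) * W i0 (iM k) := by
  rw [H.curvOp_eq e hW]
  have h1 : ∀ k l, e (H.full.riem (iM i) i0 (iM k) (iM l))
      = -e (H.full.riem (iM k) (iM l) i0 (iM i)) := fun k l => by
    rw [H.full.riem_pair, H.full.riem_antisymm', map_neg]
  have h2 : ∀ k, e (H.full.riem (iM i) i0 i0 (iM k))
      = -e (H.full.riem (iM i) i0 (iM k) i0) := fun k => by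
    rw [H.full.riem_antisymm', map_neg]
  simp [H.riem_M0MH, H.riem_M00H, H.riem_M0HH, h1, h2, sub_eq_add_neg]

lemma curvOp_MH (i : Fin n) (α : Fin N) : H.curvOp e W (iM i) (iH α)
    = e (H.ε * H.lam) * (∑ k, e (H.base.ric i k) * W (iM k) (iH α)
      + (1 / 2) * (e (H.D (iM i) H.base.scal) * W i0 (iH α))) := by
  rw [H.curvOp_eq e hW]
  have h1 : ∀ k, e (H.full.riem (iM i) (iH α) i0 (iM k)) = 0 := fun k => by
    rw [H.full.riem_antisymm', H.riem_MHM0, neg_zero, map_zero]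
  simp only [H.riem_MHMM, H.riem_MHHH, h1, H.riem_MHMH, H.riem_MH0H, apply_ite e, map_zero,
    map_smul, map_mul, ite_mul, zero_mul, Finset.sum_ite_eq, Finset.sum_const_zero,
    Finset.mem_univ, if_true, smul_eq_mul, mul_add, Finset.mul_sum]
  simp only [mul_zero, zero_add, add_zero]
  congr 1
  · exact Finset.sum_congr rfl fun k _ => by ring
  · ring

lemma curvOp_0H (α : Fin N) : H.curvOp e W i0 (iH α)
    = e (H.ε * H.lam) * ((1 / 2) * ∑ k, e (H.D (iM k) H.base.scal) * W (iM k) (iH α)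
      + (1 / 2) * (e H.dtScal * W i0 (iH α))) := by
  rw [H.curvOp_eq e hW]
  have h1 : ∀ k, e (H.full.riem i0 (iH α) i0 (iM k)) = 0 := fun k => by
    rw [H.full.riem_antisymm', H.riem_0HM0, neg_zero, map_zero]
  simp only [H.riem_0HMM, H.riem_0HHH, h1, H.riem_0HMH, H.riem_0H0H, apply_ite e, map_zero,
    map_smul, map_mul, ite_mul, zero_mul, Finset.sum_ite_eq, Finset.sum_const_zero,
    Finset.mem_univ, if_true, smul_eq_mul, mul_add, Finset.mul_sum]
  simp only [mul_zero, zero_add, add_zero]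
  congr 1
  · exact Finset.sum_congr rfl fun k _ => by ring
  · ring

lemma curvOp_HH (α β : Fin N) : H.curvOp e W (iH α) (iH β)
    = -2 * e H.hypCoeff * W (iH α) (iH β) := by
  rw [H.curvOp_eq e hW]
  have h1 : ∀ k, e (H.full.riem (iH α) (iH β) i0 (iM k)) = 0 := fun k => by
    rw [H.full.riem_antisymm', H.riem_HHM0, neg_zero, map_zero]
  have h2 : ∀ α β : Fin N, e (krd A α β) = if α = β then 1 else 0 := fun α β => by
    rw [krd, apply_ite e, map_one, map_zero]
  simp only [H.riem_HHMM, H.riem_HHMH, h1, H.riem_HH0H, H.riem_HHHH, map_neg, map_mul, map_sub, h2,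
    map_zero, zero_mul, Finset.sum_const_zero, mul_zero, zero_add, add_zero]
  simp only [sub_mul, mul_sub, neg_sub, mul_ite, ite_mul, mul_one, mul_zero, zero_mul,
    Finset.sum_sub_distrib, Finset.sum_ite_eq, Finset.mem_univ, if_true]
  rw [Finset.sum_comm]
  simp only [Finset.sum_ite_eq, Finset.mem_univ, if_true]
  rw [hW (iH β) (iH α)]
  ring

/-- The curvature operator of the thermostat as a quadratic form on bivectors. -/
lemma sum_riem_mul :
    ∑ a, ∑ b, ∑ c, ∑ d, e (H.full.riem a b c d) * W a b * W c d
      = (∑ i, ∑ j, ∑ k, ∑ l, e (H.full.riem (iM i) (iM j) (iM k) (iM l))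
          * W (iM i) (iM j) * W (iM k) (iM l))
      + 4 * (∑ i, ∑ j, ∑ k, e (H.full.riem (iM i) (iM j) i0 (iM k)) * W (iM i) (iM j) * W i0 (iM k))
      + 4 * (∑ i, ∑ j, e (H.full.riem (iM i) i0 (iM j) i0) * W i0 (iM i) * W i0 (iM j))
      + e (H.ε * H.lam) * (∑ α, (2 * (∑ i, ∑ j, e (H.base.ric i j) * W (iM i) (iH α)
            * W (iM j) (iH α))
          + 2 * (∑ i, e (H.D (iM i) H.base.scal) * W (iM i) (iH α) * W i0 (iH α))
          + e H.dtScal * W i0 (iH α) ^ 2))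
      - 2 * e H.hypCoeff * ∑ α, ∑ β, W (iH α) (iH β) ^ 2 := by
  rw [H.sum_riem_mul_eq e hW]
  simp only [H.curvOp_MM e hW, H.curvOp_M0 e hW, H.curvOp_MH e hW, H.curvOp_0H e hW,
    H.curvOp_HH e hW, hW (iM _) i0]
  have e1 : ∑ i, ∑ j, W (iM i) (iM j) *
      (∑ k, ∑ l, e (H.full.riem (iM i) (iM j) (iM k) (iM l)) * W (iM k) (iM l)
      + 2 * ∑ k, e (H.full.riem (iM i) (iM j) i0 (iM k)) * W i0 (iM k))
      = (∑ i, ∑ j, ∑ k, ∑ l, e (H.full.riem (iM i) (iM j) (iM k) (iM l))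
          * W (iM i) (iM j) * W (iM k) (iM l))
      + 2 * (∑ i, ∑ j, ∑ k, e (H.full.riem (iM i) (iM j) i0 (iM k)) * W (iM i) (iM j)
          * W i0 (iM k)) := by
    simp only [mul_add, Finset.mul_sum, Finset.sum_add_distrib]
    congr 1 <;> · repeat' refine Finset.sum_congr rfl fun _ _ => ?_
                  ring
  have e2 : ∑ i, -W i0 (iM i) *
      (-∑ k, ∑ l, e (H.full.riem (iM k) (iM l) i0 (iM i)) * W (iM k) (iM l)
      - 2 * ∑ k, e (H.full.riem (iM i) i0 (iM k) i0) * W i0 (iM k))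
      = (∑ i, ∑ j, ∑ k, e (H.full.riem (iM i) (iM j) i0 (iM k)) * W (iM i) (iM j)
          * W i0 (iM k))
      + 2 * (∑ i, ∑ j, e (H.full.riem (iM i) i0 (iM j) i0) * W i0 (iM i) * W i0 (iM j)) := by
    have e6 : ∑ i, ∑ j, ∑ k, e (H.full.riem (iM i) (iM j) i0 (iM k)) * W (iM i) (iM j)
        * W i0 (iM k) = ∑ k, ∑ i, ∑ j, e (H.full.riem (iM i) (iM j) i0 (iM k)) * W (iM i) (iM j)
        * W i0 (iM k) := by
      rw [Finset.sum_congr rfl fun i _ => Finset.sum_comm, Finset.sum_comm]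
    have e7 : ∀ x a b : ℝ, -x * (-a - 2 * b) = x * a + 2 * (x * b) := fun x a b => by ring
    rw [e6]
    simp only [e7, Finset.sum_add_distrib]
    simp only [Finset.mul_sum]
    congr 1 <;> · repeat' refine Finset.sum_congr rfl fun _ _ => ?_
                  ring
  have e3 : ∑ i, ∑ α, W (iM i) (iH α) *
      (e (H.ε * H.lam) * (∑ k, e (H.base.ric i k) * W (iM k) (iH α)
      + (1 / 2) * (e (H.D (iM i) H.base.scal) * W i0 (iH α))))
      = e (H.ε * H.lam) * (∑ α, ((∑ i, ∑ j, e (H.base.ric i j) * W (iM i) (iH α)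
            * W (iM j) (iH α))
          + (1 / 2) * (∑ i, e (H.D (iM i) H.base.scal) * W (iM i) (iH α) * W i0 (iH α)))) := by
    rw [Finset.sum_comm, Finset.mul_sum]
    refine Finset.sum_congr rfl fun α _ => ?_
    simp only [mul_add, Finset.mul_sum, Finset.sum_add_distrib]
    congr 1 <;> · repeat' refine Finset.sum_congr rfl fun _ _ => ?_
                  ring
  have e4 : ∑ α, W i0 (iH α) *
      (e (H.ε * H.lam) * ((1 / 2) * ∑ k, e (H.D (iM k) H.base.scal) * W (iM k) (iH α)
      + (1 / 2) * (e H.dtScal * W i0 (iH α))))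
      = e (H.ε * H.lam) * (∑ α, ((1 / 2) * (∑ i, e (H.D (iM i) H.base.scal) * W (iM i) (iH α)
            * W i0 (iH α))
          + (1 / 2) * (e H.dtScal * W i0 (iH α) ^ 2))) := by
    rw [Finset.mul_sum]
    refine Finset.sum_congr rfl fun α _ => ?_
    simp only [mul_add, Finset.mul_sum]
    congr 1
    · refine Finset.sum_congr rfl fun _ _ => ?_
      ring
    · ring
  have e5 : ∑ α, ∑ β, W (iH α) (iH β) * (-2 * e H.hypCoeff * W (iH α) (iH β))
      = -2 * e H.hypCoeff * ∑ α, ∑ β, W (iH α) (iH β) ^ 2 := by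
    simp only [Finset.mul_sum]
    repeat' refine Finset.sum_congr rfl fun _ _ => ?_
    ring
  rw [e1, e2, e3, e4, e5]
  simp only [Finset.sum_add_distrib, ← Finset.mul_sum]
  ring

end Thermostat

/-! ### Estimates -/

lemma abs_mul_le_of_le {x y a b : ℝ} (hx : |x| ≤ a) (hy : |y| ≤ b) : |x * y| ≤ a * b := by
  rw [abs_mul]
  exact mul_le_mul hx hy (abs_nonneg _) ((abs_nonneg _).trans hx)

lemma abs_sub_le_of_le {x y a b : ℝ} (hx : |x| ≤ a) (hy : |y| ≤ b) : |x - y| ≤ a + b :=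
  (abs_sub _ _).trans (add_le_add hx hy)

lemma abs_add_le_of_le {x y a b : ℝ} (hx : |x| ≤ a) (hy : |y| ≤ b) : |x + y| ≤ a + b :=
  (abs_add_le _ _).trans (add_le_add hx hy)

/-- A bilinear form with bounded coefficients is bounded. -/
lemma abs_sum_mul_mul_le {κ κ' : Type*} [Fintype κ] [Fintype κ'] (F : κ → κ' → ℝ) (v : κ → ℝ)
    (w : κ' → ℝ) {E c : ℝ} (hE : 0 ≤ E) (hF : ∀ a b, |F a b| ≤ E) (hc : (Fintype.card κ : ℝ) ≤ c)
    (hc' : (Fintype.card κ' : ℝ) ≤ c) :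
    |∑ a, ∑ b, F a b * v a * w b| ≤ E * c * (∑ a, v a ^ 2 + ∑ b, w b ^ 2) / 2 := by
  have h1 : ∀ a b, |F a b * v a * w b| ≤ E / 2 * (v a ^ 2 + w b ^ 2) := by
    intro a b
    rw [mul_assoc, abs_mul]
    have h2 : |v a * w b| ≤ (v a ^ 2 + w b ^ 2) / 2 := by
      rw [abs_le]; constructor <;> nlinarith [sq_nonneg (v a + w b), sq_nonneg (v a - w b)]
    calc |F a b| * |v a * w b| ≤ E * ((v a ^ 2 + w b ^ 2) / 2) :=
          mul_le_mul (hF a b) h2 (abs_nonneg _) hE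
      _ = _ := by ring
  have h2 : 0 ≤ ∑ a, v a ^ 2 := Finset.sum_nonneg fun _ _ => sq_nonneg _
  have h3 : 0 ≤ ∑ b, w b ^ 2 := Finset.sum_nonneg fun _ _ => sq_nonneg _
  calc |∑ a, ∑ b, F a b * v a * w b|
      ≤ ∑ a, ∑ b, E / 2 * (v a ^ 2 + w b ^ 2) :=
        (Finset.abs_sum_le_sum_abs _ _).trans <| Finset.sum_le_sum fun a _ =>
          (Finset.abs_sum_le_sum_abs _ _).trans <| Finset.sum_le_sum fun b _ => h1 a b
    _ = E / 2 * (Fintype.card κ' * ∑ a, v a ^ 2 + Fintype.card κ * ∑ b, w b ^ 2) := by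
        simp only [← Finset.mul_sum, Finset.sum_add_distrib, Finset.sum_const, Finset.card_univ,
          nsmul_eq_mul]
    _ ≤ E / 2 * (c * ∑ a, v a ^ 2 + c * ∑ b, w b ^ 2) := by gcongr
    _ = _ := by ring

namespace Thermostat

variable {n N : ℕ} {A : Type*} [CommRing A] [Algebra ℝ A] (H : Thermostat n N A) (e : A →ₐ[ℝ] ℝ)

/-- The bounds on the geometry of the flow at a point (where ring elements are evaluated by `e`)
that control the curvature of the thermostat. -/
structure Bound (B : ℝ) : Prop where
  one_le : 1 ≤ B
  ε : |e H.ε| ≤ B / N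
  t : |e H.t| ≤ B
  gi : ∀ i j, |e (H.gi i j)| ≤ B
  ric : ∀ i j, |e (H.base.ric i j)| ≤ B
  scal : |e H.base.scal| ≤ B
  D_scal : ∀ i, |e (H.D (iM i) H.base.scal)| ≤ B
  dtScal : |e H.dtScal| ≤ B
  ricSq : ∀ i j, |e (H.base.ricSq i j)| ≤ B
  harnackM : ∀ i j, |e (H.harnackM i j)| ≤ B

lemma one_le_N (H : Thermostat n N A) : (1 : ℝ) ≤ N := by
  have h := H.r_ne
  rw [H.r_eq] at h
  exact_mod_cast Nat.one_le_iff_ne_zero.mpr (by exact_mod_cast h)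

lemma lam_nonneg : 0 ≤ e H.lam := by
  rw [lam, H.r_eq, map_smul, map_mul, smul_eq_mul]
  have := mul_self_nonneg (e H.u)
  positivity

/-- The size of the curvature errors, up to the factor `1 / N`. -/
def errConst (n : ℕ) (B : ℝ) : ℝ := ((n : ℝ) ^ 2 + 4) * B ^ 4

variable {H e} {B : ℝ} (hB : H.Bound e B)

namespace Bound

include hB

lemma le_errConst {x : ℝ} (k : ℕ) (hk : k ≤ 3) (hx : |x| ≤ ((n : ℝ) ^ 2 + 4) * B ^ k) :
    |e H.ε * x| ≤ errConst n B / N := by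
  have h1 := hB.one_le
  have h2 : B ^ k ≤ B ^ 3 := pow_le_pow_right₀ h1 hk
  calc |e H.ε * x| ≤ B / N * (((n : ℝ) ^ 2 + 4) * B ^ 3) :=
        abs_mul_le_of_le hB.ε (hx.trans (by gcongr))
    _ = _ := by rw [errConst]; ring

lemma abs_ε_le : |e H.ε| ≤ B := by
  have h1 := hB.one_le
  exact hB.ε.trans (div_le_self (by linarith) H.one_le_N)

lemma riem_MMMM (i j k l : Fin n) : |e (H.full.riem (iM i) (iM j) (iM k) (iM l))
    - e (H.base.riem i j k l)| ≤ errConst n B / N := by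
  rw [H.riem_MMMM, map_sub, sub_sub_cancel_left, abs_neg, map_mul]
  apply hB.le_errConst 2 (by norm_num)
  rw [map_sub, map_mul, map_mul]
  have h := abs_sub_le_of_le (abs_mul_le_of_le (hB.ric i k) (hB.ric j l))
    (abs_mul_le_of_le (hB.ric j k) (hB.ric i l))
  nlinarith [sq_nonneg (n * B)]

lemma riem_MM0M (i j k : Fin n) : |e (H.full.riem (iM i) (iM j) i0 (iM k))
    - e (H.harnackP i j k)| ≤ errConst n B / N := by
  rw [H.riem_MM0M, map_add, add_sub_cancel_left, ← mul_smul_comm, map_mul]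
  apply hB.le_errConst 2 (by norm_num)
  rw [map_smul, smul_eq_mul, map_sub, map_mul, map_mul, abs_mul]
  have h := abs_sub_le_of_le (abs_mul_le_of_le (hB.ric i k) (hB.D_scal j))
    (abs_mul_le_of_le (hB.ric j k) (hB.D_scal i))
  rw [abs_of_pos (by norm_num)]
  nlinarith [sq_nonneg (n * B)]

lemma abs_quad_le (i j : Fin n) :
    |e ((1 / 4 : ℝ) • (H.D (iM i) H.base.scal * H.D (iM j) H.base.scal)
      - (1 / 2 : ℝ) • (H.dtScal * H.base.ric i j))| ≤ B ^ 2 := by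
  rw [map_sub, map_smul, map_smul, smul_eq_mul, smul_eq_mul, map_mul, map_mul]
  have h1 := abs_le.mp (abs_mul_le_of_le (hB.D_scal i) (hB.D_scal j))
  have h2 := abs_le.mp (abs_mul_le_of_le hB.dtScal (hB.ric i j))
  rw [abs_le]
  constructor <;> nlinarith

lemma riem_M0M0 (i j : Fin n) : |e (H.full.riem (iM i) i0 (iM j) i0)
    - e (H.harnackM i j)| ≤ errConst n B / N := by
  rw [H.riem_M0M0, map_add, add_sub_cancel_left, map_mul]
  apply hB.le_errConst 2 (by norm_num)
  have h := hB.abs_quad_le i j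
  nlinarith [sq_nonneg (n * B), sq_nonneg B]

lemma ric_MM (i j : Fin n) : |e (H.full.ric (iM i) (iM j))| ≤ errConst n B / N := by
  rw [H.ric_MM, map_mul]
  apply hB.le_errConst 3 le_rfl
  rw [map_add, map_add, map_mul]
  have h := abs_add_le_of_le (abs_add_le_of_le (hB.ricSq i j) (hB.harnackM i j))
    (abs_mul_le_of_le hB.abs_ε_le (hB.abs_quad_le i j))
  have h1 := hB.one_le
  have h2 : B ≤ B ^ 3 := le_self_pow₀ h1 (by norm_num)
  have h3 : 0 ≤ (n : ℝ) ^ 2 * B ^ 3 := by positivity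
  nlinarith

lemma abs_sum_gi_mul_le {F : Fin n → Fin n → A} (hF : ∀ k l, |e (F k l)| ≤ B * B) :
    |e (∑ k, ∑ l, H.gi k l * F k l)| ≤ (n : ℝ) ^ 2 * B ^ 3 := by
  rw [map_sum]
  calc |∑ k, e (∑ l, H.gi k l * F k l)| ≤ ∑ _k : Fin n, ∑ _l : Fin n, B * (B * B) := by
        refine (Finset.abs_sum_le_sum_abs _ _).trans (Finset.sum_le_sum fun k _ => ?_)
        rw [map_sum]
        refine (Finset.abs_sum_le_sum_abs _ _).trans (Finset.sum_le_sum fun l _ => ?_)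
        rw [map_mul]
        exact abs_mul_le_of_le (hB.gi k l) (hF k l)
    _ = _ := by simp; ring

lemma ric_M0 (i : Fin n) : |e (H.full.ric (iM i) i0)| ≤ errConst n B / N := by
  rw [H.ric_M0, ← mul_smul_comm, map_mul]
  apply hB.le_errConst 3 le_rfl
  have h := hB.abs_sum_gi_mul_le (F := fun k l => H.base.ric i l * H.D (iM k) H.base.scal)
    fun k l => by rw [map_mul]; exact abs_mul_le_of_le (hB.ric i l) (hB.D_scal k)
  rw [map_smul, smul_eq_mul, abs_mul, abs_of_pos (by norm_num)]
  have h1 := hB.one_le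
  have h3 : 0 ≤ B ^ 3 := by positivity
  have h4 := abs_nonneg (e (∑ k, ∑ l, H.gi k l * (H.base.ric i l * H.D (iM k) H.base.scal)))
  linarith

lemma ric_00 : |e (H.full.ric i0 i0)| ≤ errConst n B / N := by
  rw [H.ric_00, ← mul_smul_comm, map_mul]
  apply hB.le_errConst 3 le_rfl
  have h := hB.abs_sum_gi_mul_le (F := fun k l => H.D (iM k) H.base.scal * H.D (iM l) H.base.scal)
    fun k l => by rw [map_mul]; exact abs_mul_le_of_le (hB.D_scal k) (hB.D_scal l)
  rw [map_smul, smul_eq_mul, abs_mul, abs_of_pos (by norm_num)]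
  have h1 := hB.one_le
  have h3 : 0 ≤ B ^ 3 := by positivity
  have h4 := abs_nonneg
    (e (∑ k, ∑ l, H.gi k l * (H.D (iM k) H.base.scal * H.D (iM l) H.base.scal)))
  linarith

/-- The factor of the metric in the Ricci tensor of the thermostat along the hyperbolic space. -/
lemma ricCoeff_le : |e H.ε * e ((1 / (2 * H.r)) • H.base.scal
    + (1 / 4 : ℝ) • (H.ε * H.dtScal))| ≤ errConst n B / N := by
  apply hB.le_errConst 2 (by norm_num)
  rw [map_add, map_smul, map_smul, map_mul, smul_eq_mul, smul_eq_mul]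
  have h0 := H.one_le_N
  have h5 : |1 / (2 * H.r)| ≤ 1 := by
    rw [H.r_eq, abs_of_pos (by positivity), div_le_one (by positivity)]
    linarith
  have h := abs_add_le_of_le (abs_mul_le_of_le h5 hB.scal)
    (abs_mul_le_of_le (x := 1 / 4) (a := 1) (by norm_num [abs_of_pos])
      (abs_mul_le_of_le hB.abs_ε_le hB.dtScal))
  have h1 := hB.one_le
  nlinarith [sq_nonneg (n * B)]

lemma hypCoeff_le : |e H.hypCoeff| ≤ errConst n B / N * e H.lam ^ 2 := by
  have h0 := H.one_le_N
  have h1 := hB.one_le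
  have h5 : |1 / (2 * H.r)| ≤ 1 := by
    rw [H.r_eq, abs_of_pos (by positivity), div_le_one (by positivity)]
    linarith
  have h2 : e H.hypCoeff = (e H.ε * (1 / (2 * H.r) * (e H.t * e H.base.scal))) * e H.lam ^ 2 := by
    rw [H.hypCoeff_eq, map_smul, smul_eq_mul]
    simp only [map_mul]
    ring
  rw [h2, abs_mul, abs_of_nonneg (sq_nonneg (e H.lam))]
  refine mul_le_mul_of_nonneg_right ?_ (sq_nonneg _)
  apply hB.le_errConst 2 (by norm_num)
  have h := abs_mul_le_of_le h5 (abs_mul_le_of_le hB.t hB.scal)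
  nlinarith [sq_nonneg (n * B)]

lemma errConst_nonneg : 0 ≤ errConst n B / N := by
  have := hB.one_le
  rw [errConst]; positivity

/-- The thermostat is almost Ricci flat. -/
lemma ricci_le (V : TIdx n N → ℝ) :
    |∑ a, ∑ b, e (H.full.ric a b) * V a * V b| ≤ 2 * ((n : ℝ) ^ 2 + 4) * errConst n B / N *
      (∑ i, V (iM i) ^ 2 + e H.lam * ∑ α, V (iH α) ^ 2 + V i0 ^ 2) := by
  set E := errConst n B / N with hE
  have hE0 : 0 ≤ E := hB.errConst_nonneg
  have hl := H.lam_nonneg e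
  set ρ := e H.ε * e ((1 / (2 * H.r)) • H.base.scal + (1 / 4 : ℝ) • (H.ε * H.dtScal)) with hρ
  have h2 : ∀ α β : Fin N, e (krd A α β) = if α = β then 1 else 0 := fun α β => by
    rw [krd, apply_ite e, map_one, map_zero]
  have key : ∑ a, ∑ b, e (H.full.ric a b) * V a * V b
      = ∑ i, ∑ j, e (H.full.ric (iM i) (iM j)) * V (iM i) * V (iM j)
        + 2 * ∑ i, ∑ _k : Unit, e (H.full.ric (iM i) i0) * V (iM i) * V i0
        + ρ * (e H.lam * ∑ α, V (iH α) ^ 2) + e (H.full.ric i0 i0) * V i0 ^ 2 := by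
    have s1 : ∀ i α, H.full.ric (iH α) (iM i) = 0 := fun i α => by
      rw [H.full.ric_symm, H.ric_MH]
    have s2 : ∀ α, H.full.ric i0 (iH α) = 0 := fun α => by rw [H.full.ric_symm, H.ric_H0]
    have s3 : ∀ i, H.full.ric i0 (iM i) = H.full.ric (iM i) i0 := fun i => H.full.ric_symm _ _
    have s4 : ∑ α, ∑ β, e (H.full.ric (iH α) (iH β)) * V (iH α) * V (iH β)
        = ρ * (e H.lam * ∑ α, V (iH α) ^ 2) := by
      simp only [H.ric_HH, map_mul, h2, ite_mul, one_mul, zero_mul, Finset.sum_ite_eq,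
        Finset.mem_univ, if_true, Finset.mul_sum]
      exact Finset.sum_congr rfl fun α _ => by rw [hρ]; ring
    simp only [sum_TIdx, Finset.sum_add_distrib, s4, s1, s2, s3, H.ric_MH, H.ric_H0, map_zero,
      zero_mul, Finset.sum_const_zero, Finset.univ_unique, Finset.sum_singleton]
    rw [Finset.sum_congr rfl fun i _ => show e (H.full.ric (iM i) i0) * V i0 * V (iM i)
      = e (H.full.ric (iM i) i0) * V (iM i) * V i0 by ring]
    ring
  have hn : (n : ℝ) ≤ (n : ℝ) ^ 2 + 4 := by nlinarith [sq_nonneg ((n : ℝ) - 1)]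
  have hn1 : (1 : ℝ) ≤ (n : ℝ) ^ 2 + 4 := by nlinarith
  have b1 := abs_sum_mul_mul_le (fun i j => e (H.full.ric (iM i) (iM j))) (fun i => V (iM i))
    (fun i => V (iM i)) hE0 hB.ric_MM (by simpa using hn) (by simpa using hn)
  have b2 := abs_sum_mul_mul_le (fun i (_ : Unit) => e (H.full.ric (iM i) i0)) (fun i => V (iM i))
    (fun _ => V i0) hE0 (fun i _ => hB.ric_M0 i) (by simpa using hn) (by simpa using hn1)
  have p1 : 0 ≤ ∑ i, V (iM i) ^ 2 := Finset.sum_nonneg fun _ _ => sq_nonneg _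
  have p2 : 0 ≤ e H.lam * ∑ α, V (iH α) ^ 2 :=
    mul_nonneg hl (Finset.sum_nonneg fun _ _ => sq_nonneg _)
  have b3 : |ρ * (e H.lam * ∑ α, V (iH α) ^ 2)| ≤ E * (e H.lam * ∑ α, V (iH α) ^ 2) := by
    rw [abs_mul, abs_of_nonneg p2]
    exact mul_le_mul_of_nonneg_right hB.ricCoeff_le p2
  have b4 : |e (H.full.ric i0 i0) * V i0 ^ 2| ≤ E * V i0 ^ 2 := by
    rw [abs_mul, abs_of_nonneg (sq_nonneg (V i0))]
    exact mul_le_mul_of_nonneg_right hB.ric_00 (sq_nonneg _)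
  rw [key]
  simp only [Finset.univ_unique, Finset.sum_singleton] at b2 ⊢
  generalize ∑ i, ∑ j, e (H.full.ric (iM i) (iM j)) * V (iM i) * V (iM j) = x1 at *
  generalize ∑ i, e (H.full.ric (iM i) i0) * V (iM i) * V i0 = x2 at *
  generalize e H.lam * ∑ α, V (iH α) ^ 2 = q at *
  generalize ∑ i, V (iM i) ^ 2 = p at *
  rw [mul_div_assoc, ← hE]
  have p3 := sq_nonneg (V i0)
  have m1 : E * q ≤ E * ((n : ℝ) ^ 2 + 4) * q := by
    rw [mul_assoc]; gcongr; nlinarith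
  have m2 : E * V i0 ^ 2 ≤ E * ((n : ℝ) ^ 2 + 4) * V i0 ^ 2 := by
    rw [mul_assoc]; gcongr; nlinarith
  have m3 : 0 ≤ E * ((n : ℝ) ^ 2 + 4) * q := by positivity
  rw [abs_le] at *
  constructor <;> nlinarith

/-- The curvature operator of the thermostat is close to Hamilton's Harnack expression. -/
lemma curvature_le {W : TIdx n N → TIdx n N → ℝ} (hW : ∀ a b, W a b = -W b a) :
    |(∑ a, ∑ b, ∑ c, ∑ d, e (H.full.riem a b c d) * W a b * W c d)
      - ((∑ i, ∑ j, ∑ k, ∑ l, e (H.base.riem i j k l) * W (iM i) (iM j) * W (iM k) (iM l))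
        + 4 * (∑ i, ∑ j, ∑ k, e (H.harnackP i j k) * W (iM i) (iM j) * W i0 (iM k))
        + 4 * (∑ i, ∑ j, e (H.harnackM i j) * W i0 (iM i) * W i0 (iM j)))|
      ≤ 4 * ((n : ℝ) ^ 2 + 4) * errConst n B / N *
      (∑ i, ∑ j, W (iM i) (iM j) ^ 2 + 2 * (e H.lam * ∑ α, ∑ i, W (iM i) (iH α) ^ 2)
        + 2 * ∑ i, W i0 (iM i) ^ 2 + 2 * (e H.lam * ∑ α, W i0 (iH α) ^ 2)
        + e H.lam ^ 2 * ∑ α, ∑ β, W (iH α) (iH β) ^ 2) := by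
  set E := errConst n B / N with hE
  have hE0 : 0 ≤ E := hB.errConst_nonneg
  have hl := H.lam_nonneg e
  set c := (n : ℝ) ^ 2 + 4 with hc
  have hn : (n : ℝ) ≤ c := by nlinarith [sq_nonneg ((n : ℝ) - 1)]
  have hn1 : (4 : ℝ) ≤ c := by nlinarith
  have hnn : (n : ℝ) * n ≤ c := by nlinarith
  set w : Fin n × Fin n → ℝ := fun x => W (iM x.1) (iM x.2) with hw
  have hsw : ∑ x, w x ^ 2 = ∑ i, ∑ j, W (iM i) (iM j) ^ 2 := by simp only [Fintype.sum_prod_type, w]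
  have b1 : |(∑ i, ∑ j, ∑ k, ∑ l, e (H.full.riem (iM i) (iM j) (iM k) (iM l))
      * W (iM i) (iM j) * W (iM k) (iM l))
      - ∑ i, ∑ j, ∑ k, ∑ l, e (H.base.riem i j k l) * W (iM i) (iM j) * W (iM k) (iM l)|
      ≤ E * c * ∑ i, ∑ j, W (iM i) (iM j) ^ 2 := by
    have h := abs_sum_mul_mul_le (fun (x y : Fin n × Fin n) =>
      e (H.full.riem (iM x.1) (iM x.2) (iM y.1) (iM y.2)) - e (H.base.riem x.1 x.2 y.1 y.2)) w w
      hE0 (fun _ _ => hB.riem_MMMM _ _ _ _) (by simpa using hnn) (by simpa using hnn)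
    rw [hsw] at h
    simp only [Fintype.sum_prod_type, sub_mul, Finset.sum_sub_distrib, w] at h
    linarith
  have b2 : |(∑ i, ∑ j, ∑ k, e (H.full.riem (iM i) (iM j) i0 (iM k)) * W (iM i) (iM j)
      * W i0 (iM k)) - ∑ i, ∑ j, ∑ k, e (H.harnackP i j k) * W (iM i) (iM j) * W i0 (iM k)|
      ≤ E * c * (∑ i, ∑ j, W (iM i) (iM j) ^ 2 + ∑ i, W i0 (iM i) ^ 2) / 2 := by
    have h := abs_sum_mul_mul_le (fun (x : Fin n × Fin n) (k : Fin n) =>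
      e (H.full.riem (iM x.1) (iM x.2) i0 (iM k)) - e (H.harnackP x.1 x.2 k)) w
      (fun k => W i0 (iM k)) hE0 (fun _ _ => hB.riem_MM0M _ _ _) (by simpa using hnn)
      (by simpa using hn)
    rw [hsw] at h
    simpa only [Fintype.sum_prod_type, sub_mul, Finset.sum_sub_distrib, w] using h
  have b3 : |(∑ i, ∑ j, e (H.full.riem (iM i) i0 (iM j) i0) * W i0 (iM i) * W i0 (iM j))
      - ∑ i, ∑ j, e (H.harnackM i j) * W i0 (iM i) * W i0 (iM j)|
      ≤ E * c * ∑ i, W i0 (iM i) ^ 2 := by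
    have h := abs_sum_mul_mul_le (fun i j =>
      e (H.full.riem (iM i) i0 (iM j) i0) - e (H.harnackM i j)) (fun k => W i0 (iM k))
      (fun k => W i0 (iM k)) hE0 hB.riem_M0M0 (by simpa using hn) (by simpa using hn)
    simp only [sub_mul, Finset.sum_sub_distrib] at h
    linarith
  have bH : ∀ α, |e H.ε * (2 * (∑ i, ∑ j, e (H.base.ric i j) * W (iM i) (iH α) * W (iM j) (iH α))
      + 2 * (∑ i, e (H.D (iM i) H.base.scal) * W (iM i) (iH α) * W i0 (iH α))
      + e H.dtScal * W i0 (iH α) ^ 2)|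
      ≤ E * c * (3 * ∑ i, W (iM i) (iH α) ^ 2 + 2 * W i0 (iH α) ^ 2) := by
    intro α
    have hB0 : 0 ≤ B := zero_le_one.trans hB.one_le
    have h1 := abs_sum_mul_mul_le (fun i j => e (H.base.ric i j)) (fun i => W (iM i) (iH α))
      (fun i => W (iM i) (iH α)) hB0 hB.ric (by simpa using hn) (by simpa using hn)
    have h2 := abs_sum_mul_mul_le (fun i (_ : Unit) => e (H.D (iM i) H.base.scal))
      (fun i => W (iM i) (iH α)) (fun _ => W i0 (iH α)) hB0 (fun i _ => hB.D_scal i)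
      (by simpa using hn) (c := c) (by simp; linarith)
    simp only [Finset.univ_unique, Finset.sum_singleton] at h2
    have h3 : |e H.dtScal * W i0 (iH α) ^ 2| ≤ B * W i0 (iH α) ^ 2 := by
      rw [abs_mul, abs_of_nonneg (sq_nonneg (W i0 (iH α)))]
      exact mul_le_mul_of_nonneg_right hB.dtScal (sq_nonneg _)
    have hp : 0 ≤ ∑ i, W (iM i) (iH α) ^ 2 := Finset.sum_nonneg fun _ _ => sq_nonneg _
    generalize ∑ i, ∑ j, e (H.base.ric i j) * W (iM i) (iH α) * W (iM j) (iH α) = x1 at *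
    generalize ∑ i, e (H.D (iM i) H.base.scal) * W (iM i) (iH α) * W i0 (iH α) = x2 at *
    generalize ∑ i, W (iM i) (iH α) ^ 2 = p at *
    generalize e H.dtScal * W i0 (iH α) ^ 2 = x3 at *
    have hq := sq_nonneg (W i0 (iH α))
    generalize W i0 (iH α) ^ 2 = q at *
    have h4 : |2 * x1 + 2 * x2 + x3| ≤ B * c * (3 * p + 2 * q) := by
      have h5 : B * q ≤ B * c * q := by
        rw [mul_assoc]; gcongr; nlinarith
      rw [abs_le] at *
      constructor <;> nlinarith
    calc _ ≤ B / N * (B * c * (3 * p + 2 * q)) := abs_mul_le_of_le hB.ε h4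
      _ ≤ _ := by
        -- `errConst` has enough powers of `B` to absorb the bound of the coefficients
        have h6 : B / N * B ≤ E := by
          have h7 : B ^ 2 ≤ errConst n B := by
            have := pow_le_pow_right₀ hB.one_le (show 2 ≤ 4 by norm_num)
            rw [errConst]; nlinarith
          rw [hE, div_mul_eq_mul_div, ← sq]
          gcongr
        calc B / N * (B * c * (3 * p + 2 * q)) = B / N * B * (c * (3 * p + 2 * q)) := by ring
          _ ≤ E * (c * (3 * p + 2 * q)) := by gcongr
          _ = _ := by ring
  have b4 : |e (H.ε * H.lam) * ∑ α, (2 * (∑ i, ∑ j, e (H.base.ric i j) * W (iM i) (iH α)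
            * W (iM j) (iH α))
          + 2 * (∑ i, e (H.D (iM i) H.base.scal) * W (iM i) (iH α) * W i0 (iH α))
          + e H.dtScal * W i0 (iH α) ^ 2)|
      ≤ E * c * (3 * (e H.lam * ∑ α, ∑ i, W (iM i) (iH α) ^ 2)
        + 2 * (e H.lam * ∑ α, W i0 (iH α) ^ 2)) := by
    have h := Finset.sum_le_sum fun α (_ : α ∈ Finset.univ) => bH α
    have h1 := (Finset.abs_sum_le_sum_abs _ _).trans h
    rw [← Finset.mul_sum] at h1
    rw [map_mul, mul_comm (e H.ε), mul_assoc, abs_mul, abs_of_nonneg hl]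
    refine (mul_le_mul_of_nonneg_left h1 hl).trans_eq ?_
    rw [← Finset.mul_sum, Finset.sum_add_distrib, ← Finset.mul_sum, ← Finset.mul_sum]
    ring
  have pHH : 0 ≤ ∑ α, ∑ β, W (iH α) (iH β) ^ 2 :=
    Finset.sum_nonneg fun _ _ => Finset.sum_nonneg fun _ _ => sq_nonneg _
  have b5 : |e H.hypCoeff * ∑ α, ∑ β, W (iH α) (iH β) ^ 2|
      ≤ E * (e H.lam ^ 2 * ∑ α, ∑ β, W (iH α) (iH β) ^ 2) := by
    rw [abs_mul, abs_of_nonneg pHH, ← mul_assoc]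
    exact mul_le_mul_of_nonneg_right hB.hypCoeff_le pHH
  rw [H.sum_riem_mul e hW]
  have p1 : 0 ≤ ∑ i, ∑ j, W (iM i) (iM j) ^ 2 :=
    Finset.sum_nonneg fun _ _ => Finset.sum_nonneg fun _ _ => sq_nonneg _
  have p2 : 0 ≤ e H.lam * ∑ α, ∑ i, W (iM i) (iH α) ^ 2 :=
    mul_nonneg hl (Finset.sum_nonneg fun _ _ => Finset.sum_nonneg fun _ _ => sq_nonneg _)
  have p3 : 0 ≤ ∑ i, W i0 (iM i) ^ 2 := Finset.sum_nonneg fun _ _ => sq_nonneg _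
  have p4 : 0 ≤ e H.lam * ∑ α, W i0 (iH α) ^ 2 :=
    mul_nonneg hl (Finset.sum_nonneg fun _ _ => sq_nonneg _)
  have p5 : 0 ≤ e H.lam ^ 2 * ∑ α, ∑ β, W (iH α) (iH β) ^ 2 := mul_nonneg (sq_nonneg _) pHH
  rw [mul_assoc (2 : ℝ) (e H.hypCoeff)]
  generalize (∑ i, ∑ j, ∑ k, ∑ l, e (H.full.riem (iM i) (iM j) (iM k) (iM l))
      * W (iM i) (iM j) * W (iM k) (iM l)) = x1 at *
  generalize (∑ i, ∑ j, ∑ k, ∑ l, e (H.base.riem i j k l) * W (iM i) (iM j)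
    * W (iM k) (iM l)) = y1 at *
  generalize (∑ i, ∑ j, ∑ k, e (H.full.riem (iM i) (iM j) i0 (iM k)) * W (iM i) (iM j)
      * W i0 (iM k)) = x2 at *
  generalize (∑ i, ∑ j, ∑ k, e (H.harnackP i j k) * W (iM i) (iM j) * W i0 (iM k)) = y2 at *
  generalize (∑ i, ∑ j, e (H.full.riem (iM i) i0 (iM j) i0) * W i0 (iM i) * W i0 (iM j)) = x3 at *
  generalize (∑ i, ∑ j, e (H.harnackM i j) * W i0 (iM i) * W i0 (iM j)) = y3 at *
  generalize e (H.ε * H.lam) * _ = x4 at *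
  generalize e H.hypCoeff * _ = x5 at *
  generalize ∑ i, ∑ j, W (iM i) (iM j) ^ 2 = q1 at *
  generalize e H.lam * ∑ α, ∑ i, W (iM i) (iH α) ^ 2 = q2 at *
  generalize ∑ i, W i0 (iM i) ^ 2 = q3 at *
  generalize e H.lam * ∑ α, W i0 (iH α) ^ 2 = q4 at *
  generalize e H.lam ^ 2 * _ = q5 at *
  rw [mul_div_assoc, ← hE]
  have hE5 : E * q5 ≤ E * c * q5 / 4 := by
    have : E * 4 * q5 ≤ E * c * q5 := by gcongr
    linarith
  have m1 : 0 ≤ E * c * q1 := by positivity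
  have m2 : 0 ≤ E * c * q2 := by positivity
  have m3 : 0 ≤ E * c * q3 := by positivity
  have m4 : 0 ≤ E * c * q4 := by positivity
  have m5 : 0 ≤ E * c * q5 := by positivity
  rw [abs_le] at *
  constructor <;> linarith

end Bound

end Thermostat

/-! ### The reference norms -/

section Norms

variable {n N : ℕ} (y : EuclideanSpace ℝ (Fin N))

/-- The conformal factor of the metric of `ℍ^N` in the ball. -/
def confFactor : ℝ := 2 * (N : ℝ) * (4 / (1 - ‖y‖ ^ 2) ^ 2)

/-- The diagonal components of the reference inner product. -/
def refDiag : TIdx n N → ℝ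
  | Sum.inl _ => 1
  | Sum.inr (Sum.inl _) => confFactor y
  | Sum.inr (Sum.inr _) => 1

lemma refCoeff_eq (a b : TIdx n N) : refCoeff n y a b = if a = b then refDiag y a else 0 := by
  rcases a with i | α | _ <;> rcases b with j | β | _ <;>
    simp [refCoeff, refDiag, hyperbolicPatch, confFactor, Matrix.one_apply]

lemma vecNormSq_eq (V : TIdx n N → ℝ) : vecNormSq y V
    = ∑ i, V (iM i) ^ 2 + confFactor y * ∑ α, V (iH α) ^ 2 + V i0 ^ 2 := by
  simp only [vecNormSq, refCoeff_eq, ite_mul, zero_mul, Finset.sum_ite_eq, Finset.mem_univ, if_true,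
    sum_TIdx, refDiag, Finset.mul_sum, sq, one_mul, mul_assoc]

lemma bivecNormSq_eq {W : TIdx n N → TIdx n N → ℝ} (hW : ∀ a b, W a b = -W b a) : bivecNormSq y W
    = ∑ i, ∑ j, W (iM i) (iM j) ^ 2 + 2 * (confFactor y * ∑ α, ∑ i, W (iM i) (iH α) ^ 2)
        + 2 * ∑ i, W i0 (iM i) ^ 2 + 2 * (confFactor y * ∑ α, W i0 (iH α) ^ 2)
        + confFactor y ^ 2 * ∑ α, ∑ β, W (iH α) (iH β) ^ 2 := by
  have h0 : W i0 i0 = 0 := by have h := hW i0 i0; linarith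
  have h1 : bivecNormSq y W = ∑ a, ∑ b, refDiag y a * refDiag y b * W a b ^ 2 := by
    refine Finset.sum_congr rfl fun a _ => Finset.sum_congr rfl fun b _ => ?_
    simp only [refCoeff_eq, ite_mul, mul_ite, zero_mul, mul_zero, Finset.sum_ite_eq,
      Finset.mem_univ, if_true, sq, mul_assoc]
  rw [h1, Thermostat.sum_TIdx_symm]
  · simp only [refDiag, hW (iM _) i0, Finset.mul_sum, one_mul, mul_one, neg_sq]
    have h2 : ∑ i, ∑ α, 2 * (confFactor y * W (iM i) (iH α) ^ 2)
        = ∑ α, ∑ i, 2 * (confFactor y * W (iM i) (iH α) ^ 2) := Finset.sum_comm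
    rw [h2]
    simp only [sq (confFactor y), mul_assoc]
    ring
  · intro a b
    rw [hW a b]; ring
  · rw [h0]; ring

end Norms

/-! ### Bounds on compact sets -/

section Compact

variable {n : ℕ} {M : Type*} [TopologicalSpace M] {T : ℝ}
  {φ : OpenPartialHomeomorph M (EuclideanSpace ℝ (Fin n))} (N : ℕ)

/-- The time and the coordinates in `M` of a point of the thermostat. -/
def basePt (p : thermoDomain φ T N) : ℝ × EuclideanSpace ℝ (Fin n) := (p.1.2.2, p.1.1)

/-- Time derivatives are represented by the derivation in the direction of time. -/
lemma represents_time {h : ℝ → EuclideanSpace ℝ (Fin n) → ℝ} {f : SmoothFun (thermoDomain φ T N)}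
    (hf : Represents (basePt N) h f) :
    Represents (basePt N) (fun s z => derivWithin (fun r => h r z) (Ioc 0 T) s)
      (thermoDeriv φ T N i0 f) := fun p =>
  (hasDerivWithinAt_thermoDeriv f (fun z => h z.2.2 z.1) hf p).derivWithin
    (uniqueDiffOn_Ioc 0 T _ p.2.2.2)

lemma represents_inv_time :
    Represents (basePt N) (fun s _ => s⁻¹)
      (Ring.inverse (timeFun N) : SmoothFun (thermoDomain φ T N)) := fun p =>
  (inverse_timeFun_apply N p).symm

/-- A function of `(x, t)` that is represented over the ring of smooth functions is bounded on
compact sets. It suffices to consider `N = 0`, where the ball is a point. -/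
lemma exists_abs_le {h : ℝ → EuclideanSpace ℝ (Fin n) → ℝ} {f : SmoothFun (thermoDomain φ T 0)}
    (hf : Represents (basePt 0) h f) {K : Set (EuclideanSpace ℝ (Fin n) × ℝ)}
    (hK : IsCompact K) (hKs : K ⊆ φ.target ×ˢ Ioc 0 T) : ∃ C, ∀ q ∈ K, |h q.2 q.1| ≤ C := by
  have hmem : ∀ q ∈ K, ((q.1, 0, q.2) : TSpace n 0) ∈ thermoDomain φ T 0 := fun q hq =>
    ⟨(hKs hq).1, by simp, (hKs hq).2⟩
  have hc : ContinuousOn (fun q : EuclideanSpace ℝ (Fin n) × ℝ =>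
      SmoothFun.extend f ((q.1, 0, q.2) : TSpace n 0)) K :=
    (SmoothFun.extend_contDiffOn f).continuousOn.comp (by fun_prop) hmem
  obtain ⟨C, hC⟩ := hK.exists_bound_of_continuousOn hc
  refine ⟨C, fun q hq => ?_⟩
  have h1 := hf ⟨_, hmem q hq⟩
  have h2 := SmoothFun.extend_apply f ⟨_, hmem q hq⟩
  refine le_trans (le_of_eq ?_) (hC q hq)
  rw [Real.norm_eq_abs, h2, ← h1]
  rfl

lemma exists_forall_abs_le {κ : Type*} [Fintype κ] {h : κ → ℝ → EuclideanSpace ℝ (Fin n) → ℝ}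
    {f : κ → SmoothFun (thermoDomain φ T 0)}
    (hf : ∀ k, Represents (basePt 0) (h k) (f k)) {K : Set (EuclideanSpace ℝ (Fin n) × ℝ)}
    (hK : IsCompact K) (hKs : K ⊆ φ.target ×ˢ Ioc 0 T) :
    ∃ C, 0 ≤ C ∧ ∀ k, ∀ q ∈ K, |h k q.2 q.1| ≤ C := by
  choose C hC using fun k => exists_abs_le (hf k) hK hKs
  refine ⟨∑ k, |C k|, Finset.sum_nonneg fun _ _ => abs_nonneg _, fun k q hq => ?_⟩
  exact ((hC k q hq).trans (le_abs_self _)).trans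
    (Finset.single_le_sum (f := fun k => |C k|) (fun _ _ => abs_nonneg _) (Finset.mem_univ k))

end Compact

/-! ### Bounds that are uniform in the dimension of the hyperbolic space -/

namespace IsRicciFlow

variable {n : ℕ} {M : Type*} [TopologicalSpace M] [ChartedSpace (EuclideanSpace ℝ (Fin n)) M]
  [IsManifold (𝓡 n) ∞ M]
  {T : ℝ} {g : ℝ → SmoothMetric n M} (hflow : IsRicciFlow g T)
  {φ : OpenPartialHomeomorph M (EuclideanSpace ℝ (Fin n))}
  (hφ : φ ∈ IsManifold.maximalAtlas (𝓡 n) ∞ M) (N : ℕ)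

/-- `M_{ij}` over the ring of smooth functions. -/
def harnackMFun (i j : Fin n) : SmoothFun (thermoDomain φ T N) :=
  (hflow.baseMetric hφ N).lap (hflow.baseMetric hφ N).ric i j
    - (1 / 2 : ℝ) • (hflow.baseMetric hφ N).hess (hflow.baseMetric hφ N).scal i j
    + (2 : ℝ) • (hflow.baseMetric hφ N).riemRic i j - (hflow.baseMetric hφ N).ricSq i j
    + (1 / 2 : ℝ) • (Ring.inverse (timeFun N) * (hflow.baseMetric hφ N).ric i j)

lemma represents_ricSq (i j : Fin n) : Represents (basePt N)
    (fun s z => ∑ k, ∑ l, (chartPatch (g s) φ).inv k l z * (chartPatch (g s) φ).ricci i k z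
      * (chartPatch (g s) φ).ricci l j z) ((hflow.baseMetric hφ N).ricSq i j) :=
  have R := hflow.baseMetric_rep hφ N
  .sum fun k => .sum fun l => ((R.inv k l).mul (R.ricci i k)).mul (R.ricci l j)

lemma represents_harnackM (i j : Fin n) : Represents (basePt N)
    (fun s z => (chartPatch (g s) φ).harnackM s i j z) (hflow.harnackMFun hφ N i j) := by
  have R := hflow.baseMetric_rep hφ N
  have h1 : Represents (basePt N) (fun s z => 1 / (2 * s) * (chartPatch (g s) φ).ricci i j z)
      ((1 / 2 : ℝ) • (Ring.inverse (timeFun N) * (hflow.baseMetric hφ N).ric i j)) := by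
    intro p
    refine Eq.trans ?_ (((represents_inv_time N).mul (R.ricci i j)).const_mul (1 / 2) p)
    dsimp only
    rw [one_div, one_div, mul_inv, mul_assoc]
  exact ((((R.lap R.ricci i j).sub ((R.hess R.scalar i j).const_mul (1 / 2))).add
    ((Represents.sum fun k => Represents.sum fun l =>
      (R.riemann i k j l).mul (R.ricciUp k l)).const_mul 2)).sub
    (hflow.represents_ricSq hφ N i j)).add h1

/-- The function `∂_t R + R / t` over the ring of smooth functions. -/
def dtScalFun : SmoothFun (thermoDomain φ T N) :=
  thermoDeriv φ T N i0 (hflow.baseMetric hφ N).scal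
    + Ring.inverse (timeFun N) * (hflow.baseMetric hφ N).scal

lemma represents_dtScal : Represents (basePt N)
    (fun s z => derivWithin (fun r => (chartPatch (g r) φ).scalar z) (Ioc 0 T) s
      + s⁻¹ * (chartPatch (g s) φ).scalar z) (hflow.dtScalFun hφ N) :=
  (represents_time N (hflow.baseMetric_rep hφ N).scalar).add
    ((represents_inv_time N).mul (hflow.baseMetric_rep hφ N).scalar)

/-- The coefficient `R - N / (2t)` is comparable to `-N` for large `N`. -/
lemma lapseFun_le (hT : 0 < T) {C : ℝ} (hC : ∀ x ∈ φ.target, ∀ t ∈ Ioc 0 T,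
    |(chartPatch (g t) φ).scalar x| ≤ C) (hN : 4 * T * C ≤ N) (p : thermoDomain φ T N) :
    (hflow.lapseFun hφ N).1 p ≤ -(N / (4 * T)) := by
  rw [lapseFun_apply]
  have h1 := (abs_le.mp (hC _ p.2.1 _ p.2.2.2)).2
  have h2 : (N : ℝ) / (2 * T) ≤ N / (2 * p.1.2.2) := by
    have := p.2.2.2.1
    have := p.2.2.2.2
    gcongr
  have h3 : C ≤ N / (4 * T) := by
    rw [le_div_iff₀ (by positivity)]; linarith
  have h4 : (N : ℝ) / (2 * T) = N / (4 * T) + N / (4 * T) := by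
    field_simp; ring
  linarith

/-- On a compact set of `(x, t)`, the thermostats obey bounds that are uniform in `N`. -/
lemma exists_bound (hT : 0 < T) {C : ℝ} (hC : ∀ x ∈ φ.target, ∀ t ∈ Ioc 0 T,
    |(chartPatch (g t) φ).scalar x| ≤ C) {K : Set (EuclideanSpace ℝ (Fin n) × ℝ)}
    (hK : IsCompact K) (hKs : K ⊆ φ.target ×ˢ Ioc 0 T) :
    ∃ B : ℝ, ∀ (N : ℕ) (hN : N ≠ 0) (hG : ∀ p, (hflow.lapseFun hφ N).1 p ≠ 0), 4 * T * C ≤ N →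
      ∀ p : thermoDomain φ T N, (p.1.1, p.1.2.2) ∈ K →
        (hflow.thermostat hφ N hN hG).Bound (SmoothFun.eval p) B := by
  have R := fun N => hflow.baseMetric_rep hφ N
  obtain ⟨C1, p1, h1⟩ := exists_forall_abs_le (κ := Fin n × Fin n)
    (fun k => (R 0).inv k.1 k.2) hK hKs
  obtain ⟨C2, p2, h2⟩ := exists_forall_abs_le (κ := Fin n × Fin n)
    (fun k => (R 0).ricci k.1 k.2) hK hKs
  obtain ⟨C3, p3, h3⟩ := exists_forall_abs_le (κ := Unit) (fun _ => (R 0).scalar) hK hKs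
  obtain ⟨C4, p4, h4⟩ := exists_forall_abs_le (κ := Fin n)
    (fun i => (R 0).pd i _ _ (R 0).scalar) hK hKs
  obtain ⟨C5, p5, h5⟩ := exists_forall_abs_le (κ := Unit)
    (fun _ => hflow.represents_dtScal hφ 0) hK hKs
  obtain ⟨C6, p6, h6⟩ := exists_forall_abs_le (κ := Fin n × Fin n)
    (fun k => hflow.represents_ricSq hφ 0 k.1 k.2) hK hKs
  obtain ⟨C7, p7, h7⟩ := exists_forall_abs_le (κ := Fin n × Fin n)
    (fun k => hflow.represents_harnackM hφ 0 k.1 k.2) hK hKs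
  -- the summand `4 * T` bounds `N * |ε|`, and also `t`
  refine ⟨1 + C1 + C2 + C3 + C4 + C5 + C6 + C7 + 4 * T, fun N hN hG hNC p hp => ?_⟩
  have hN0 : (0 : ℝ) < N := by exact_mod_cast Nat.pos_of_ne_zero hN
  refine ⟨by linarith, ?_, ?_, fun i j => ?_, fun i j => ?_, ?_, fun i => ?_, ?_, fun i j => ?_,
    fun i j => ?_⟩
  · set E := SmoothFun.eval p (hflow.thermostat hφ N hN hG).ε with hE
    have e1 : E * (hflow.lapseFun hφ N).1 p = 1 := by
      have := congrArg (SmoothFun.eval p) (hflow.thermostat hφ N hN hG).ε_mul_G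
      rwa [map_mul, map_one] at this
    have e2 := hflow.lapseFun_le hφ N hT hC hNC p
    have e3 : (N : ℝ) / (4 * T) ≤ |(hflow.lapseFun hφ N).1 p| := by
      rw [le_abs]; right; linarith
    have e4 : |E| * |(hflow.lapseFun hφ N).1 p| = 1 := by rw [← abs_mul, e1, abs_one]
    have e5 : |E| * (N / (4 * T)) ≤ 1 := by
      rw [← e4]; gcongr
    have e6 : |E| * N ≤ 4 * T := by
      rw [← mul_div_assoc, div_le_one (by positivity)] at e5
      exact e5
    rw [le_div_iff₀ hN0]
    linarith
  · have e1 : SmoothFun.eval p (hflow.thermostat hφ N hN hG).t = p.1.2.2 := rfl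
    rw [e1, abs_of_pos p.2.2.2.1]
    linarith [p.2.2.2.2]
  · have e1 := h1 (i, j) _ hp
    have e2 : _ = SmoothFun.eval p ((hflow.thermostat hφ N hN hG).gi i j) := (R N).inv i j p
    rw [← e2]
    exact e1.trans (by linarith)
  · have e1 := h2 (i, j) _ hp
    have e2 : _ = SmoothFun.eval p ((hflow.thermostat hφ N hN hG).base.ric i j) :=
      (R N).ricci i j p
    rw [← e2]
    exact e1.trans (by linarith)
  · have e1 := h3 () _ hp
    have e2 : _ = SmoothFun.eval p (hflow.thermostat hφ N hN hG).base.scal := (R N).scalar p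
    rw [← e2]
    exact e1.trans (by linarith)
  · have e1 := h4 i _ hp
    have e2 : _ = SmoothFun.eval p ((hflow.thermostat hφ N hN hG).D (iM i)
      (hflow.thermostat hφ N hN hG).base.scal) := (R N).pd i _ _ (R N).scalar p
    rw [← e2]
    exact e1.trans (by linarith)
  · have e1 := h5 () _ hp
    have e2 : _ = SmoothFun.eval p (hflow.thermostat hφ N hN hG).dtScal :=
      hflow.represents_dtScal hφ N p
    rw [← e2]
    exact e1.trans (by linarith)
  · have e1 := h6 (i, j) _ hp
    have e2 : _ = SmoothFun.eval p ((hflow.thermostat hφ N hN hG).base.ricSq i j) :=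
      hflow.represents_ricSq hφ N i j p
    rw [← e2]
    exact e1.trans (by linarith)
  · have e1 := h7 (i, j) _ hp
    have e2 : _ = SmoothFun.eval p ((hflow.thermostat hφ N hN hG).harnackM i j) :=
      hflow.represents_harnackM hφ N i j p
    rw [← e2]
    exact e1.trans (by linarith)

end IsRicciFlow

end

theorem theorem1p2 {n : ℕ} {M : Type*} [TopologicalSpace M] [T2Space M]
    [SecondCountableTopology M] [ChartedSpace (EuclideanSpace ℝ (Fin n)) M]
    [IsManifold (𝓡 n) ∞ M]
    (T : ℝ) (hT : 0 < T) (g : ℝ → SmoothMetric n M) (hflow : IsRicciFlow g T)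
    (hcomplete : ∀ t ∈ Ioc 0 T, SmoothMetric.IsComplete (g t))
    (hbounded : HasBoundedCurvature g T) :
    -- for large `N` the component `g̃_00` is negative on all of `M × ℍ^N × (0, T]`
    (∀ᶠ N : ℕ in atTop, ∀ φ ∈ IsManifold.maximalAtlas (𝓡 n) ∞ M,
      ∀ z ∈ (thermostatPatch g T φ N).domain, (thermostatPatch g T φ N).coeff z i0 i0 < 0) ∧
    -- curvature, up to errors of order `1 / N` that are uniform on compact sets of `(x, t)`
    (∀ φ ∈ IsManifold.maximalAtlas (𝓡 n) ∞ M,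
      ∀ K ⊆ φ.target ×ˢ Ioc 0 T, IsCompact K → ∃ C : ℝ, ∀ᶠ N : ℕ in atTop,
        ∀ x t, (x, t) ∈ K → ∀ y ∈ Metric.ball (0 : EuclideanSpace ℝ (Fin N)) 1,
          -- Ricci flatness
          (∀ V : TIdx n N → ℝ,
            |∑ a, ∑ b, (thermostatPatch g T φ N).ricci a b (x, y, t) * V a * V b|
              ≤ C / N * vecNormSq y V) ∧
          -- the components of the curvature tensor
          (∀ i j k l : Fin n,
            |(thermostatPatch g T φ N).riemann (iM i) (iM j) (iM k) (iM l) (x, y, t)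
              - (chartPatch (g t) φ).riemann i j k l x| ≤ C / N) ∧
          (∀ i j k : Fin n,
            |(thermostatPatch g T φ N).riemann (iM i) (iM j) i0 (iM k) (x, y, t)
              - (chartPatch (g t) φ).harnackP i j k x| ≤ C / N) ∧
          (∀ i j : Fin n,
            |(thermostatPatch g T φ N).riemann (iM i) i0 (iM j) i0 (x, y, t)
              - (chartPatch (g t) φ).harnackM t i j x| ≤ C / N) ∧
          -- the full curvature operator
          (∀ W : TIdx n N → TIdx n N → ℝ, (∀ a b, W a b = -W b a) →
            |(∑ a, ∑ b, ∑ c, ∑ d,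
                (thermostatPatch g T φ N).riemann a b c d (x, y, t) * W a b * W c d)
              - (chartPatch (g t) φ).harnackZ t (fun i j => W (iM i) (iM j))
                  (fun k => 2 * W i0 (iM k)) x|
              ≤ C / N * bivecNormSq y W)) := by
  obtain ⟨C₀, hC₀, hscal⟩ := hbounded.scalar_le
  have hneg : ∀ N : ℕ, N ≠ 0 → 4 * T * C₀ ≤ N → ∀ φ (hφ : φ ∈ IsManifold.maximalAtlas (𝓡 n) ∞ M)
      (p : thermoDomain φ T N), (hflow.lapseFun hφ N).1 p < 0 := by
    intro N hN hNC φ hφ p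
    refine (hflow.lapseFun_le hφ N hT (hscal φ hφ) hNC p).trans_lt ?_
    have : (0 : ℝ) < N := by exact_mod_cast Nat.pos_of_ne_zero hN
    rw [neg_lt_zero]
    positivity
  have hlarge : ∀ᶠ N : ℕ in atTop, N ≠ 0 ∧ 4 * T * C₀ ≤ N :=
    (eventually_ne_atTop 0).and (tendsto_natCast_atTop_atTop.eventually_ge_atTop _)
  refine ⟨?_, ?_⟩
  · filter_upwards [hlarge] with N hN φ hφ z hz
    have h := hneg N hN.1 hN.2 φ hφ ⟨z, hz⟩
    rwa [IsRicciFlow.lapseFun_apply] at h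
  · intro φ hφ K hKs hK
    obtain ⟨B, hB⟩ := hflow.exists_bound hφ hT (hscal φ hφ) hK hKs
    refine ⟨4 * ((n : ℝ) ^ 2 + 4) * Thermostat.errConst n B, ?_⟩
    filter_upwards [hlarge] with N hN x t hxt y hy
    have hG : ∀ p, (hflow.lapseFun hφ N).1 p ≠ 0 := fun p => (hneg N hN.1 hN.2 φ hφ p).ne
    let p : thermoDomain φ T N := ⟨(x, y, t), (hKs hxt).1, hy, (hKs hxt).2⟩
    have hb := hB N hN.1 hG hN.2 p hxt
    set H := hflow.thermostat hφ N hN.1 hG with hH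
    set e := SmoothFun.eval p with he
    have R := hflow.thermostat_rep hφ hN.1 hG
    have R' := hflow.baseMetric_rep hφ N
    have hric : ∀ a b, (thermostatPatch g T φ N).ricci a b (x, y, t) = e (H.full.ric a b) :=
      fun a b => R.ricci a b p
    have hriem : ∀ a b c d, (thermostatPatch g T φ N).riemann a b c d (x, y, t)
        = e (H.full.riem a b c d) := fun a b c d => R.riemann a b c d p
    have hRm : ∀ i j k l, (chartPatch (g t) φ).riemann i j k l x = e (H.base.riem i j k l) :=
      fun i j k l => R'.riemann i j k l p
    have hP : ∀ i j k, (chartPatch (g t) φ).harnackP i j k x = e (H.harnackP i j k) :=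
      fun i j k => R'.harnackP i j k p
    have hM : ∀ i j, (chartPatch (g t) φ).harnackM t i j x = e (H.harnackM i j) :=
      fun i j => hflow.represents_harnackM hφ N i j p
    have hlam : e H.lam = confFactor y := hflow.thermostat_lam_apply hφ hN.1 hG p
    have hE := hb.errConst_nonneg
    have hle : Thermostat.errConst n B / N
        ≤ 4 * ((n : ℝ) ^ 2 + 4) * Thermostat.errConst n B / N := by
      rw [mul_div_assoc]
      nlinarith [sq_nonneg (n : ℝ)]
    refine ⟨fun V => ?_, fun i j k l => ?_, fun i j k => ?_, fun i j => ?_, fun W hW => ?_⟩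
    · have h := hb.ricci_le V
      simp only [hric]
      rw [vecNormSq_eq, ← hlam]
      refine h.trans ?_
      have h1 := H.lam_nonneg e
      have h2 : 0 ≤ ∑ i, V (iM i) ^ 2 + e H.lam * ∑ α, V (iH α) ^ 2 + V i0 ^ 2 := by positivity
      refine mul_le_mul_of_nonneg_right ?_ h2
      rw [mul_div_assoc, mul_div_assoc]
      gcongr
      norm_num
    · rw [hriem, hRm]
      exact (hb.riem_MMMM i j k l).trans hle
    · rw [hriem, hP]
      exact (hb.riem_MM0M i j k).trans hle
    · rw [hriem, hM]
      exact (hb.riem_M0M0 i j).trans hle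
    · have h := hb.curvature_le hW
      simp only [hriem]
      rw [bivecNormSq_eq y hW, ← hlam]
      have hZ : (chartPatch (g t) φ).harnackZ t (fun i j => W (iM i) (iM j))
          (fun k => 2 * W i0 (iM k)) x
          = (∑ i, ∑ j, ∑ k, ∑ l, e (H.base.riem i j k l) * W (iM i) (iM j) * W (iM k) (iM l))
            + 4 * (∑ i, ∑ j, ∑ k, e (H.harnackP i j k) * W (iM i) (iM j) * W i0 (iM k))
            + 4 * (∑ i, ∑ j, e (H.harnackM i j) * W i0 (iM i) * W i0 (iM j)) := by
        simp only [MetricPatch.harnackZ, hRm, hP, hM, Finset.mul_sum]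
        congr 1
        · congr 1
          refine Finset.sum_congr rfl fun i _ => Finset.sum_congr rfl fun j _ =>
            Finset.sum_congr rfl fun k _ => ?_
          ring
        · refine Finset.sum_congr rfl fun i _ => Finset.sum_congr rfl fun j _ => ?_
          ring
      rw [hZ]
      exact h
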